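/- **Proposition.** Let $p\in[1,\infty)$. There is a constant $C$, depending only on $p$, with the following property. Let $\mathcal W$ be a smooth Riemannian manifold (without boundary, Hausdorff and second countable) of any dimension $m-2\ge 0$, and let $\mathcal N$ be a smooth Riemannian manifold (without boundary), isometrically embedded in some $\mathbb R^\nu$. Put $Q=\mathcal W\times(0,1)\times(0,1)$, endowed with the product Riemannian metric, and write its points as $(x',x_{m-1},x_m)$. A map $U\colon Q\to\mathcal N$ belongs to $\dot W^{1,p}(Q,\mathcal N)$ if, as an $\mathbb R^\nu$-valued map, it is weakly differentiable in local charts (it and its weak derivative are locally integrable in the charts) and $\int_Q|\mathrm DU|^p<\infty$, the norm (Hilbert–Schmidt) and the measure being those induced by the Riemannian metrics. The trace $\operatorname{tr}U$ of such a map on one of the faces $\mathcal W\times(0,1)\times\{0\}$, $\mathcal W\times\{0\}\times(0,1)$, $\mathcal W\times\{1\}\times(0,1)$ of $Q$ is the $\mathbb R^\nu$-valued function $v$ on the face, unique up to a null set, such that, when $(y,t)\in Q$ denotes the point at distance $t$ from the face above its point $y$, one has $$\lim_{\varepsilon\to0^+}\frac1\varepsilon\int_K\int_0^\varepsilon|U(y,t)-v(y)|\,\mathrm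 dt\,\mathrm dy=0$$ for every compact subset $K$, contained in the domain of a chart, of the (relatively open) face. Let $U_0,U_1\in\dot W^{1,p}(Q,\mathcal N)$ have equal traces on the bottom face, $$\operatorname{tr}_{\mathcal W\times(0,1)\times\{0\}}U_0=\operatorname{tr}_{\mathcal W\times(0,1)\times\{0\}}U_1,$$ and define $U_*\colon Q\to\mathcal N$ by $$U_*(x',x_{m-1},x_m)=\begin{cases}U_0(x',2x_{m-1},x_m-2x_{m-1})&\text{if }x_{m-1}\le x_m/2,\\ U_1(x',x_m,2x_{m-1}-x_m)&\text{if }x_m/2<x_{m-1}\le x_m,\\ U_1(x',x_{m-1},x_m)&\text{if }x_m<x_{m-1},\end{cases}$$ where on the null set $\{x_{m-1}=x_m/2\}$, on which the formula leaves $Q$, the value of $U_*$ in $\mathcal N$ is arbitrary. Then $U_*\in\dot W^{1,p}(Q,\mathcal N)$, the following traces exist and satisfy $$\operatorname{tr}_{\mathcal W\times(0,1)\times\{0\}}U_*=\operatorname{tr}_{\mathcal W\times(0,1)\times\{0\}}U_0=\operatorname{tr}_{\mathcal W\times(0,1)\times\{0\}}U_1,$$ $$\operatorname{tr}_{\mathcal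 W\times\{0\}\times(0,1)}U_*=\operatorname{tr}_{\mathcal W\times\{0\}\times(0,1)}U_0,\qquad \operatorname{tr}_{\mathcal W\times\{1\}\times(0,1)}U_*=\operatorname{tr}_{\mathcal W\times\{1\}\times(0,1)}U_1,$$ and $$\int_Q|\mathrm DU_*|^p\le C\int_Q\bigl(|\mathrm DU_0|^p+|\mathrm DU_1|^p\bigr).$$ -/

import Mathlib

open MeasureTheory Set Filter
open scoped ContDiff Manifold Bundle Topology ENNReal NNReal

noncomputable section

namespace SobolevFolding

/-! ### Weak derivatives in Euclidean coordinates -/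

/-- `f` is weakly differentiable on the open set `Ω` of a finite-dimensional vector space, with weak
derivative `f'`: both are locally integrable on `Ω` and
`∫ ∂_v η • f = - ∫ η • f' v` for all smooth `η` compactly supported in `Ω` and all directions `v`.
Only the values of `f` and `f'` almost everywhere on `Ω` matter. -/
def HasWeakDerivOn {X F : Type*} [NormedAddCommGroup X] [NormedSpace ℝ X] [MeasureSpace X]
    [NormedAddCommGroup F] [NormedSpace ℝ F]
    (Ω : Set X) (f : X → F) (f' : X → X →ₗ[ℝ] F) : Prop :=
  LocallyIntegrableOn f Ω volume ∧
  ∀ v : X, LocallyIntegrableOn (fun x => f' x v) Ω volume ∧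
    ∀ η : X → ℝ, ContDiff ℝ ∞ η → HasCompactSupport η → tsupport η ⊆ Ω →
      ∫ x, (fderiv ℝ η x v) • f x = - ∫ x, η x • f' x v

/-! ### The product manifold `W × (0,1) × (0,1)`

A point of `W × ℝ × ℝ` is written `(x', s, t)` with `s = x_{m-1}`, `t = x_m`, where
`m = d + 2` and `d = dim W`.  Maps on `W × (0,1) × (0,1)` are represented by maps on `W × ℝ × ℝ`
whose values outside `W × (0,1) × (0,1)` are irrelevant. -/

/-- The domain `W × (0,1) × (0,1)`. -/
def strip (W : Type*) : Set (W × ℝ × ℝ) := univ ×ˢ (Ioo (0 : ℝ) 1 ×ˢ Ioo (0 : ℝ) 1)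

/-- The folded map `U_*` built from `U₀` and `U₁`. -/
def fold {W N : Type*} (U₀ U₁ : W × ℝ × ℝ → N) : W × ℝ × ℝ → N := fun z =>
  if z.2.1 ≤ z.2.2 / 2 then U₀ (z.1, 2 * z.2.1, z.2.2 - 2 * z.2.1)
  else if z.2.1 ≤ z.2.2 then U₁ (z.1, z.2.2, 2 * z.2.1 - z.2.2)
  else U₁ z

section Domain

variable {d : ℕ} {W : Type*} [TopologicalSpace W] [ChartedSpace (EuclideanSpace ℝ (Fin d)) W]

/-- The inverse chart `φ⁻¹ × id` of the product manifold given by a chart `φ` of `W`. -/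
def prodInv (φ : OpenPartialHomeomorph W (EuclideanSpace ℝ (Fin d)))
    (u : EuclideanSpace ℝ (Fin d) × ℝ × ℝ) : W × ℝ × ℝ := (φ.symm u.1, u.2)

/-- The derivative of the inverse chart `φ⁻¹` at `u`, from `ℝᵈ` to the tangent space of `W`. -/
def chartInvDeriv (φ : OpenPartialHomeomorph W (EuclideanSpace ℝ (Fin d)))
    (u : EuclideanSpace ℝ (Fin d)) :
    EuclideanSpace ℝ (Fin d) →ₗ[ℝ] TangentSpace (𝓡 d) (φ.symm u) :=
  (mfderiv (𝓡 d) (𝓡 d) φ.symm u).toLinearMap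

/-- `D` is a weak derivative of `U : W × (0,1) × (0,1) → F`: in every chart `φ × id`, with `φ` in
the maximal smooth atlas of `W`, the local representative `U ∘ (φ × id)⁻¹` is weakly differentiable
and its weak derivative is the local representative of `D`. -/
def IsWeakDeriv {F : Type*} [NormedAddCommGroup F] [NormedSpace ℝ F]
    (U : W × ℝ × ℝ → F)
    (D : (z : W × ℝ × ℝ) → (TangentSpace (𝓡 d) z.1 × ℝ × ℝ) →ₗ[ℝ] F) : Prop :=
  ∀ φ ∈ IsManifold.maximalAtlas (𝓡 d) ∞ W,
    HasWeakDerivOn (φ.target ×ˢ (Ioo (0 : ℝ) 1 ×ˢ Ioo (0 : ℝ) 1))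
      (fun u => U (prodInv φ u))
      (fun u => D (prodInv φ u) ∘ₗ LinearMap.prodMap (chartInvDeriv φ u.1) LinearMap.id)

/-! ### Traces on the faces of `W × (0,1) × (0,1)` -/

/-- `v : W × (0,1) → F` is the trace of `U` on a face of `W × (0,1) × (0,1)`.  The face is described
by `P`: the point `(x', P r ε)` lies at distance `ε` from the face, and `(x', r) ∈ W × (0,1)` are
the coordinates of its projection on the face.  The trace is understood, as usual, as the
limit of `U` in `L¹_loc` (in charts of the face) when approaching the face, in average:
`(1/ε) ∫_K ∫_0^ε |U(x', P r t) - v(x', r)| dt d(x', r) → 0` for every compact set `K`.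
This determines `v` almost everywhere on `W × (0,1)`. -/
def IsTrace {F : Type*} [NormedAddCommGroup F] (d : ℕ) {W : Type*} [TopologicalSpace W]
    [ChartedSpace (EuclideanSpace ℝ (Fin d)) W] (P : ℝ → ℝ → ℝ × ℝ)
    (U : W × ℝ × ℝ → F) (v : W × ℝ → F) : Prop :=
  ∀ φ ∈ IsManifold.maximalAtlas (𝓡 d) ∞ W,
    AEStronglyMeasurable (fun q : EuclideanSpace ℝ (Fin d) × ℝ => v (φ.symm q.1, q.2))
      (volume.restrict (φ.target ×ˢ Ioo (0 : ℝ) 1)) ∧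
    ∀ K : Set (EuclideanSpace ℝ (Fin d) × ℝ), IsCompact K → K ⊆ φ.target ×ˢ Ioo (0 : ℝ) 1 →
      Tendsto (fun ε : ℝ => (ENNReal.ofReal ε)⁻¹ *
          ∫⁻ q in K, ∫⁻ t in Ioo 0 ε, ‖U (φ.symm q.1, P q.2 t) - v (φ.symm q.1, q.2)‖ₑ)
        (𝓝[>] 0) (𝓝 0)

/-- The face `W × (0,1) × {0}`. -/
def bottomFace (r ε : ℝ) : ℝ × ℝ := (r, ε)

/-- The face `W × {0} × (0,1)`. -/
def leftFace (r ε : ℝ) : ℝ × ℝ := (ε, r)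

/-- The face `W × {1} × (0,1)`. -/
def rightFace (r ε : ℝ) : ℝ × ℝ := (1 - ε, r)

/-- `U` and `V` have a trace on the face `P`, and these traces are equal. -/
def SameTrace {F : Type*} [NormedAddCommGroup F] (d : ℕ) {W : Type*} [TopologicalSpace W]
    [ChartedSpace (EuclideanSpace ℝ (Fin d)) W] (P : ℝ → ℝ → ℝ × ℝ)
    (U V : W × ℝ × ℝ → F) : Prop :=
  ∃ v : W × ℝ → F, IsTrace d P U v ∧ IsTrace d P V v

/-! ### Riemannian measure and Sobolev energy -/

section Riemannian

variable [Bundle.RiemannianBundle (fun x : W => TangentSpace (𝓡 d) x)]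

/-- The density `√(det g_{ij})` of the Riemannian metric in the chart `φ`. -/
def chartDensity (φ : OpenPartialHomeomorph W (EuclideanSpace ℝ (Fin d)))
    (u : EuclideanSpace ℝ (Fin d)) : ℝ :=
  √(Matrix.det (Matrix.of fun i j : Fin d =>
    inner ℝ (chartInvDeriv φ u (EuclideanSpace.single i 1))
      (chartInvDeriv φ u (EuclideanSpace.single j 1))))

/-- The Riemannian measure of `W × ℝ × ℝ`, restricted to the domain of the chart `φ × id`:
`√(det g_{ij}(u)) du ds dt`, transported to `W × ℝ × ℝ`. -/
def chartMeasure [MeasurableSpace W]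
    (φ : OpenPartialHomeomorph W (EuclideanSpace ℝ (Fin d))) : Measure (W × ℝ × ℝ) :=
  ((volume.restrict (φ.target ×ˢ (univ : Set (ℝ × ℝ)))).withDensity
    fun u => ENNReal.ofReal (chartDensity φ u.1)).map (prodInv φ)

/-- The Riemannian measure of the product `W × ℝ × ℝ`: the measure which is given by
`chartMeasure φ` in the domain of every chart `φ × id`.  Since the chart measures agree on the
overlaps of the charts, it is the supremum (in the lattice of measures) of the chart measures. -/
def riemannianMeasure (d : ℕ) (W : Type*) [TopologicalSpace W]
    [ChartedSpace (EuclideanSpace ℝ (Fin d)) W]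
    [Bundle.RiemannianBundle (fun x : W => TangentSpace (𝓡 d) x)] [MeasurableSpace W] :
    Measure (W × ℝ × ℝ) :=
  ⨆ φ ∈ IsManifold.maximalAtlas (𝓡 d) ∞ W, chartMeasure φ

/-- The tangent spaces of `W`, which are copies of `ℝᵈ`, are finite-dimensional. -/
instance tangentSpaceFiniteDimensional (x : W) :
    FiniteDimensional ℝ (TangentSpace (𝓡 d) x) :=
  inferInstanceAs (FiniteDimensional ℝ (EuclideanSpace ℝ (Fin d)))

/-- The Euclidean (Hilbert–Schmidt) norm of a linear map on `T_x W × ℝ × ℝ` with respect to the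
product metric: the root of the sum of the `|L e|²` for `e` in an orthonormal basis. -/
def derivNorm {F : Type*} [NormedAddCommGroup F] [NormedSpace ℝ F] {x : W}
    (L : (TangentSpace (𝓡 d) x × ℝ × ℝ) →ₗ[ℝ] F) : ℝ :=
  √((∑ i, ‖L (stdOrthonormalBasis ℝ (TangentSpace (𝓡 d) x) i, 0, 0)‖ ^ 2)
    + ‖L (0, 1, 0)‖ ^ 2 + ‖L (0, 0, 1)‖ ^ 2)

/-- `∫_{W × (0,1) × (0,1)} |D|^p` with respect to the Riemannian measure. -/
def derivEnergy [MeasurableSpace W] {F : Type*} [NormedAddCommGroup F] [NormedSpace ℝ F] (p : ℝ)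
    (D : (z : W × ℝ × ℝ) → (TangentSpace (𝓡 d) z.1 × ℝ × ℝ) →ₗ[ℝ] F) : ℝ≥0∞ :=
  ∫⁻ z in strip W, ENNReal.ofReal (derivNorm (D z) ^ p) ∂(riemannianMeasure d W)

/-- The energy `∫ |D U|^p` of a map `U`.  The weak derivative of `U` is
unique almost everywhere, so that the infimum is its energy; the energy is `∞` when `U` is not
weakly differentiable. -/
def energy (d : ℕ) {W : Type*} [TopologicalSpace W] [ChartedSpace (EuclideanSpace ℝ (Fin d)) W]
    [Bundle.RiemannianBundle (fun x : W => TangentSpace (𝓡 d) x)] [MeasurableSpace W]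
    {F : Type*} [NormedAddCommGroup F] [NormedSpace ℝ F] (p : ℝ) (U : W × ℝ × ℝ → F) : ℝ≥0∞ :=
  ⨅ (D : (z : W × ℝ × ℝ) → (TangentSpace (𝓡 d) z.1 × ℝ × ℝ) →ₗ[ℝ] F) (_ : IsWeakDeriv U D),
    derivEnergy p D

/-- `U` belongs to the homogeneous Sobolev space `Ẇ^{1,p}` of `W × (0,1) × (0,1)`: it is weakly
differentiable with `∫ |D U|^p < ∞`. -/
def MemSobolev (d : ℕ) {W : Type*} [TopologicalSpace W] [ChartedSpace (EuclideanSpace ℝ (Fin d)) W]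
    [Bundle.RiemannianBundle (fun x : W => TangentSpace (𝓡 d) x)] [MeasurableSpace W]
    {F : Type*} [NormedAddCommGroup F] [NormedSpace ℝ F] (p : ℝ) (U : W × ℝ × ℝ → F) : Prop :=
  ∃ D : (z : W × ℝ × ℝ) → (TangentSpace (𝓡 d) z.1 × ℝ × ℝ) →ₗ[ℝ] F,
    IsWeakDeriv U D ∧ derivEnergy p D < ⊤

end Riemannian

end Domain

/-! ### The target manifold -/

/-- `ι` is a smooth isometric embedding of the Riemannian manifold `N` into `ℝ^ν`. -/
structure IsIsometricEmbedding (n : ℕ) {ν : ℕ} {N : Type*} [TopologicalSpace N]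
    [ChartedSpace (EuclideanSpace ℝ (Fin n)) N]
    [Bundle.RiemannianBundle (fun y : N => TangentSpace (𝓡 n) y)]
    (ι : N → EuclideanSpace ℝ (Fin ν)) : Prop where
  contMDiff : ContMDiff (𝓡 n) (𝓡 ν) ∞ ι
  isEmbedding : Topology.IsEmbedding ι
  norm_mfderiv : ∀ (y : N) (w : TangentSpace (𝓡 n) y),
    ‖NormedSpace.fromTangentSpace (ι y) (mfderiv (𝓡 n) (𝓡 ν) ι y w)‖ = ‖w‖

end SobolevFolding

end

/-!
The map `U_*` is obtained from `U₀` and `U₁` by cutting `W × (0,1) × (0,1)` along the two interfaces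
`{s = t / 2}` and `{s = t}` and by composing, on each piece, one of the two maps with a linear map
acting on `(s, t)` only. So everything but the behaviour at the interfaces and at the faces is a
linear change of variables, and the constant depends on `p` only: the two linear maps are fixed maps
of the plane, with fixed norms and determinants.

*Gluing.* At `{s = t}` the two formulas are exchanged by a linear map which fixes the interface and
swaps its two sides. At `{s = t / 2}` both formulas degenerate to the bottom face, and the jump in
average between the two sides is a multiple of `(1/ε) ∫∫ |U₀ - U₁|` in a layer of height `ε` above the
bottom, which tends to `0` because the traces agree. In both cases `HasWeakDerivOn.glue` applies: a
function which is weakly differentiable off a hyperplane, with vanishing jump in average, is weakly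
differentiable across it. It is proved by integrating by parts against `η χ_ε`, where `χ_ε` is a
cutoff vanishing near the hyperplane, the two sides being matched so that the terms `∇χ_ε` pair up
into the jump. The result in charts is `hasWeakDerivOn_fold`.

*Traces.* Near compact subsets of the bottom and right faces `U_*` coincides with `U₁`, so its trace
is that of `U₁`. Near the left face `U_*(x', s, t) = U₀(x', 2 s, t - 2 s)`, a shear of `U₀` fixing
the face, and traces are invariant under such shears by continuity of translations in `L¹`
(`HasEdgeTrace.comp_shear`). The traces of `U₀` on the left and of `U₁` on the right face have to be
shown to exist: on almost every segment a weakly differentiable function is the primitive of its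
derivative (`ae_eq_primitive`), and its initial value is a weighted average (`edgeValue`) along that
segment, a formula that makes sense on the manifold without any choice of chart
(`hasEdgeTrace_edgeValue`).

*Passage to the manifold.* The metric is continuous and nondegenerate in charts, so a weak derivative
of finite energy is integrable in charts over compact subsets of `W` times the whole square
(`integrableOn_chart_of_derivEnergy_lt_top`). Since the maps of the plane act on the second factor,
they scale the Riemannian measure by a constant (`map_shiftEquiv_riemannianMeasure_le`), whence the
energy estimate `exists_derivEnergy_foldDeriv_le`.
-/

set_option linter.unusedSectionVars false

noncomputable section

namespace SobolevFolding

/-! ### Weak derivatives: localization and linear changes of variables -/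

section Generic

variable {X F : Type*} [NormedAddCommGroup X] [NormedSpace ℝ X] [MeasureSpace X]
  [NormedAddCommGroup F] [NormedSpace ℝ F]

lemma integrable_smul_of_tsupport_subset [OpensMeasurableSpace X] {Ω : Set X} {f : X → F}
    (hf : LocallyIntegrableOn f Ω volume) {η : X → ℝ} (hη : Continuous η)
    (hc : HasCompactSupport η) (hs : tsupport η ⊆ Ω) : Integrable (fun x => η x • f x) := by
  have hK : IntegrableOn f (tsupport η) := hf.integrableOn_compact_subset hs hc
  obtain ⟨C, hC⟩ := hc.exists_bound_of_continuous hη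
  have h1 : IntegrableOn (fun x => η x • f x) (tsupport η) :=
    Integrable.bdd_smul hK C hη.aestronglyMeasurable (Eventually.of_forall hC)
  rwa [integrableOn_iff_integrable_of_support_subset] at h1
  intro x hx
  apply subset_tsupport
  intro h
  simp [h] at hx

lemma continuous_fderiv_apply {η : X → ℝ} (hη : ContDiff ℝ ∞ η) (v : X) :
    Continuous fun x => fderiv ℝ η x v :=
  (hη.continuous_fderiv (by simp)).clm_apply continuous_const

lemma integrable_fderiv_smul [OpensMeasurableSpace X] {Ω : Set X} {f : X → F}
    (hf : LocallyIntegrableOn f Ω volume) {η : X → ℝ} (hη : ContDiff ℝ ∞ η)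
    (hc : HasCompactSupport η) (hs : tsupport η ⊆ Ω) (v : X) :
    Integrable (fun x => (fderiv ℝ η x v) • f x) :=
  integrable_smul_of_tsupport_subset hf (continuous_fderiv_apply hη v)
    (hc.of_isClosed_subset (isClosed_tsupport _) (tsupport_fderiv_apply_subset ℝ v))
    ((tsupport_fderiv_apply_subset ℝ v).trans hs)

lemma locallyIntegrableOn_of_eqOn {Ω : Set X} {f g : X → F}
    (hf : LocallyIntegrableOn f Ω volume) (hΩ : MeasurableSet Ω)
    (h : ∀ x ∈ Ω, f x = g x) :
    LocallyIntegrableOn g Ω volume := by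
  intro x hx
  obtain ⟨u, hu, hfu⟩ := hf x hx
  refine ⟨u ∩ Ω, inter_mem hu self_mem_nhdsWithin, ?_⟩
  have h1 : IntegrableOn f (u ∩ Ω) := hfu.mono_set inter_subset_left
  refine Integrable.congr h1 ?_
  have : ∀ᵐ x ∂(volume.restrict u).restrict Ω, x ∈ Ω := ae_restrict_mem hΩ
  rw [Measure.restrict_restrict hΩ, inter_comm] at this
  filter_upwards [this] with x hx using h x hx

lemma HasWeakDerivOn.congr {Ω : Set X} {f g : X → F} {f' g' : X → X →ₗ[ℝ] F}
    (h : HasWeakDerivOn Ω f f') (hΩ : MeasurableSet Ω) (hfg : ∀ x ∈ Ω, f x = g x)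
    (hfg' : ∀ x ∈ Ω, f' x = g' x) : HasWeakDerivOn Ω g g' := by
  refine ⟨locallyIntegrableOn_of_eqOn h.1 hΩ hfg, fun v =>
    ⟨locallyIntegrableOn_of_eqOn (h.2 v).1 hΩ fun x hx => by rw [hfg' x hx], fun η hη hc hs => ?_⟩⟩
  have e := (h.2 v).2 η hη hc hs
  rw [integral_congr_ae, e, neg_inj]
  · refine integral_congr_ae (Eventually.of_forall fun x => ?_)
    by_cases hx : x ∈ tsupport η
    · simp only [hfg' x (hs hx)]
    · simp [image_eq_zero_of_notMem_tsupport hx]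
  · refine Eventually.of_forall fun x => ?_
    by_cases hx : x ∈ tsupport η
    · simp only [hfg x (hs hx)]
    · simp [image_eq_zero_of_notMem_tsupport
        (fun h => hx (tsupport_fderiv_apply_subset ℝ v h))]

lemma HasWeakDerivOn.mono {Ω Ω' : Set X} {f : X → F} {f' : X → X →ₗ[ℝ] F}
    (h : HasWeakDerivOn Ω f f') (hsub : Ω' ⊆ Ω) : HasWeakDerivOn Ω' f f' :=
  ⟨h.1.mono_set hsub, fun v => ⟨(h.2 v).1.mono_set hsub, fun η hη hc hs =>
    (h.2 v).2 η hη hc (hs.trans hsub)⟩⟩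

lemma locallyIntegrableOn_union_of_isOpen {Ω₁ Ω₂ : Set X} (h₁ : IsOpen Ω₁) (h₂ : IsOpen Ω₂)
    {f : X → F} (hf₁ : LocallyIntegrableOn f Ω₁ volume) (hf₂ : LocallyIntegrableOn f Ω₂ volume) :
    LocallyIntegrableOn f (Ω₁ ∪ Ω₂) volume := by
  rintro x (hx | hx)
  · have := hf₁ x hx
    rw [h₁.nhdsWithin_eq hx] at this
    rwa [(h₁.union h₂).nhdsWithin_eq (Or.inl hx)]
  · have := hf₂ x hx
    rw [h₂.nhdsWithin_eq hx] at this
    rwa [(h₁.union h₂).nhdsWithin_eq (Or.inr hx)]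

/-- A test function supported in a disjoint union of two open sets restricts to a test function on
each of them. -/
lemma indicator_testFunction {Ω₁ Ω₂ : Set X} (h₁ : IsOpen Ω₁) (h₂ : IsOpen Ω₂)
    (hd : Disjoint Ω₁ Ω₂) {η : X → ℝ} (hη : ContDiff ℝ ∞ η) (hc : HasCompactSupport η)
    (hs : tsupport η ⊆ Ω₁ ∪ Ω₂) :
    ContDiff ℝ ∞ (Ω₁.indicator η) ∧ HasCompactSupport (Ω₁.indicator η) ∧
      tsupport (Ω₁.indicator η) ⊆ Ω₁ ∧
      ∀ x v, fderiv ℝ (Ω₁.indicator η) x v = Ω₁.indicator (fun x => fderiv ℝ η x v) x := by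
  have hsub : tsupport (Ω₁.indicator η) ⊆ tsupport η :=
    closure_mono (by rw [support_indicator]; exact inter_subset_right)
  have hsub1 : tsupport (Ω₁.indicator η) ⊆ Ω₁ := by
    intro x hx
    rcases hs (hsub hx) with h | h
    · exact h
    · exfalso
      have : x ∈ closure Ω₁ :=
        closure_mono (by rw [support_indicator]; exact inter_subset_left) hx
      obtain ⟨y, hy2, hy1⟩ := mem_closure_iff.1 this Ω₂ h₂ h
      exact hd.le_bot ⟨hy1, hy2⟩
  have key1 : ∀ x ∈ Ω₁, Ω₁.indicator η =ᶠ[𝓝 x] η := fun x hx => by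
    filter_upwards [h₁.mem_nhds hx] with y hy using indicator_of_mem hy _
  have key2 : ∀ x ∉ Ω₁, Ω₁.indicator η =ᶠ[𝓝 x] 0 := fun x hx =>
    notMem_tsupport_iff_eventuallyEq.1 fun h => hx (hsub1 h)
  refine ⟨contDiff_iff_contDiffAt.2 fun x => ?_, hc.of_isClosed_subset (isClosed_tsupport _) hsub,
    hsub1, fun x v => ?_⟩
  · by_cases hx : x ∈ Ω₁
    · exact hη.contDiffAt.congr_of_eventuallyEq (key1 x hx)
    · exact (contDiffAt_const (c := (0 : ℝ))).congr_of_eventuallyEq (key2 x hx)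
  · by_cases hx : x ∈ Ω₁
    · rw [(key1 x hx).fderiv_eq, indicator_of_mem hx]
    · rw [(key2 x hx).fderiv_eq, indicator_of_notMem hx]; simp

/-- Only disjoint open sets are needed, so no partition of unity is involved. -/
lemma HasWeakDerivOn.union [OpensMeasurableSpace X] {Ω₁ Ω₂ : Set X} (h₁ : IsOpen Ω₁)
    (h₂ : IsOpen Ω₂) (hd : Disjoint Ω₁ Ω₂) {f : X → F} {f' : X → X →ₗ[ℝ] F}
    (hf₁ : HasWeakDerivOn Ω₁ f f') (hf₂ : HasWeakDerivOn Ω₂ f f') :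
    HasWeakDerivOn (Ω₁ ∪ Ω₂) f f' := by
  refine ⟨locallyIntegrableOn_union_of_isOpen h₁ h₂ hf₁.1 hf₂.1, fun v =>
    ⟨locallyIntegrableOn_union_of_isOpen h₁ h₂ (hf₁.2 v).1 (hf₂.2 v).1, fun η hη hc hs => ?_⟩⟩
  obtain ⟨a1, a2, a3, a4⟩ := indicator_testFunction h₁ h₂ hd hη hc hs
  obtain ⟨b1, b2, b3, b4⟩ := indicator_testFunction h₂ h₁ hd.symm hη hc (by rwa [union_comm])
  have key : ∀ ζ : X → ℝ, Function.support ζ ⊆ Ω₁ ∪ Ω₂ → ∀ x,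
      ζ x = Ω₁.indicator ζ x + Ω₂.indicator ζ x := fun ζ hζ x => by
    by_cases hx1 : x ∈ Ω₁
    · have : x ∉ Ω₂ := fun h => hd.le_bot ⟨hx1, h⟩
      simp [hx1, this]
    · by_cases hx2 : x ∈ Ω₂
      · simp [hx1, hx2]
      · have : ζ x = 0 := by
          by_contra h
          exact (hζ h).elim hx1 hx2
        simp [hx1, hx2, this]
  have e1 : ∀ x, (fderiv ℝ η x v) • f x = (fderiv ℝ (Ω₁.indicator η) x v) • f x
      + (fderiv ℝ (Ω₂.indicator η) x v) • f x := fun x => by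
    rw [a4, b4, ← add_smul, ← key (fun x => fderiv ℝ η x v)]
    exact (subset_tsupport _).trans ((tsupport_fderiv_apply_subset ℝ v).trans hs)
  have e2 : ∀ x, η x • f' x v = (Ω₁.indicator η x) • f' x v
      + (Ω₂.indicator η x) • f' x v := fun x => by
    rw [← add_smul, ← key η]
    exact (subset_tsupport _).trans hs
  simp_rw [e1, e2]
  rw [integral_add (integrable_fderiv_smul hf₁.1 a1 a2 a3 v)
      (integrable_fderiv_smul hf₂.1 b1 b2 b3 v),
    integral_add (integrable_smul_of_tsupport_subset (hf₁.2 v).1 a1.continuous a2 a3)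
      (integrable_smul_of_tsupport_subset (hf₂.2 v).1 b1.continuous b2 b3),
    (hf₁.2 v).2 _ a1 a2 a3, (hf₂.2 v).2 _ b1 b2 b3, neg_add]

end Generic

section Linear

variable {X Y F : Type*} [NormedAddCommGroup X] [NormedSpace ℝ X]
  [MeasureSpace X] [BorelSpace X]
  [NormedAddCommGroup Y] [NormedSpace ℝ Y] [FiniteDimensional ℝ Y] [MeasureSpace Y] [BorelSpace Y]
  [NormedAddCommGroup F] [NormedSpace ℝ F]

/-- A linear equivalence scales the volume by a constant. The lemmas below take such a constant and
the corresponding identity as data, so that a known constant can be used. -/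
lemma exists_map_volume_eq_smul [(volume : Measure X).IsAddHaarMeasure]
    [(volume : Measure Y).IsAddHaarMeasure] (L : X ≃L[ℝ] Y) :
    ∃ c : ℝ≥0, c ≠ 0 ∧ Measure.map L (volume : Measure X) = c • (volume : Measure Y) := by
  have : (Measure.map L (volume : Measure X)).IsAddHaarMeasure := L.isAddHaarMeasure_map _
  refine ⟨Measure.addHaarScalarFactor (Measure.map L (volume : Measure X)) volume, ?_, ?_⟩
  · exact (Measure.addHaarScalarFactor_pos_of_isAddHaarMeasure _ _).ne'
  · exact Measure.isAddLeftInvariant_eq_smul _ _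

lemma integral_comp_linear {L : X ≃L[ℝ] Y} {c : ℝ≥0}
    (hL : Measure.map L (volume : Measure X) = c • (volume : Measure Y)) (g : Y → F) :
    ∫ x, g (L x) = (c : ℝ) • ∫ y, g y := by
  have := integral_map_equiv (μ := (volume : Measure X)) L.toHomeomorph.toMeasurableEquiv g
  simp only [Homeomorph.toMeasurableEquiv_coe, ContinuousLinearEquiv.coe_toHomeomorph] at this
  rw [← this, hL, integral_smul_nnreal_measure]
  rfl

lemma lintegral_comp_linear {L : X ≃L[ℝ] Y} {c : ℝ≥0}
    (hL : Measure.map L (volume : Measure X) = c • (volume : Measure Y)) (g : Y → ℝ≥0∞) :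
    ∫⁻ x, g (L x) = c * ∫⁻ y, g y := by
  have := lintegral_map_equiv (μ := (volume : Measure X)) g L.toHomeomorph.toMeasurableEquiv
  simp only [Homeomorph.toMeasurableEquiv_coe, ContinuousLinearEquiv.coe_toHomeomorph] at this
  rw [← this, hL, lintegral_smul_measure]
  rfl

lemma quasiMeasurePreserving_linear {L : X ≃L[ℝ] Y} {c : ℝ≥0}
    (hL : Measure.map L (volume : Measure X) = c • (volume : Measure Y)) :
    Measure.QuasiMeasurePreserving L (volume : Measure X) (volume : Measure Y) :=
  ⟨L.continuous.measurable, by rw [hL]; exact Measure.smul_absolutelyContinuous⟩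

lemma integrableOn_comp_linear {L : X ≃L[ℝ] Y} {c : ℝ≥0}
    (hL : Measure.map L (volume : Measure X) = c • (volume : Measure Y)) {f : Y → F} {S : Set Y}
    (hf : IntegrableOn f S) : IntegrableOn (fun x => f (L x)) (L ⁻¹' S) := by
  have h := integrableOn_map_equiv (μ := (volume : Measure X)) L.toHomeomorph.toMeasurableEquiv
    (f := f) (s := S)
  simp only [Homeomorph.toMeasurableEquiv_coe, ContinuousLinearEquiv.coe_toHomeomorph] at h
  refine h.1 ?_
  rw [hL, IntegrableOn, Measure.restrict_smul]
  exact hf.smul_measure_nnreal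

lemma locallyIntegrableOn_comp_linear {L : X ≃L[ℝ] Y} {c : ℝ≥0}
    (hL : Measure.map L (volume : Measure X) = c • (volume : Measure Y)) {f : Y → F} {S : Set Y}
    (hf : LocallyIntegrableOn f S volume) :
    LocallyIntegrableOn (fun x => f (L x)) (L ⁻¹' S) volume := by
  intro x hx
  obtain ⟨u, hu, hfu⟩ := hf (L x) hx
  exact ⟨L ⁻¹' u, (L.continuous.continuousWithinAt.tendsto_nhdsWithin (mapsTo_preimage L S)) hu,
    integrableOn_comp_linear hL hfu⟩

/-- Chain rule for weak derivatives under a linear change of variables. -/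
lemma HasWeakDerivOn.comp_linear {L : X ≃L[ℝ] Y} {c : ℝ≥0}
    (hL : Measure.map L (volume : Measure X) = c • (volume : Measure Y)) {Ω : Set Y}
    {f : Y → F} {f' : Y → Y →ₗ[ℝ] F} (h : HasWeakDerivOn Ω f f') :
    HasWeakDerivOn (L ⁻¹' Ω) (fun x => f (L x))
      (fun x => f' (L x) ∘ₗ (L : X →L[ℝ] Y).toLinearMap) := by
  refine ⟨locallyIntegrableOn_comp_linear hL h.1, fun v =>
    ⟨locallyIntegrableOn_comp_linear hL (h.2 (L v)).1, fun η hη hc hs => ?_⟩⟩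
  have hcs : tsupport (η ∘ L.symm) = L.symm ⁻¹' tsupport η :=
    tsupport_comp_eq_preimage η L.symm.toHomeomorph
  have e := (h.2 (L v)).2 (η ∘ L.symm) (hη.comp L.symm.contDiff)
    (hc.comp_homeomorph L.symm.toHomeomorph) (by
      rw [hcs]; intro y hy; simpa using hs hy)
  have e1 := integral_comp_linear hL (fun y => fderiv ℝ (η ∘ L.symm) y (L v) • f y)
  have e2 := integral_comp_linear hL (fun y => (η ∘ L.symm) y • f' y (L v))
  have e3 : ∀ x, fderiv ℝ (η ∘ L.symm) (L x) (L v) = fderiv ℝ η x v := fun x => by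
    rw [ContinuousLinearEquiv.comp_right_fderiv]; simp
  simp only [e3, Function.comp_apply, ContinuousLinearEquiv.symm_apply_apply] at e1 e2
  simp only [LinearMap.comp_apply]
  rw [e1, e]
  simp only [Function.comp_apply]
  rw [smul_neg, ← e2]
  rfl

end Linear

/-! ### Gluing weak derivatives across a hyperplane -/

section Glue

/-- A cutoff function which vanishes up to `1 / 2` and equals `1` from `1` on. -/
lemma exists_cutoff : ∃ ψ : ℝ → ℝ, ContDiff ℝ ∞ ψ ∧ (∀ r, r ≤ 1 / 2 → ψ r = 0) ∧
    (∀ r, 1 ≤ r → ψ r = 1) ∧ (∀ r, 0 ≤ ψ r ∧ ψ r ≤ 1) ∧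
    (∀ r, r ≤ 0 ∨ 1 ≤ r → deriv ψ r = 0) ∧ ∃ M : ℝ, ∀ r, ‖deriv ψ r‖ ≤ M := by
  have hcd : ContDiff ℝ ∞ fun r : ℝ => Real.smoothTransition (4 * r - 2) :=
    Real.smoothTransition.contDiff.comp (by fun_prop)
  have h0 : ∀ r : ℝ, r ≤ 1 / 2 → Real.smoothTransition (4 * r - 2) = 0 := fun r hr =>
    Real.smoothTransition.zero_of_nonpos (by linarith)
  have h1 : ∀ r : ℝ, 3 / 4 ≤ r → Real.smoothTransition (4 * r - 2) = 1 := fun r hr =>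
    Real.smoothTransition.one_of_one_le (by linarith)
  have hd : ∀ r : ℝ, r ≤ 0 ∨ 1 ≤ r →
      deriv (fun r : ℝ => Real.smoothTransition (4 * r - 2)) r = 0 := by
    rintro r (hr | hr)
    · have : (fun r : ℝ => Real.smoothTransition (4 * r - 2)) =ᶠ[𝓝 r] fun _ => 0 := by
        filter_upwards [Iio_mem_nhds (show r < 1 / 2 by linarith)] with y hy using h0 y (le_of_lt hy)
      rw [this.deriv_eq, deriv_const]
    · have : (fun r : ℝ => Real.smoothTransition (4 * r - 2)) =ᶠ[𝓝 r] fun _ => 1 := by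
        filter_upwards [Ioi_mem_nhds (show 3 / 4 < r by linarith)] with y hy using h1 y (le_of_lt hy)
      rw [this.deriv_eq, deriv_const]
  refine ⟨_, hcd, h0, fun r hr => h1 r (by linarith),
    fun r => ⟨Real.smoothTransition.nonneg _, Real.smoothTransition.le_one _⟩, hd, ?_⟩
  have hcs : HasCompactSupport (deriv fun r : ℝ => Real.smoothTransition (4 * r - 2)) := by
    refine HasCompactSupport.intro (isCompact_Icc (a := (0 : ℝ)) (b := 1)) fun x hx => hd x ?_
    rw [mem_Icc, not_and_or, not_le, not_le] at hx
    exact hx.imp le_of_lt le_of_lt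
  exact hcs.exists_bound_of_continuous (hcd.continuous_deriv (by simp))

variable {X F : Type*} [NormedAddCommGroup X] [NormedSpace ℝ X] [MeasureSpace X] [BorelSpace X]
  [NormedAddCommGroup F] [NormedSpace ℝ F]

lemma measurableSet_slab {ℓ : X → ℝ} (hℓ : Continuous ℓ) (ε : ℝ) :
    MeasurableSet {x | 0 < ℓ x ∧ ℓ x < ε} :=
  ((isOpen_lt continuous_const hℓ).inter (isOpen_lt hℓ continuous_const)).measurableSet

/-- The integral of an integrable function over thin slabs `{0 < ℓ < ε}` tends to `0`: their
intersection is empty. -/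
lemma tendsto_lintegral_slab {h : X → F} (hh : Integrable h) {ℓ : X → ℝ} (hℓ : Continuous ℓ) :
    Tendsto (fun ε : ℝ => ∫⁻ x in {x | 0 < ℓ x ∧ ℓ x < ε}, ‖h x‖ₑ) (𝓝[>] 0) (𝓝 0) := by
  have key : ∀ ε : ℝ, ∫⁻ x in {x | 0 < ℓ x ∧ ℓ x < ε}, ‖h x‖ₑ
      = ENNReal.ofReal (∫ x, ({x | 0 < ℓ x ∧ ℓ x < ε} : Set X).indicator (fun x => ‖h x‖) x) := by
    intro ε
    rw [integral_indicator (measurableSet_slab hℓ ε),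
      ofReal_integral_norm_eq_lintegral_enorm hh.integrableOn]
  simp_rw [key]
  rw [← ENNReal.ofReal_zero]
  refine (ENNReal.continuous_ofReal.tendsto 0).comp ?_
  rw [show 𝓝 (0 : ℝ) = 𝓝 (∫ _ : X, (0 : ℝ)) by rw [integral_zero]]
  refine tendsto_integral_filter_of_dominated_convergence (fun x => ‖h x‖) ?_ ?_ hh.norm ?_
  · exact Eventually.of_forall fun ε =>
      hh.aestronglyMeasurable.norm.indicator (measurableSet_slab hℓ ε)
  · refine Eventually.of_forall fun ε => Eventually.of_forall fun x => ?_
    simpa using norm_indicator_le_norm_self (s := {x | 0 < ℓ x ∧ ℓ x < ε}) (fun x => ‖h x‖) x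
  · refine Eventually.of_forall fun x => ?_
    refine tendsto_const_nhds.congr' ?_
    by_cases hx : 0 < ℓ x
    · filter_upwards [nhdsWithin_le_nhds (Iio_mem_nhds hx)] with ε hε
      rw [indicator_of_notMem]
      rintro ⟨_, h2⟩
      exact absurd h2 (not_lt.2 (le_of_lt hε))
    · exact Eventually.of_forall fun ε => (indicator_of_notMem (fun h => hx h.1) _).symm

/-- The map `x ↦ x - ℓ(x) a`, which fixes the hyperplane `{ℓ = 0}` and, when `ℓ a > 1`, exchanges
its two sides. -/
def foldMap (ℓ : X →L[ℝ] ℝ) (a : X) (ha : 1 < ℓ a) : X ≃L[ℝ] X :=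
  ContinuousLinearEquiv.equivOfInverse
    (ContinuousLinearMap.id ℝ X - ℓ.smulRight a)
    (ContinuousLinearMap.id ℝ X - (ℓ a - 1)⁻¹ • ℓ.smulRight a)
    (fun x => by
      have : ℓ a - 1 ≠ 0 := by linarith
      simp only [sub_apply, ContinuousLinearMap.id_apply,
        ContinuousLinearMap.smulRight_apply, smul_apply, map_sub, map_smul, smul_smul]
      match_scalars
      · ring
      · field_simp; ring)
    (fun x => by
      have : ℓ a - 1 ≠ 0 := by linarith
      simp only [sub_apply, ContinuousLinearMap.id_apply,
        ContinuousLinearMap.smulRight_apply, smul_apply, map_sub, map_smul, smul_smul]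
      match_scalars
      · ring
      · field_simp; ring)

lemma foldMap_apply (ℓ : X →L[ℝ] ℝ) (a : X) (ha : 1 < ℓ a) (x : X) :
    foldMap ℓ a ha x = x - ℓ x • a := rfl

/-- `foldMap` is a transvection of determinant `-(ℓ a - 1)`. -/
lemma map_foldMap [FiniteDimensional ℝ X] [(volume : Measure X).IsAddHaarMeasure]
    (ℓ : X →L[ℝ] ℝ) (a : X) (ha : 1 < ℓ a) :
    Measure.map (foldMap ℓ a ha) (volume : Measure X)
      = (ℓ a - 1)⁻¹.toNNReal • (volume : Measure X) := by
  have hdet : LinearMap.det (LinearMap.transvection (ℓ : X →ₗ[ℝ] ℝ) (-a)) = -(ℓ a - 1) := by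
    rw [LinearMap.transvection.det]; simp; ring
  have h := Measure.map_linearMap_addHaar_eq_smul_addHaar (volume : Measure X)
    (f := LinearMap.transvection (ℓ : X →ₗ[ℝ] ℝ) (-a)) (by rw [hdet]; linarith)
  have e : ⇑(LinearMap.transvection (ℓ : X →ₗ[ℝ] ℝ) (-a)) = ⇑(foldMap ℓ a ha) := by
    ext x; simp [foldMap_apply, LinearMap.transvection, sub_eq_add_neg]
  rw [e, hdet, inv_neg, abs_neg, abs_of_pos (inv_pos.2 (by linarith))] at h
  rw [h]
  rfl

lemma volume_hyperplane [FiniteDimensional ℝ X] [(volume : Measure X).IsAddHaarMeasure]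
    (ℓ : X →L[ℝ] ℝ) (a : X) (ha : ℓ a ≠ 0) : ∀ᵐ x : X, ℓ x ≠ 0 := by
  have h := Measure.addHaar_submodule (volume : Measure X) (LinearMap.ker (ℓ : X →ₗ[ℝ] ℝ)) (by
    intro h
    have : a ∈ LinearMap.ker (ℓ : X →ₗ[ℝ] ℝ) := by rw [h]; trivial
    exact ha this)
  rw [ae_iff]
  convert h using 2
  ext x
  simp

/-- A function which is weakly differentiable on both sides of a hyperplane, and whose values on the
two sides agree in average near it, is weakly differentiable across the hyperplane. The two sides are
compared through the map `x ↦ x - ℓ(x) a`, which sends `{ℓ > 0}` to `{ℓ < 0}`. -/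
theorem HasWeakDerivOn.glue [FiniteDimensional ℝ X] [(volume : Measure X).IsAddHaarMeasure]
    {Ω : Set X} (hΩ : IsOpen Ω) {f : X → F} {f' : X → X →ₗ[ℝ] F}
    (hf : LocallyIntegrableOn f Ω volume)
    (hf' : ∀ v, LocallyIntegrableOn (fun x => f' x v) Ω volume)
    (ℓ : X →L[ℝ] ℝ) (a : X) (ha : 1 < ℓ a)
    (h : HasWeakDerivOn (Ω ∩ {x | ℓ x ≠ 0}) f f')
    (hjump : ∀ K ⊆ Ω, IsCompact K → Tendsto (fun ε : ℝ => (ENNReal.ofReal ε)⁻¹ *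
      ∫⁻ x in K ∩ {x | 0 < ℓ x ∧ ℓ x < ε}, ‖f x - f (x - ℓ x • a)‖ₑ) (𝓝[>] 0) (𝓝 0)) :
    HasWeakDerivOn Ω f f' := by
  refine ⟨hf, fun v => ⟨hf' v, fun η hη hc hs => ?_⟩⟩
  obtain ⟨ψ, hψ, hψ0, hψ1, hψb, hψd, M, hM⟩ := exists_cutoff
  set c := ℓ a - 1 with hcdef
  have hcpos : 0 < c := by simp only [hcdef]; linarith
  set R := foldMap ℓ a ha with hRdef
  have hR : Measure.map R (volume : Measure X) = c⁻¹.toNNReal • (volume : Measure X) :=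
    map_foldMap ℓ a ha
  have hRx : ∀ x, R x = x - ℓ x • a := fun x => rfl
  have hℓR : ∀ x, ℓ (R x) = -(c * ℓ x) := fun x => by
    rw [hRx]; simp [hcdef]; ring
  -- The widths `ε` and `c * ε` of the cutoff on the two sides are matched by `R`, as
  -- `ℓ (R x) = -c ℓ x`; the derivatives of the cutoff then combine into the differences `g - g ∘ R`.
  let cut : ℝ → X → ℝ := fun ε x => ψ (ℓ x / ε) + ψ (-(ℓ x) / (c * ε))
  have hψx : ∀ x, DifferentiableAt ℝ ψ x := fun x => (hψ.differentiable (by simp)) x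
  have hcut : ∀ ε, ContDiff ℝ ∞ (cut ε) := fun ε =>
    (hψ.comp (ℓ.contDiff.div_const ε)).add (hψ.comp (ℓ.contDiff.neg.div_const _))
  have hcutd : ∀ ε x, fderiv ℝ (cut ε) x v =
      deriv ψ (ℓ x / ε) * (ℓ v / ε) - deriv ψ (-(ℓ x) / (c * ε)) * (ℓ v / (c * ε)) := by
    intro ε x
    have h1 : HasFDerivAt (fun x => ψ (ℓ x / ε)) (deriv ψ (ℓ x / ε) • (ε⁻¹ • ℓ)) x := by
      have : HasFDerivAt (fun x => ℓ x / ε) (ε⁻¹ • ℓ) x := by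
        simpa [div_eq_mul_inv] using ℓ.hasFDerivAt.mul_const ε⁻¹
      exact (hψx _).hasDerivAt.comp_hasFDerivAt x this
    have h2 : HasFDerivAt (fun x => ψ (-(ℓ x) / (c * ε)))
        (deriv ψ (-(ℓ x) / (c * ε)) • ((c * ε)⁻¹ • -ℓ)) x := by
      have : HasFDerivAt (fun x => -(ℓ x) / (c * ε)) ((c * ε)⁻¹ • -ℓ) x := by
        simpa [div_eq_mul_inv] using ℓ.hasFDerivAt.neg.mul_const (c * ε)⁻¹
      exact (hψx _).hasDerivAt.comp_hasFDerivAt x this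
    have h3 : HasFDerivAt (cut ε) _ x := h1.add h2
    rw [h3.fderiv]
    simp only [add_apply, smul_apply, neg_apply, smul_eq_mul]
    ring
  have hcut1 : ∀ ε > 0, ∀ x, 0 ≤ cut ε x ∧ cut ε x ≤ 1 := by
    intro ε hε x
    refine ⟨add_nonneg (hψb _).1 (hψb _).1, ?_⟩
    rcases le_total 0 (ℓ x) with h0 | h0
    · have : ψ (-(ℓ x) / (c * ε)) = 0 := hψ0 _ <| by
        have : -(ℓ x) / (c * ε) ≤ 0 := div_nonpos_of_nonpos_of_nonneg (by linarith) (by positivity)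
        linarith
      simp only [cut, this, add_zero]
      exact (hψb _).2
    · have : ψ (ℓ x / ε) = 0 := hψ0 _ <| by
        have : ℓ x / ε ≤ 0 := div_nonpos_of_nonpos_of_nonneg h0 hε.le
        linarith
      simp only [cut, this, zero_add]
      exact (hψb _).2
  have hcutlim : ∀ x, ℓ x ≠ 0 → Tendsto (fun ε => cut ε x) (𝓝[>] 0) (𝓝 1) := by
    intro x hx
    refine tendsto_const_nhds.congr' ?_
    rcases lt_or_gt_of_ne hx with h0 | h0
    · have hpos : 0 < -(ℓ x) / c := div_pos (by linarith) hcpos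
      filter_upwards [nhdsWithin_le_nhds (Iio_mem_nhds hpos), self_mem_nhdsWithin] with ε h1 h2
      have h2 : 0 < ε := h2
      have h1 : ε < -(ℓ x) / c := h1
      rw [lt_div_iff₀ hcpos] at h1
      have e1 : ψ (ℓ x / ε) = 0 := hψ0 _ <| by
        have : ℓ x / ε ≤ 0 := div_nonpos_of_nonpos_of_nonneg h0.le h2.le
        linarith
      have e2 : ψ (-(ℓ x) / (c * ε)) = 1 := hψ1 _ <| by
        rw [le_div_iff₀ (by positivity)]; linarith
      simp only [cut, e1, e2, zero_add]
    · filter_upwards [nhdsWithin_le_nhds (Iio_mem_nhds h0), self_mem_nhdsWithin] with ε h1 h2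
      have h2 : 0 < ε := h2
      have h1 : ε < ℓ x := h1
      have e1 : ψ (-(ℓ x) / (c * ε)) = 0 := hψ0 _ <| by
        have : -(ℓ x) / (c * ε) ≤ 0 :=
          div_nonpos_of_nonpos_of_nonneg (by linarith) (by positivity)
        linarith
      have e2 : ψ (ℓ x / ε) = 1 := hψ1 _ <| by
        rw [le_div_iff₀ h2]; linarith
      simp only [cut, e1, e2, add_zero]
  have hae : ∀ᵐ x : X, ℓ x ≠ 0 := volume_hyperplane ℓ a (by linarith)
  -- the test function `η * cut ε` is supported away from the hyperplane
  have hsupp : ∀ ε > 0, tsupport (fun x => η x * cut ε x) ⊆ Ω ∩ {x | ℓ x ≠ 0} := by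
    intro ε hε
    refine subset_inter ((tsupport_mul_subset_left).trans hs) ?_
    intro x hx hx0
    have hx0 : ℓ x = 0 := hx0
    refine notMem_tsupport_iff_eventuallyEq.2 ?_ hx
    have o1 : ∀ᶠ y in 𝓝 x, ℓ y / ε < 1 / 2 :=
      (ℓ.continuous.div_const ε).continuousAt.eventually_lt continuousAt_const (by simp [hx0])
    have o2 : ∀ᶠ y in 𝓝 x, -(ℓ y) / (c * ε) < 1 / 2 :=
      (ℓ.continuous.neg.div_const (c * ε)).continuousAt.eventually_lt continuousAt_const
        (by simp [hx0])
    filter_upwards [o1, o2] with y h1 h2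
    simp [cut, hψ0 _ h1.le, hψ0 _ h2.le]
  set g : X → F := fun x => η x • f x with hgdef
  have hg : Integrable g := integrable_smul_of_tsupport_subset hf hη.continuous hc hs
  have hgR : Integrable (fun x => g (R x)) := by
    have := integrableOn_comp_linear hR (S := univ) (f := g) (by simpa using hg)
    simpa using this
  have hI1 := integrable_fderiv_smul hf hη hc hs v
  have hI3 := integrable_smul_of_tsupport_subset (hf' v) hη.continuous hc hs
  let J : ℝ → F := fun ε => ∫ x, (deriv ψ (ℓ x / ε) * (ℓ v / ε)) • (g x - g (R x))
  have hψdc : Continuous (deriv ψ) := hψ.continuous_deriv (by simp)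
  -- integration by parts against `η * cut ε`, with the change of variables `R` on one side
  have hibp : ∀ ε > 0, (∫ x, cut ε x • ((fderiv ℝ η x v) • f x)) + J ε
      = - ∫ x, cut ε x • (η x • f' x v) := by
    intro ε hε
    have e := (h.2 v).2 (fun x => η x * cut ε x) (hη.mul (hcut ε)) hc.mul_right (hsupp ε hε)
    have i1 : Integrable fun x => (deriv ψ (ℓ x / ε) * (ℓ v / ε)) • g x := by
      refine Integrable.bdd_smul hg (M * ‖ℓ v / ε‖) ?_ (Eventually.of_forall fun x => ?_)
      · exact ((hψdc.comp (ℓ.continuous.div_const ε)).mul continuous_const).aestronglyMeasurable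
      · rw [norm_mul]; gcongr; exact hM _
    have i1' : Integrable fun x => (deriv ψ (ℓ x / ε) * (ℓ v / ε)) • g (R x) := by
      refine Integrable.bdd_smul hgR (M * ‖ℓ v / ε‖) ?_ (Eventually.of_forall fun x => ?_)
      · exact ((hψdc.comp (ℓ.continuous.div_const ε)).mul continuous_const).aestronglyMeasurable
      · rw [norm_mul]; gcongr; exact hM _
    have i2 : Integrable fun x => (deriv ψ (-(ℓ x) / (c * ε)) * (ℓ v / (c * ε))) • g x := by
      refine Integrable.bdd_smul hg (M * ‖ℓ v / (c * ε)‖) ?_ (Eventually.of_forall fun x => ?_)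
      · exact ((hψdc.comp (ℓ.continuous.neg.div_const _)).mul
          continuous_const).aestronglyMeasurable
      · rw [norm_mul]; gcongr; exact hM _
    have i3 : Integrable fun x => cut ε x • ((fderiv ℝ η x v) • f x) := by
      refine Integrable.bdd_smul hI1 1 (hcut ε).continuous.aestronglyMeasurable
        (Eventually.of_forall fun x => ?_)
      rw [Real.norm_of_nonneg (hcut1 ε hε x).1]; exact (hcut1 ε hε x).2
    have hJ : J ε = (∫ x, (deriv ψ (ℓ x / ε) * (ℓ v / ε)) • g x)
        - ∫ x, (deriv ψ (-(ℓ x) / (c * ε)) * (ℓ v / (c * ε))) • g x := by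
      have e2 := integral_comp_linear hR
        (fun x => (deriv ψ (-(ℓ x) / (c * ε)) * (ℓ v / (c * ε))) • g x)
      rw [Real.coe_toNNReal _ (inv_pos.2 hcpos).le, eq_inv_smul_iff₀ hcpos.ne'] at e2
      rw [← e2, ← integral_smul]
      simp only [J, smul_sub]
      rw [integral_sub i1 i1']
      congr 1
      refine integral_congr_ae (Eventually.of_forall fun x => ?_)
      simp only [hℓR, neg_neg, smul_smul]
      congr 1
      rw [mul_div_mul_left _ _ hcpos.ne']
      field_simp
    have i4 : Integrable fun x => cut ε x • ((fderiv ℝ η x v) • f x)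
        + (deriv ψ (ℓ x / ε) * (ℓ v / ε)) • g x := i3.add i1
    rw [hJ, ← add_sub_assoc, ← integral_add i3 i1, ← integral_sub i4 i2]
    have lhs : ∀ x, cut ε x • ((fderiv ℝ η x v) • f x) + (deriv ψ (ℓ x / ε) * (ℓ v / ε)) • g x
        - (deriv ψ (-(ℓ x) / (c * ε)) * (ℓ v / (c * ε))) • g x
        = (fderiv ℝ (fun x => η x * cut ε x) x v) • f x := by
      intro x
      have hp : fderiv ℝ (fun x => η x * cut ε x) x v
          = η x * fderiv ℝ (cut ε) x v + cut ε x * fderiv ℝ η x v := by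
        rw [fderiv_fun_mul (hη.differentiable (by simp) x) ((hcut ε).differentiable (by simp) x)]
        simp
      rw [hp, hcutd]
      simp only [hgdef, smul_smul]
      rw [← add_smul, ← sub_smul]
      congr 1
      ring
    rw [integral_congr_ae (Eventually.of_forall lhs), e]
    simp_rw [smul_smul, mul_comm (η _)]
  have hlim1 : Tendsto (fun ε => ∫ x, cut ε x • ((fderiv ℝ η x v) • f x)) (𝓝[>] 0)
      (𝓝 (∫ x, (fderiv ℝ η x v) • f x)) := by
    refine tendsto_integral_filter_of_dominated_convergence _ ?_ ?_ hI1.norm ?_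
    · exact Eventually.of_forall fun ε =>
        (hcut ε).continuous.aestronglyMeasurable.smul hI1.aestronglyMeasurable
    · filter_upwards [self_mem_nhdsWithin] with ε hε
      refine Eventually.of_forall fun x => ?_
      rw [norm_smul, Real.norm_of_nonneg (hcut1 ε hε x).1]
      exact mul_le_of_le_one_left (norm_nonneg _) (hcut1 ε hε x).2
    · filter_upwards [hae] with x hx
      simpa using (hcutlim x hx).smul_const (fderiv ℝ η x v • f x)
  have hlim3 : Tendsto (fun ε => ∫ x, cut ε x • (η x • f' x v)) (𝓝[>] 0)
      (𝓝 (∫ x, η x • f' x v)) := by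
    refine tendsto_integral_filter_of_dominated_convergence _ ?_ ?_ hI3.norm ?_
    · exact Eventually.of_forall fun ε =>
        (hcut ε).continuous.aestronglyMeasurable.smul hI3.aestronglyMeasurable
    · filter_upwards [self_mem_nhdsWithin] with ε hε
      refine Eventually.of_forall fun x => ?_
      rw [norm_smul, Real.norm_of_nonneg (hcut1 ε hε x).1]
      exact mul_le_of_le_one_left (norm_nonneg _) (hcut1 ε hε x).2
    · filter_upwards [hae] with x hx
      simpa using (hcutlim x hx).smul_const (η x • f' x v)
  -- `g - g ∘ R = η (f - f ∘ R) + (η - η ∘ R) (f ∘ R)`: the first term is controlled by the jump of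
  -- `f`, the second one by the Lipschitz constant of `η`, which gains the factor `ε`.
  have hlimJ : Tendsto J (𝓝[>] 0) (𝓝 0) := by
    set K := tsupport η with hKdef
    obtain ⟨δ, hδ, hδΩ⟩ := hc.isCompact.exists_cthickening_subset_open hΩ hs
    set K' := Metric.cthickening δ K
    have hK' : IsCompact K' := hc.isCompact.cthickening
    have hfK' : Integrable (K'.indicator f) :=
      (hf.integrableOn_compact_subset hδΩ hK').integrable_indicator hK'.measurableSet
    have hfK'R : Integrable (fun x => K'.indicator f (R x)) := by
      have := integrableOn_comp_linear hR (S := univ) (f := K'.indicator f) (by simpa using hfK')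
      simpa using this
    obtain ⟨B, hB⟩ := hc.exists_bound_of_continuous hη.continuous
    obtain ⟨Λ, hΛ⟩ := ContDiff.lipschitzWith_of_hasCompactSupport hc hη (by simp)
    have hεδ : ∀ᶠ ε : ℝ in 𝓝[>] 0, ε * ‖a‖ < δ := by
      refine nhdsWithin_le_nhds ?_
      have : Tendsto (fun ε : ℝ => ε * ‖a‖) (𝓝 0) (𝓝 (0 * ‖a‖)) :=
        tendsto_id.mul_const _
      rw [zero_mul] at this
      exact this.eventually (gt_mem_nhds hδ)
    have hpt : ∀ ε > 0, ε * ‖a‖ < δ → ∀ x ∈ {x | 0 < ℓ x ∧ ℓ x < ε},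
        ‖g x - g (R x)‖ₑ ≤ K.indicator (fun x => ENNReal.ofReal B * ‖f x - f (R x)‖ₑ) x
          + ENNReal.ofReal (Λ * (ε * ‖a‖)) * ‖K'.indicator f (R x)‖ₑ := by
      intro ε hε hεa x hx
      have hdist : dist x (R x) ≤ ε * ‖a‖ := by
        rw [hRx, dist_eq_norm, sub_sub_cancel, norm_smul, Real.norm_of_nonneg hx.1.le]
        exact mul_le_mul_of_nonneg_right hx.2.le (norm_nonneg _)
      have e : g x - g (R x) = η x • (f x - f (R x)) + (η x - η (R x)) • f (R x) := by
        simp only [hgdef, smul_sub, sub_smul]; abel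
      rw [e]
      refine (enorm_add_le _ _).trans (add_le_add ?_ ?_)
      · by_cases hxK : x ∈ K
        · rw [indicator_of_mem hxK, enorm_smul]
          gcongr
          rw [← ofReal_norm]
          exact ENNReal.ofReal_le_ofReal (hB x)
        · rw [image_eq_zero_of_notMem_tsupport hxK]; simp
      · by_cases hRK : R x ∈ K'
        · rw [indicator_of_mem hRK, enorm_smul]
          gcongr
          rw [← ofReal_norm]
          refine ENNReal.ofReal_le_ofReal ?_
          rw [← dist_eq_norm]
          exact (hΛ.dist_le_mul _ _).trans (mul_le_mul_of_nonneg_left hdist Λ.2)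
        · have h1 : η (R x) = 0 := image_eq_zero_of_notMem_tsupport fun hk =>
            hRK (Metric.self_subset_cthickening _ hk)
          have h2 : η x = 0 := image_eq_zero_of_notMem_tsupport fun hk =>
            hRK (Metric.mem_cthickening_of_dist_le _ x _ _ hk (by
              rw [dist_comm]; exact hdist.trans hεa.le))
          rw [h1, h2]; simp
    have hbound : ∀ᶠ ε : ℝ in 𝓝[>] 0, ‖J ε‖ₑ ≤
        ENNReal.ofReal (M * ‖ℓ v‖) * ENNReal.ofReal B * ((ENNReal.ofReal ε)⁻¹ *
          ∫⁻ x in K ∩ {x | 0 < ℓ x ∧ ℓ x < ε}, ‖f x - f (R x)‖ₑ)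
        + ENNReal.ofReal (M * ‖ℓ v‖) * ENNReal.ofReal (Λ * ‖a‖) *
          ∫⁻ x in {x | 0 < ℓ x ∧ ℓ x < ε}, ‖K'.indicator f (R x)‖ₑ := by
      filter_upwards [hεδ, self_mem_nhdsWithin] with ε hεa hε
      have hε : 0 < ε := hε
      have hms := measurableSet_slab ℓ.continuous ε
      set S := {x | 0 < ℓ x ∧ ℓ x < ε} with hS
      have hM0 : 0 ≤ M := (norm_nonneg _).trans (hM 0)
      calc ‖J ε‖ₑ ≤ ∫⁻ x, ‖(deriv ψ (ℓ x / ε) * (ℓ v / ε)) • (g x - g (R x))‖ₑ :=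
            enorm_integral_le_lintegral_enorm _
        _ ≤ ∫⁻ x, S.indicator
            (fun x => ENNReal.ofReal (M * ‖ℓ v‖) * (ENNReal.ofReal ε)⁻¹ * ‖g x - g (R x)‖ₑ) x := by
            refine lintegral_mono fun x => ?_
            by_cases hx : x ∈ S
            · rw [indicator_of_mem hx, enorm_smul]
              gcongr
              rw [← ofReal_norm, ← ENNReal.ofReal_inv_of_pos hε,
                ← ENNReal.ofReal_mul (by positivity)]
              refine ENNReal.ofReal_le_ofReal ?_
              rw [norm_mul, norm_div, Real.norm_of_nonneg hε.le, mul_assoc, ← div_eq_mul_inv]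
              gcongr
              exact hM _
            · have : deriv ψ (ℓ x / ε) = 0 := by
                refine hψd _ ?_
                by_cases h0 : 0 < ℓ x
                · right
                  have : ¬ ℓ x < ε := fun h => hx ⟨h0, h⟩
                  rw [le_div_iff₀ hε]; linarith
                · left
                  exact div_nonpos_of_nonpos_of_nonneg (not_lt.1 h0) hε.le
              simp [this]
        _ = ENNReal.ofReal (M * ‖ℓ v‖) * (ENNReal.ofReal ε)⁻¹ * ∫⁻ x in S, ‖g x - g (R x)‖ₑ := by
            rw [lintegral_indicator hms, lintegral_const_mul' _ _ (by
              refine ENNReal.mul_ne_top ENNReal.ofReal_ne_top ?_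
              simp [hε])]
        _ ≤ ENNReal.ofReal (M * ‖ℓ v‖) * (ENNReal.ofReal ε)⁻¹ *
            (ENNReal.ofReal B * (∫⁻ x in K ∩ S, ‖f x - f (R x)‖ₑ)
              + ENNReal.ofReal (Λ * (ε * ‖a‖)) * ∫⁻ x in S, ‖K'.indicator f (R x)‖ₑ) := by
            gcongr
            refine (setLIntegral_mono' hms (hpt ε hε hεa)).trans (le_of_eq ?_)
            rw [lintegral_add_right', lintegral_const_mul' _ _ ENNReal.ofReal_ne_top,
              lintegral_indicator hc.isCompact.measurableSet,
              Measure.restrict_restrict hc.isCompact.measurableSet,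
              lintegral_const_mul' _ _ ENNReal.ofReal_ne_top]
            exact (hfK'R.aestronglyMeasurable.enorm.restrict).const_mul _
        _ = _ := by
            rw [mul_add]
            congr 1
            · ring
            · rw [show (Λ : ℝ) * (ε * ‖a‖) = ε * (Λ * ‖a‖) by ring,
                ENNReal.ofReal_mul (p := ε) hε.le]
              have : (ENNReal.ofReal ε)⁻¹ * ENNReal.ofReal ε = 1 :=
                ENNReal.inv_mul_cancel (by simpa using hε) ENNReal.ofReal_ne_top
              calc _ = ENNReal.ofReal (M * ‖ℓ v‖) * ((ENNReal.ofReal ε)⁻¹ * ENNReal.ofReal ε) *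
                    ENNReal.ofReal (Λ * ‖a‖) * ∫⁻ x in S, ‖K'.indicator f (R x)‖ₑ := by ring
                _ = _ := by rw [this, mul_one]
    rw [tendsto_iff_enorm_sub_tendsto_zero]
    simp only [sub_zero]
    refine tendsto_of_tendsto_of_tendsto_of_le_of_le' tendsto_const_nhds ?_
      (Eventually.of_forall fun _ => zero_le) hbound
    have t1 := ENNReal.Tendsto.const_mul (a := ENNReal.ofReal (M * ‖ℓ v‖) * ENNReal.ofReal B)
      (hjump K hs hc.isCompact) (Or.inr (ENNReal.mul_ne_top ENNReal.ofReal_ne_top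
        ENNReal.ofReal_ne_top))
    have t2 := ENNReal.Tendsto.const_mul
      (a := ENNReal.ofReal (M * ‖ℓ v‖) * ENNReal.ofReal (Λ * ‖a‖))
      (tendsto_lintegral_slab hfK'R ℓ.continuous) (Or.inr (ENNReal.mul_ne_top ENNReal.ofReal_ne_top
        ENNReal.ofReal_ne_top))
    have t3 := t1.add t2
    rw [mul_zero, mul_zero, add_zero] at t3
    exact t3
  have hlim : Tendsto (fun ε => (∫ x, cut ε x • ((fderiv ℝ η x v) • f x)) + J ε) (𝓝[>] 0)
      (𝓝 (∫ x, (fderiv ℝ η x v) • f x)) := by simpa using hlim1.add hlimJ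
  refine tendsto_nhds_unique hlim (hlim3.neg.congr' ?_)
  filter_upwards [self_mem_nhdsWithin] with ε hε using (hibp ε hε).symm

end Glue

/-! ### Smooth primitives and weighted boundary values -/

section WeightedValue

variable {Y F : Type*} [NormedAddCommGroup Y] [NormedSpace ℝ Y] [FiniteDimensional ℝ Y]
  [MeasureSpace Y] [BorelSpace Y] [(volume : Measure Y).IsAddHaarMeasure]
  [NormedAddCommGroup F] [NormedSpace ℝ F] [CompleteSpace F]

/-- Exchange of the last two coordinates of `(Y × ℝ) × ℝ`. -/
def swapLast (Y : Type*) [MeasurableSpace Y] : (Y × ℝ) × ℝ ≃ᵐ (Y × ℝ) × ℝ :=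
  (MeasurableEquiv.prodAssoc.trans
    (MeasurableEquiv.prodCongr (MeasurableEquiv.refl Y) MeasurableEquiv.prodComm)).trans
    MeasurableEquiv.prodAssoc.symm

lemma swapLast_apply (z : (Y × ℝ) × ℝ) : swapLast Y z = ((z.1.1, z.2), z.1.2) := rfl

lemma measurePreserving_swapLast :
    MeasurePreserving (swapLast Y) (volume : Measure ((Y × ℝ) × ℝ)) volume := by
  have h1 : MeasurePreserving (MeasurableEquiv.prodAssoc : (Y × ℝ) × ℝ ≃ᵐ Y × ℝ × ℝ)
      volume volume := volume_preserving_prodAssoc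
  have h2 : MeasurePreserving
      (MeasurableEquiv.prodCongr (MeasurableEquiv.refl Y)
        (MeasurableEquiv.prodComm : ℝ × ℝ ≃ᵐ ℝ × ℝ))
      (volume : Measure (Y × ℝ × ℝ)) volume :=
    (MeasurePreserving.id (volume : Measure Y)).prod
      (Measure.measurePreserving_swap (μ := (volume : Measure ℝ)) (ν := (volume : Measure ℝ)))
  exact (h1.symm _).comp (h2.comp h1)

/-- Fubini's theorem for an integral operator acting on the last variable. -/
lemma integral_smul_kernel {H : Y × ℝ → F} (hH : Integrable H) {k : ℝ × ℝ → ℝ}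
    (hk : Measurable k) {C : ℝ} (hkC : ∀ x, ‖k x‖ ≤ C) {η : Y × ℝ → ℝ} (hη : Measurable η) {B : ℝ}
    (hηB : ∀ x, ‖η x‖ ≤ B) {a b : ℝ} (hηs : ∀ x, x.2 ∉ Icc a b → η x = 0) :
    Integrable (fun x : Y × ℝ => η x • ∫ σ, k (x.2, σ) • H (x.1, σ)) ∧
    Integrable (fun x : Y × ℝ => (∫ s, η (x.1, s) * k (s, x.2)) • H x) ∧
    ∫ x : Y × ℝ, η x • ∫ σ, k (x.2, σ) • H (x.1, σ)
      = ∫ x : Y × ℝ, (∫ s, η (x.1, s) * k (s, x.2)) • H x := by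
  let G₂ : (Y × ℝ) × ℝ → F := fun z => (η (z.1.1, z.2) * k (z.2, z.1.2)) • H z.1
  have hG₂ : Integrable G₂ (volume : Measure ((Y × ℝ) × ℝ)) := by
    have hb : Integrable (fun z : (Y × ℝ) × ℝ => (Icc a b).indicator (fun _ => (1 : ℝ)) z.2 • H z.1)
        ((volume : Measure (Y × ℝ)).prod (volume : Measure ℝ)) := by
      have h1 : Integrable ((Icc a b).indicator fun _ : ℝ => (1 : ℝ)) :=
        (integrable_indicator_iff measurableSet_Icc).2 (by simp)
      have := (h1.smul_prod hH).swap
      exact this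
    have hb2 := hb.bdd_smul (φ := fun z : (Y × ℝ) × ℝ => η (z.1.1, z.2) * k (z.2, z.1.2)) (B * C)
      (by
        refine Measurable.aestronglyMeasurable ?_
        exact (hη.comp (by fun_prop)).mul (hk.comp (by fun_prop)))
      (Eventually.of_forall fun z => by
        rw [norm_mul]
        exact mul_le_mul (hηB _) (hkC _) (norm_nonneg _) ((norm_nonneg _).trans (hηB z.1)))
    refine hb2.congr (Eventually.of_forall fun z => ?_)
    by_cases hz : z.2 ∈ Icc a b
    · simp [G₂, hz]
    · simp [G₂, hηs (z.1.1, z.2) hz]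
  have hG₁ : Integrable (fun z => G₂ (swapLast Y z)) (volume : Measure ((Y × ℝ) × ℝ)) :=
    (measurePreserving_swapLast.integrable_comp_emb (swapLast Y).measurableEmbedding).2 hG₂
  have e1 : ∀ x : Y × ℝ, η x • ∫ σ, k (x.2, σ) • H (x.1, σ)
      = ∫ σ, G₂ (swapLast Y (x, σ)) := fun x => by
    rw [← integral_smul]
    simp [G₂, swapLast_apply, smul_smul]
  have e2 : ∀ x : Y × ℝ, (∫ s, η (x.1, s) * k (s, x.2)) • H x = ∫ s, G₂ (x, s) := fun x => by
    rw [← integral_smul_const]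
  simp_rw [e1, e2]
  refine ⟨hG₁.integral_prod_left, hG₂.integral_prod_left, ?_⟩
  rw [← integral_prod _ hG₁, ← integral_prod _ hG₂]
  exact measurePreserving_swapLast.integral_comp (swapLast Y).measurableEmbedding G₂

/-- The integral over `(σ, ∞)` in the last variable of a test function is smooth. -/
lemma contDiff_tail {ζ : Y × ℝ → ℝ} (hζ : ContDiff ℝ ∞ ζ) (hc : HasCompactSupport ζ) :
    ContDiff ℝ ∞ fun x : Y × ℝ => ∫ s in Ioi x.2, ζ (x.1, s) := by
  have hk : IsCompact (Prod.snd '' tsupport ζ) := hc.isCompact.image continuous_snd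
  have h := contDiffOn_convolution_right_with_param (𝕜 := ℝ) (μ := (volume : Measure ℝ)) (n := ⊤)
    (f := (Iio (0 : ℝ)).indicator fun _ => (1 : ℝ)) (L := ContinuousLinearMap.lsmul ℝ ℝ)
    (g := fun (y : Y) (s : ℝ) => ζ (y, s)) (s := univ) isOpen_univ hk
    (fun y s _ hs => by
      by_contra h0
      exact hs ⟨(y, s), subset_tsupport _ h0, rfl⟩)
    ((locallyIntegrable_const (1 : ℝ)).indicator measurableSet_Iio) (by exact hζ.contDiffOn)
  rw [univ_prod_univ, contDiffOn_univ] at h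
  convert h using 2 with x
  rw [convolution_eq_swap]
  rw [← integral_indicator measurableSet_Ioi]
  refine integral_congr_ae (Eventually.of_forall fun s => ?_)
  by_cases hs : x.2 < s
  · simp [hs]
  · simp [hs]

/-- The integral in the last variable of a test function is smooth. -/
lemma contDiff_integral_snd {ζ : Y × ℝ → ℝ} (hζ : ContDiff ℝ ∞ ζ) (hc : HasCompactSupport ζ) :
    ContDiff ℝ ∞ fun y : Y => ∫ s, ζ (y, s) := by
  have hk : IsCompact (Prod.snd '' tsupport ζ) := hc.isCompact.image continuous_snd
  have h := contDiffOn_convolution_right_with_param_comp (𝕜 := ℝ) (μ := (volume : Measure ℝ))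
    (n := ⊤) (f := fun _ : ℝ => (1 : ℝ)) (L := ContinuousLinearMap.lsmul ℝ ℝ) (v := fun _ : Y => 0)
    (g := fun (y : Y) (s : ℝ) => ζ (y, s)) (s := univ) contDiffOn_const isOpen_univ hk
    (fun y s _ hs => by
      by_contra h0
      exact hs ⟨(y, s), subset_tsupport _ h0, rfl⟩)
    (locallyIntegrable_const (1 : ℝ)) (by exact hζ.contDiffOn)
  rw [contDiffOn_univ] at h
  convert h using 2 with y
  rw [convolution_eq_swap]
  simp

lemma hasDerivAt_integral_Ioi {g : ℝ → ℝ} (hg : Continuous g) (hi : Integrable g) (σ : ℝ) :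
    HasDerivAt (fun σ => ∫ s in Ioi σ, g s) (-g σ) σ := by
  have e : (fun σ => ∫ s in Ioi σ, g s) = fun σ => (∫ s in Ioi 0, g s) - ∫ s in (0 : ℝ)..σ, g s := by
    ext σ
    have := intervalIntegral.integral_interval_add_Ioi (a := 0) (b := σ) (f := g)
      hi.integrableOn hi.integrableOn
    rw [← this]; ring
  rw [e]
  exact (intervalIntegral.integral_hasDerivAt_right (hg.intervalIntegrable _ _)
    (hg.stronglyMeasurableAtFilter _ _) hg.continuousAt).const_sub _

lemma exists_weight : ∃ β : ℝ → ℝ, ContDiff ℝ ∞ β ∧ (∀ s, 0 ≤ β s) ∧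
    (∀ s, s ∉ Icc (1 / 4 : ℝ) (3 / 4) → β s = 0) ∧ ∫ s, β s = 1 := by
  let b : ContDiffBump (1 / 2 : ℝ) := ⟨1 / 8, 1 / 4, by norm_num, by norm_num⟩
  refine ⟨b.normed volume, b.contDiff_normed, b.nonneg_normed, fun s hs => ?_, b.integral_normed⟩
  by_contra h
  have h2 : s ∈ Function.support (b.normed volume) := h
  rw [b.support_normed_eq, Real.ball_eq_Ioo] at h2
  exact hs ⟨by have := h2.1; norm_num [b] at this; linarith,
    by have := h2.2; norm_num [b] at this; linarith⟩

/-- A fixed smooth probability density on `(0, 1)`. -/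
def weight : ℝ → ℝ := exists_weight.choose

lemma contDiff_weight : ContDiff ℝ ∞ weight := exists_weight.choose_spec.1
lemma weight_nonneg (s : ℝ) : 0 ≤ weight s := exists_weight.choose_spec.2.1 s
lemma weight_eq_zero {s : ℝ} (hs : s ∉ Icc (1 / 4 : ℝ) (3 / 4)) : weight s = 0 :=
  exists_weight.choose_spec.2.2.1 s hs
lemma integral_weight : ∫ s, weight s = 1 := exists_weight.choose_spec.2.2.2

lemma hasCompactSupport_weight : HasCompactSupport weight :=
  HasCompactSupport.intro isCompact_Icc fun _ hs => weight_eq_zero hs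

lemma integrable_weight : Integrable weight :=
  contDiff_weight.continuous.integrable_of_hasCompactSupport hasCompactSupport_weight

/-- The mass of `weight` to the right of a point. -/
def weightTail (σ : ℝ) : ℝ := ∫ s in Ioi σ, weight s

lemma continuous_weightTail : Continuous weightTail :=
  continuous_iff_continuousAt.2 fun σ =>
    (hasDerivAt_integral_Ioi contDiff_weight.continuous integrable_weight σ).continuousAt

lemma weightTail_norm_le (σ : ℝ) : ‖weightTail σ‖ ≤ 1 := by
  have h0 : 0 ≤ weightTail σ := setIntegral_nonneg measurableSet_Ioi fun s _ => weight_nonneg s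
  rw [Real.norm_of_nonneg h0, ← integral_weight]
  exact setIntegral_le_integral integrable_weight (Eventually.of_forall weight_nonneg)

/-- The boundary value at `0` of a function `f` on `(0, 1)` with derivative `h`, written as an
average: since `f(s) - f(0) = ∫₀ˢ h`, one has `f(0) = ∫ β f - ∫₀¹ (∫_σ^∞ β) h(σ) dσ` for a
probability density `β` on `(0, 1)`. -/
def edgeValue (f h : ℝ → F) : F :=
  (∫ s in Ioo (0 : ℝ) 1, weight s • f s) - ∫ σ in Ioo (0 : ℝ) 1, weightTail σ • h σ

end WeightedValue

/-! ### Weakly differentiable functions are primitives along lines -/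

section DuBoisReymond

variable {Y F : Type*} [NormedAddCommGroup Y] [NormedSpace ℝ Y] [FiniteDimensional ℝ Y]
  [MeasureSpace Y] [BorelSpace Y] [(volume : Measure Y).IsAddHaarMeasure]
  [NormedAddCommGroup F] [NormedSpace ℝ F] [CompleteSpace F]

lemma exists_Icc_of_isCompact_subset_Ioo {k : Set ℝ} (hk : IsCompact k) (hs : k ⊆ Ioo (0 : ℝ) 1) :
    ∃ a b : ℝ, 0 < a ∧ a ≤ 1 / 4 ∧ 3 / 4 ≤ b ∧ b < 1 ∧ k ⊆ Icc a b := by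
  have hk' : IsCompact (insert (1 / 4 : ℝ) (insert (3 / 4) k)) := (hk.insert _).insert _
  have hs' : insert (1 / 4 : ℝ) (insert (3 / 4) k) ⊆ Ioo (0 : ℝ) 1 := by
    rintro x (rfl | rfl | hx)
    · norm_num
    · norm_num
    · exact hs hx
  obtain ⟨a, ha, ha'⟩ := hk'.exists_isLeast ⟨_, mem_insert _ _⟩
  obtain ⟨b, hb, hb'⟩ := hk'.exists_isGreatest ⟨_, mem_insert _ _⟩
  exact ⟨a, b, (hs' ha).1, ha' (by simp), hb' (by simp), (hs' hb).2, fun x hx =>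
    ⟨ha' (by simp [hx]), hb' (by simp [hx])⟩⟩

/-- The continuous representative of `f`, built from its weak derivative `h` in the last variable. -/
def primitive (f h : Y × ℝ → F) (x : Y × ℝ) : F :=
  edgeValue (fun s => f (x.1, s)) (fun s => h (x.1, s)) + ∫ σ in Ioo 0 x.2, h (x.1, σ)

/-- The antiderivative `-∫_σ^∞ (η - β N)` of `η - β N`, where `N = ∫ η ds`, is a test function. -/
lemma exists_test_primitive {V : Set Y} {K : Set Y} (hK : IsCompact K) (hKV : K ⊆ V) {a b : ℝ}
    (ha : 0 < a) (ha' : a ≤ 1 / 4) (hb' : 3 / 4 ≤ b) (hb : b < 1) {η : Y × ℝ → ℝ}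
    (hη : ContDiff ℝ ∞ η) (hc : HasCompactSupport η) (hηK : ∀ x, x ∉ K ×ˢ Icc a b → η x = 0) :
    ∃ θ : Y × ℝ → ℝ, ContDiff ℝ ∞ θ ∧ HasCompactSupport θ ∧ tsupport θ ⊆ V ×ˢ Ioo (0 : ℝ) 1 ∧
      (∀ x, fderiv ℝ θ x (0, 1) = η x - (∫ s, η (x.1, s)) * weight x.2) ∧
      ∀ x, θ x = (∫ s, η (x.1, s)) * weightTail x.2 - ∫ s in Ioi x.2, η (x.1, s) := by
  let ζ : Y × ℝ → ℝ := fun x => (∫ s, η (x.1, s)) * weight x.2 - η x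
  have hζ : ContDiff ℝ ∞ ζ :=
    (((contDiff_integral_snd hη hc).comp contDiff_fst).mul (contDiff_weight.comp contDiff_snd)).sub hη
  have hKc : IsCompact (K ×ˢ Icc a b) := hK.prod isCompact_Icc
  have hηy : ∀ y, Continuous fun s => η (y, s) := fun y => hη.continuous.comp (by fun_prop)
  have hηi : ∀ y, Integrable fun s => η (y, s) := fun y =>
    (hηy y).integrable_of_hasCompactSupport
      (HasCompactSupport.intro (isCompact_Icc (a := a) (b := b)) fun s hs =>
        hηK (y, s) fun h => hs h.2)
  have hζK : ∀ x, x ∉ K ×ˢ Icc a b → ζ x = 0 := by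
    rintro ⟨y, s⟩ hx
    by_cases hy : y ∈ K
    · have hs : s ∉ Icc a b := fun h => hx ⟨hy, h⟩
      have hw : weight s = 0 := weight_eq_zero fun h => hs ⟨ha'.trans h.1, h.2.trans hb'⟩
      simp [ζ, hw, hηK _ hx]
    · have : ∀ s, η (y, s) = 0 := fun s => hηK _ fun h => hy h.1
      simp [ζ, this]
  have hζc : HasCompactSupport ζ := HasCompactSupport.intro hKc hζK
  have hζi : ∀ y, Integrable fun s => ζ (y, s) := fun y =>
    (hζ.continuous.comp (by fun_prop : Continuous fun s : ℝ => (y, s))).integrable_of_hasCompactSupport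
      (HasCompactSupport.intro (isCompact_Icc (a := a) (b := b)) fun s hs =>
        hζK (y, s) fun h => hs h.2)
  have hζ0 : ∀ y, ∫ s, ζ (y, s) = 0 := fun y => by
    simp only [ζ]
    rw [integral_sub (integrable_weight.const_mul _) (hηi y), integral_const_mul, integral_weight]
    ring
  let θ : Y × ℝ → ℝ := fun x => ∫ s in Ioi x.2, ζ (x.1, s)
  have hθ : ContDiff ℝ ∞ θ := contDiff_tail hζ hζc
  have hθK : ∀ x, x ∉ K ×ˢ Icc a b → θ x = 0 := by
    rintro ⟨y, σ⟩ hx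
    by_cases hy : y ∈ K
    · have hs : σ ∉ Icc a b := fun h => hx ⟨hy, h⟩
      rw [mem_Icc, not_and_or, not_le, not_le] at hs
      rcases hs with hs | hs
      · rw [← hζ0 y]
        refine setIntegral_eq_integral_of_forall_compl_eq_zero fun s hs' => hζK _ fun h => hs' ?_
        exact hs.trans_le h.2.1
      · refine setIntegral_eq_zero_of_forall_eq_zero fun s hs' => hζK _ fun h => ?_
        exact absurd (hs.trans hs') (not_lt.2 h.2.2)
    · have : ∀ s, ζ (y, s) = 0 := fun s => hζK _ fun h => hy h.1
      simp [θ, this]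
  refine ⟨θ, hθ, HasCompactSupport.intro hKc hθK, ?_, ?_, ?_⟩
  · have : tsupport θ ⊆ K ×ˢ Icc a b := closure_minimal (fun x hx => by
      by_contra h; exact hx (hθK x h)) hKc.isClosed
    exact this.trans (prod_mono hKV (Icc_subset_Ioo ha hb))
  · rintro ⟨y, σ⟩
    have h1 : HasDerivAt (fun σ => θ (y, σ)) (fderiv ℝ θ (y, σ) (0, 1)) σ :=
      ((hθ.differentiable (by simp)) (y, σ)).hasFDerivAt.comp_hasDerivAt σ
        ((hasDerivAt_const σ y).prodMk (hasDerivAt_id σ))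
    have h2 : HasDerivAt (fun σ => θ (y, σ)) (-ζ (y, σ)) σ :=
      hasDerivAt_integral_Ioi (g := fun s => ζ (y, s)) (hζ.continuous.comp (by fun_prop)) (hζi y) σ
    rw [h1.unique h2]
    simp [ζ]
  · rintro ⟨y, σ⟩
    simp only [θ, ζ]
    rw [integral_sub (integrable_weight.const_mul _).integrableOn (hηi y).integrableOn,
      integral_const_mul]
    rfl

/-- A function whose weak derivative `h` in the last variable is integrable up to both ends equals
`primitive f h` almost everywhere. Indeed `∫ η (f - primitive f h)` is, by Fubini's theorem, the
weak equation tested against the antiderivative of `η - β N` given by `exists_test_primitive`. -/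
theorem ae_eq_primitive {V : Set Y} (hV : IsOpen V) {f h : Y × ℝ → F}
    (hf : LocallyIntegrableOn f (V ×ˢ Ioo (0 : ℝ) 1) volume)
    (hh : ∀ K ⊆ V, IsCompact K → IntegrableOn h (K ×ˢ Ioo (0 : ℝ) 1))
    (hibp : ∀ η : Y × ℝ → ℝ, ContDiff ℝ ∞ η → HasCompactSupport η →
      tsupport η ⊆ V ×ˢ Ioo (0 : ℝ) 1 →
      ∫ x, (fderiv ℝ η x (0, 1)) • f x = - ∫ x, η x • h x) :
    ∀ᵐ x : Y × ℝ, x ∈ V ×ˢ Ioo (0 : ℝ) 1 → f x = primitive f h x := by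
  have hU : IsOpen (V ×ˢ Ioo (0 : ℝ) 1) := hV.prod isOpen_Ioo
  -- the three integral operators which make up `primitive f h`, on a compact set
  have key : ∀ (K : Set Y) (a b : ℝ), IsCompact K → K ⊆ V → 0 < a → a ≤ 1 / 4 → 3 / 4 ≤ b → b < 1 →
      ∀ η : Y × ℝ → ℝ, Measurable η → (∃ B, ∀ x, ‖η x‖ ≤ B) → (∀ x, x ∉ K ×ˢ Icc a b → η x = 0) →
      Integrable (fun x => η x • primitive f h x) ∧
      Integrable (fun x => ((∫ s, η (x.1, s)) * weight x.2) • f x) ∧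
      ∫ x, η x • primitive f h x =
        (∫ x, ((∫ s, η (x.1, s)) * weight x.2) • f x)
        - ∫ x, ((∫ s, η (x.1, s)) * weightTail x.2 - (∫ s in Ioi x.2, η (x.1, s))) •
          (K ×ˢ Ioo (0 : ℝ) 1).indicator h x := by
    rintro K a b hK hKV ha ha' hb' hb η hη ⟨B, hηB⟩ hηK
    have hKm := hK.measurableSet
    have hηs : ∀ x : Y × ℝ, x.2 ∉ Icc a b → η x = 0 := fun x hx => hηK x fun h => hx h.2
    set f₁ : Y × ℝ → F := (K ×ˢ Icc a b).indicator f with hf₁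
    set h₁ : Y × ℝ → F := (K ×ˢ Ioo (0 : ℝ) 1).indicator h with hh₁
    have hf₁i : Integrable f₁ :=
      (hf.integrableOn_compact_subset (prod_mono hKV (Icc_subset_Ioo ha hb))
        (hK.prod isCompact_Icc)).integrable_indicator (hKm.prod measurableSet_Icc)
    have hh₁i : Integrable h₁ := (hh K hKV hK).integrable_indicator (hKm.prod measurableSet_Ioo)
    obtain ⟨Cw, hCw⟩ := hasCompactSupport_weight.exists_bound_of_continuous
      contDiff_weight.continuous
    have A := integral_smul_kernel hf₁i (k := fun z => weight z.2)
      (contDiff_weight.continuous.measurable.comp measurable_snd) (fun z => hCw z.2) hη hηB hηs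
    have Bk := integral_smul_kernel hh₁i (k := ({z | z.2 < z.1} : Set (ℝ × ℝ)).indicator fun _ => 1)
      (measurable_const.indicator (measurableSet_lt measurable_snd measurable_fst)) (C := 1)
      (fun z => by
        by_cases hz : z ∈ ({z | z.2 < z.1} : Set (ℝ × ℝ)) <;> simp [hz]) hη hηB hηs
    have Ck := integral_smul_kernel hh₁i (k := fun z => weightTail z.2)
      (continuous_weightTail.measurable.comp measurable_snd) (fun z => weightTail_norm_le z.2)
      hη hηB hηs
    have hdec : ∀ x, η x • primitive f h x = η x • (∫ σ, weight σ • f₁ (x.1, σ))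
        - η x • (∫ σ, weightTail σ • h₁ (x.1, σ))
        + η x • (∫ σ, ({z | z.2 < z.1} : Set (ℝ × ℝ)).indicator (fun _ => (1 : ℝ)) (x.2, σ) •
          h₁ (x.1, σ)) := by
      rintro ⟨y, s⟩
      by_cases hx : (y, s) ∈ K ×ˢ Icc a b
      · have hy : y ∈ K := hx.1
        rw [← smul_sub, ← smul_add]
        congr 1
        simp only [primitive, edgeValue]
        congr 1
        · congr 1
          · rw [← integral_indicator measurableSet_Ioo]
            refine integral_congr_ae (Eventually.of_forall fun σ => ?_)
            by_cases hσ : σ ∈ Icc a b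
            · have : σ ∈ Ioo (0 : ℝ) 1 := Icc_subset_Ioo ha hb hσ
              have h2 : (y, σ) ∈ K ×ˢ Icc a b := ⟨hy, hσ⟩
              simp only [hf₁, indicator_of_mem this, indicator_of_mem h2]
            · have : weight σ = 0 := weight_eq_zero fun h => hσ ⟨ha'.trans h.1, h.2.trans hb'⟩
              simp [this, indicator]
          · rw [← integral_indicator measurableSet_Ioo]
            refine integral_congr_ae (Eventually.of_forall fun σ => ?_)
            by_cases hσ : σ ∈ Ioo (0 : ℝ) 1
            · have h2 : (y, σ) ∈ K ×ˢ Ioo (0 : ℝ) 1 := ⟨hy, hσ⟩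
              simp only [hh₁, indicator_of_mem hσ, indicator_of_mem h2]
            · have h2 : (y, σ) ∉ K ×ˢ Ioo (0 : ℝ) 1 := fun h => hσ h.2
              simp only [hh₁, indicator_of_notMem hσ, indicator_of_notMem h2, smul_zero]
        · rw [← integral_indicator measurableSet_Ioo]
          refine integral_congr_ae (Eventually.of_forall fun σ => ?_)
          have hs1 : s < 1 := hx.2.2.trans_lt hb
          by_cases h1 : σ < s
          · by_cases h0 : 0 < σ
            · have h2 : (y, σ) ∈ K ×ˢ Ioo (0 : ℝ) 1 := ⟨hy, h0, h1.trans hs1⟩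
              have h3 : σ ∈ Ioo 0 s := ⟨h0, h1⟩
              simp [hh₁, indicator_of_mem h2, indicator_of_mem h3, h1]
            · have h2 : (y, σ) ∉ K ×ˢ Ioo (0 : ℝ) 1 := fun h => h0 h.2.1
              have h3 : σ ∉ Ioo 0 s := fun h => h0 h.1
              simp [hh₁, indicator_of_notMem h2, indicator_of_notMem h3]
          · have h3 : σ ∉ Ioo 0 s := fun h => h1 h.2
            simp [h1]
      · simp [hηK _ hx]
    simp_rw [hdec]
    have i1 : Integrable (fun x : Y × ℝ => (η x • ∫ σ, weight σ • f₁ (x.1, σ))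
        - η x • ∫ σ, weightTail σ • h₁ (x.1, σ)) := A.1.sub Ck.1
    obtain ⟨A1, A2, A3⟩ := A
    obtain ⟨B1, B2, B3⟩ := Bk
    obtain ⟨C1, C2, C3⟩ := Ck
    have a2 : ∀ x : Y × ℝ, (∫ s, η (x.1, s) * weight x.2) • f₁ x
        = ((∫ s, η (x.1, s)) * weight x.2) • f x := by
      rintro ⟨y, s⟩
      rw [integral_mul_const]
      by_cases hx : (y, s) ∈ K ×ˢ Icc a b
      · simp only [hf₁, indicator_of_mem hx]
      · by_cases hy : y ∈ K
        · have hs : s ∉ Icc a b := fun h => hx ⟨hy, h⟩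
          have hw : weight s = 0 := weight_eq_zero fun h => hs ⟨ha'.trans h.1, h.2.trans hb'⟩
          simp [hw]
        · have : ∀ s, η (y, s) = 0 := fun s => hηK _ fun h => hy h.1
          simp [this]
    have b2 : ∀ x : Y × ℝ, (∫ s, η (x.1, s) *
          ({z | z.2 < z.1} : Set (ℝ × ℝ)).indicator (fun _ => (1 : ℝ)) (s, x.2)) • h₁ x
        = (∫ s in Ioi x.2, η (x.1, s)) • h₁ x := by
      rintro ⟨y, σ⟩
      congr 1
      rw [← integral_indicator measurableSet_Ioi]
      refine integral_congr_ae (Eventually.of_forall fun s => ?_)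
      by_cases hs : σ < s <;> simp [hs]
    have c2 : ∀ x : Y × ℝ, (∫ s, η (x.1, s) * weightTail x.2) • h₁ x
        = ((∫ s, η (x.1, s)) * weightTail x.2) • h₁ x := fun x => by rw [integral_mul_const]
    simp only [a2] at A2 A3
    simp only [b2] at B2 B3
    simp only [c2] at C2 C3
    refine ⟨i1.add B1, A2, ?_⟩
    rw [integral_add i1 B1, integral_sub A1 C1, A3, B3, C3]
    simp_rw [sub_smul]
    rw [integral_sub C2 B2]
    abel
  have hcpt : ∀ k ⊆ V ×ˢ Ioo (0 : ℝ) 1, IsCompact k → ∃ (K : Set Y) (a b : ℝ), IsCompact K ∧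
      K ⊆ V ∧ 0 < a ∧ a ≤ 1 / 4 ∧ 3 / 4 ≤ b ∧ b < 1 ∧ k ⊆ K ×ˢ Icc a b := by
    intro k hk hkc
    obtain ⟨a, b, ha, ha', hb', hb, hab⟩ := exists_Icc_of_isCompact_subset_Ioo
      (hkc.image continuous_snd) (by rintro _ ⟨x, hx, rfl⟩; exact (hk hx).2)
    exact ⟨Prod.fst '' k, a, b, hkc.image continuous_fst,
      by rintro _ ⟨x, hx, rfl⟩; exact (hk hx).1, ha, ha', hb', hb,
      fun x hx => ⟨⟨x, hx, rfl⟩, hab ⟨x, hx, rfl⟩⟩⟩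
  have hloc : LocallyIntegrableOn (primitive f h) (V ×ˢ Ioo (0 : ℝ) 1) volume := by
    rw [locallyIntegrableOn_iff hU.isLocallyClosed]
    intro k hk hkc
    obtain ⟨K, a, b, hK, hKV, ha, ha', hb', hb, hab⟩ := hcpt k hk hkc
    have hm : MeasurableSet (K ×ˢ Icc a b) := hK.measurableSet.prod measurableSet_Icc
    have := (key K a b hK hKV ha ha' hb' hb ((K ×ˢ Icc a b).indicator fun _ => 1)
      (measurable_const.indicator hm) ⟨1, fun x => by
        by_cases hx : x ∈ K ×ˢ Icc a b <;> simp [hx]⟩ fun x hx => indicator_of_notMem hx _).1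
    refine IntegrableOn.mono_set ?_ hab
    rw [← integrable_indicator_iff hm]
    refine this.congr (Eventually.of_forall fun x => ?_)
    by_cases hx : x ∈ K ×ˢ Icc a b <;> simp [indicator, hx]
  have := hU.ae_eq_zero_of_integral_contDiff_smul_eq_zero (hf.sub hloc) fun η hη hc hs => by
    obtain ⟨K, a, b, hK, hKV, ha, ha', hb', hb, hab⟩ := hcpt _ hs hc.isCompact
    have hηK : ∀ x, x ∉ K ×ˢ Icc a b → η x = 0 := fun x hx =>
      image_eq_zero_of_notMem_tsupport fun h => hx (hab h)
    obtain ⟨θ, hθ, hθc, hθs, hθd, hθe⟩ :=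
      exists_test_primitive hK hKV ha ha' hb' hb hη hc hηK
    obtain ⟨k1, k2, k3⟩ := key K a b hK hKV ha ha' hb' hb η hη.continuous.measurable
      (hc.exists_bound_of_continuous hη.continuous) hηK
    have hηf := integrable_smul_of_tsupport_subset hf hη.continuous hc hs
    have e := hibp θ hθ hθc hθs
    have e1 : ∀ x, θ x • (K ×ˢ Ioo (0 : ℝ) 1).indicator h x = θ x • h x := by
      rintro ⟨y, s⟩
      by_cases hx : (y, s) ∈ K ×ˢ Ioo (0 : ℝ) 1
      · rw [indicator_of_mem hx]
      · have : θ (y, s) = 0 := by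
          by_cases hy : y ∈ K
          · exact image_eq_zero_of_notMem_tsupport fun h => hx ⟨hy, (hθs h).2⟩
          · have : ∀ s, η (y, s) = 0 := fun s => hηK _ fun h => hy h.1
            rw [hθe]; simp [this]
        simp [this]
    simp_rw [← hθe, e1] at k3
    simp_rw [hθd, sub_smul] at e
    rw [integral_sub hηf k2] at e
    simp only [Pi.sub_apply, smul_sub]
    rw [integral_sub hηf k1, k3, ← add_eq_zero_iff_eq_neg.2 e]
    abel
  filter_upwards [this] with x hx hxU
  exact sub_eq_zero.1 (hx hxU)

end DuBoisReymond

/-! ### Traces at an edge and their invariance under shears -/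

section EdgeTrace

variable {Y F : Type*} [NormedAddCommGroup Y] [NormedSpace ℝ Y] [FiniteDimensional ℝ Y]
  [MeasureSpace Y] [BorelSpace Y] [(volume : Measure Y).IsAddHaarMeasure]
  [NormedAddCommGroup F]

/-- `v` is the trace on `V × {0}` of a function `g` on `V × (0, 1)`, in the averaged `L¹_loc` sense
used for the traces on the faces in charts. -/
def HasEdgeTrace (V : Set Y) (g : Y × ℝ → F) (v : Y → F) : Prop :=
  AEStronglyMeasurable v (volume.restrict V) ∧
    ∀ K : Set Y, IsCompact K → K ⊆ V → Tendsto (fun ε : ℝ => (ENNReal.ofReal ε)⁻¹ *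
      ∫⁻ q in K, ∫⁻ t in Ioo 0 ε, ‖g (q, t) - v q‖ₑ) (𝓝[>] 0) (𝓝 0)

lemma restrict_prod_volume (s : Set Y) (t : Set ℝ) :
    (volume : Measure (Y × ℝ)).restrict (s ×ˢ t)
      = ((volume : Measure Y).restrict s).prod ((volume : Measure ℝ).restrict t) := by
  rw [Measure.prod_restrict]; rfl

lemma setLIntegral_prod_volume {s : Set Y} {t : Set ℝ} {G : Y × ℝ → ℝ≥0∞}
    (hG : AEMeasurable G (volume.restrict (s ×ˢ t))) :
    ∫⁻ x in s ×ˢ t, G x = ∫⁻ y in s, ∫⁻ r in t, G (y, r) := by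
  rw [restrict_prod_volume] at *
  exact lintegral_prod _ hG

/-- Two functions which agree near the edge have the same traces. -/
lemma HasEdgeTrace.congr {V : Set Y} {g g' : Y × ℝ → F} {v : Y → F} (h : HasEdgeTrace V g v)
    (hgg : ∀ K ⊆ V, IsCompact K → ∃ δ > 0, ∀ q ∈ K, ∀ t ∈ Ioo 0 δ, g (q, t) = g' (q, t)) :
    HasEdgeTrace V g' v := by
  refine ⟨h.1, fun K hK hKV => ?_⟩
  obtain ⟨δ, hδ, hgδ⟩ := hgg K hKV hK
  refine (h.2 K hK hKV).congr' ?_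
  filter_upwards [nhdsWithin_le_nhds (Iio_mem_nhds hδ)] with ε hε
  congr 1
  refine setLIntegral_congr_fun hK.measurableSet fun q hq => ?_
  refine setLIntegral_congr_fun measurableSet_Ioo fun t ht => ?_
  simp only [hgδ q hq t ⟨ht.1, ht.2.trans hε⟩]

lemma aestronglyMeasurable_sub_edge {V : Set Y} {g : Y × ℝ → F} {v : Y → F} {T : Set ℝ}
    (hg : AEStronglyMeasurable g (volume.restrict (V ×ˢ T)))
    (hv : AEStronglyMeasurable v (volume.restrict V)) :
    AEStronglyMeasurable (fun x : Y × ℝ => g x - v x.1) (volume.restrict (V ×ˢ T)) := by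
  refine hg.sub ?_
  rw [restrict_prod_volume]
  exact hv.comp_fst

/-- A trace is locally integrable, and a function with a trace is integrable up to the edge. -/
lemma HasEdgeTrace.integrableOn {V : Set Y} {g : Y × ℝ → F} {v : Y → F}
    (h : HasEdgeTrace V g v)
    (hg : LocallyIntegrableOn g (V ×ˢ Ioo (0 : ℝ) 1) volume) {K : Set Y}
    (hK : IsCompact K) (hKV : K ⊆ V) :
    IntegrableOn v K ∧ ∃ δ > 0, IntegrableOn g (K ×ˢ Ioo (0 : ℝ) δ) := by
  have hlt : ∀ᶠ ε : ℝ in 𝓝[>] 0, (ENNReal.ofReal ε)⁻¹ *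
      ∫⁻ q in K, ∫⁻ t in Ioo 0 ε, ‖g (q, t) - v q‖ₑ < 1 :=
    (h.2 K hK hKV).eventually (gt_mem_nhds one_pos)
  have hlt1 : ∀ᶠ ε : ℝ in 𝓝[>] 0, 0 < ε ∧ ε < 1 := Ioo_mem_nhdsGT one_pos
  obtain ⟨ε, hε, hεpos, hε1⟩ := (hlt.and hlt1).exists
  have hsub : K ×ˢ Ioo (0 : ℝ) ε ⊆ V ×ˢ Ioo (0 : ℝ) 1 :=
    prod_mono hKV (Ioo_subset_Ioo_right hε1.le)
  have hm := (aestronglyMeasurable_sub_edge hg.aestronglyMeasurable h.1).mono_measure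
    (Measure.restrict_mono hsub le_rfl)
  have hd : IntegrableOn (fun x : Y × ℝ => g x - v x.1) (K ×ˢ Ioo (0 : ℝ) ε) := by
    refine ⟨hm, ?_⟩
    rw [HasFiniteIntegral, setLIntegral_prod_volume hm.enorm]
    by_contra htop
    rw [not_lt, top_le_iff] at htop
    simp only at htop
    rw [htop, ENNReal.mul_top (by simp)] at hε
    simp at hε
  have hvK : AEStronglyMeasurable v (volume.restrict K) :=
    h.1.mono_measure (Measure.restrict_mono hKV le_rfl)
  have hv : IntegrableOn v K := by
    -- integrate `v = g - (g - v)` over a layer away from the edge, where `g` is integrable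
    set J := Ioo (ε / 3) (2 * ε / 3) with hJ
    have hJsub : J ⊆ Ioo 0 ε := Ioo_subset_Ioo (by linarith) (by linarith)
    have h1 : IntegrableOn g (K ×ˢ J) :=
      (hg.integrableOn_compact_subset (prod_mono hKV (Icc_subset_Ioo (by linarith) (by linarith)))
        (hK.prod (isCompact_Icc (a := ε / 3) (b := 2 * ε / 3)))).mono_set
        (prod_mono_right Ioo_subset_Icc_self)
    have h2 : IntegrableOn (fun x : Y × ℝ => v x.1) (K ×ˢ J) := by
      have := h1.sub (hd.mono_set (prod_mono_right hJsub))
      refine this.congr (Eventually.of_forall fun x => ?_)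
      simp
    refine ⟨hvK, ?_⟩
    have h3 := h2.2
    rw [HasFiniteIntegral, setLIntegral_prod_volume h2.1.enorm] at h3
    simp only [lintegral_const, Measure.restrict_apply MeasurableSet.univ, univ_inter] at h3
    have hvol : volume J ≠ 0 := by
      rw [hJ, Real.volume_Ioo]; simp; linarith
    rw [lintegral_mul_const'' _ hvK.enorm] at h3
    exact ENNReal.lt_top_of_mul_ne_top_left h3.ne hvol
  refine ⟨hv, ε, hεpos, ?_⟩
  have h2 : IntegrableOn (fun x : Y × ℝ => v x.1) (K ×ˢ Ioo (0 : ℝ) ε) := by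
    rw [IntegrableOn, restrict_prod_volume]
    exact Integrable.comp_fst hv _
  refine (hd.add h2).congr (Eventually.of_forall fun x => ?_)
  simp

/-- Local integrability up to the edge. -/
lemma locallyIntegrableOn_prod_Ico {V : Set Y} {g : Y × ℝ → F} (hV : IsOpen V)
    (hg : LocallyIntegrableOn g (V ×ˢ Ioo (0 : ℝ) 1) volume)
    (h0 : ∀ K ⊆ V, IsCompact K → ∃ δ > 0, IntegrableOn g (K ×ˢ Ioo (0 : ℝ) δ)) :
    LocallyIntegrableOn g (V ×ˢ Ico (0 : ℝ) 1) volume := by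
  rintro ⟨y, t⟩ ⟨hy, ht⟩
  rcases eq_or_lt_of_le ht.1 with h | h
  · obtain ⟨K, hK, hyK, hKV⟩ := exists_compact_subset hV hy
    obtain ⟨δ, hδ, hgδ⟩ := h0 K hKV hK
    refine ⟨K ×ˢ Ico (0 : ℝ) δ, ?_, ?_⟩
    · have h1 : interior K ×ˢ Iio δ ∈ 𝓝 (y, t) :=
        (isOpen_interior.prod isOpen_Iio).mem_nhds ⟨hyK, by simp only [mem_Iio]; linarith⟩
      filter_upwards [mem_nhdsWithin_of_mem_nhds h1, self_mem_nhdsWithin] with x hx hx'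
      exact ⟨interior_subset hx.1, hx'.2.1, hx.2⟩
    · rw [IntegrableOn, restrict_prod_volume] at *
      rwa [← Measure.restrict_congr_set Ioo_ae_eq_Ico]
  · have hmem : (y, t) ∈ V ×ˢ Ioo (0 : ℝ) 1 := ⟨hy, h, ht.2⟩
    have := hg _ hmem
    rw [(hV.prod isOpen_Ioo).nhdsWithin_eq hmem] at this
    exact this.filter_mono nhdsWithin_le_nhds

/-- Continuity of translations in `L¹`. -/
lemma tendsto_lintegral_translate {w : Y → F} (hw : Integrable w) :
    Tendsto (fun z : Y => ∫⁻ q, ‖w (q + z) - w q‖ₑ) (𝓝 0) (𝓝 0) := by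
  have hw1 : MemLp w 1 volume := memLp_one_iff_integrable.2 hw
  let g : C(Y, C(Y, Y)) := ContinuousMap.curry ⟨fun p : Y × Y => p.2 + p.1, by fun_prop⟩
  have hg : ∀ z, MeasurePreserving (g z) (volume : Measure Y) volume := fun z =>
    measurePreserving_add_right volume z
  have h := Filter.Tendsto.compMeasurePreservingLp (l := 𝓝 (0 : Y)) (f := fun _ => hw1.toLp w)
    tendsto_const_nhds (g.continuous.tendsto 0) hg (hg 0) ENNReal.one_ne_top
  rw [tendsto_iff_edist_tendsto_0] at h
  refine h.congr fun z => ?_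
  rw [Lp.toLp_compMeasurePreserving, Lp.toLp_compMeasurePreserving, Lp.edist_toLp_toLp,
    eLpNorm_one_eq_lintegral_enorm]
  simp [g]

/-- The layer `(0, 2 ε)` instead of `(0, ε)` in the definition of the trace, as needed for `shear`. -/
lemma tendsto_lintegral_comp_two_mul {V : Set Y} {g : Y × ℝ → F} {v : Y → F}
    (h : HasEdgeTrace V g v) {K : Set Y} (hK : IsCompact K) (hKV : K ⊆ V) :
    Tendsto (fun ε : ℝ => (ENNReal.ofReal ε)⁻¹ *
      ∫⁻ q in K, ∫⁻ t in Ioo 0 (2 * ε), ‖g (q, t) - v q‖ₑ) (𝓝[>] 0) (𝓝 0) := by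
  have h2 : Tendsto (fun ε : ℝ => 2 * ε) (𝓝[>] 0) (𝓝[>] 0) := by
    refine tendsto_nhdsWithin_iff.2 ⟨?_, ?_⟩
    · have : Tendsto (fun ε : ℝ => 2 * ε) (𝓝 0) (𝓝 (2 * 0)) := tendsto_id.const_mul 2
      rw [mul_zero] at this
      exact this.mono_left nhdsWithin_le_nhds
    · filter_upwards [self_mem_nhdsWithin] with ε hε
      have : (0 : ℝ) < ε := hε
      simp only [mem_Ioi]; linarith
  have h3 := ENNReal.Tendsto.const_mul (a := 2) ((h.2 K hK hKV).comp h2) (Or.inr (by simp))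
  rw [mul_zero] at h3
  refine h3.congr' ?_
  filter_upwards [self_mem_nhdsWithin] with ε hε
  have hε : 0 < ε := hε
  simp only [Function.comp_apply]
  rw [← mul_assoc, ENNReal.ofReal_mul (by norm_num)]
  congr 1
  rw [ENNReal.mul_inv (by simp) (by simp), ← mul_assoc]
  simp [ENNReal.mul_inv_cancel]

/-- The linear map `(q, t) ↦ (q - 2 t e, 2 t)`. -/
def shear (e : Y) : (Y × ℝ) ≃L[ℝ] (Y × ℝ) :=
  ContinuousLinearEquiv.equivOfInverse
    ((ContinuousLinearMap.fst ℝ Y ℝ - (2 : ℝ) • (ContinuousLinearMap.snd ℝ Y ℝ).smulRight e).prod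
      ((2 : ℝ) • ContinuousLinearMap.snd ℝ Y ℝ))
    ((ContinuousLinearMap.fst ℝ Y ℝ + (ContinuousLinearMap.snd ℝ Y ℝ).smulRight e).prod
      ((1 / 2 : ℝ) • ContinuousLinearMap.snd ℝ Y ℝ))
    (fun x => by ext <;> simp [smul_smul])
    (fun x => by ext <;> simp [smul_smul])

lemma shear_apply (e : Y) (x : Y × ℝ) : shear e x = (x.1 - (2 * x.2) • e, 2 * x.2) := by
  simp [shear, smul_smul]

instance isAddHaarMeasure_prod_real : (volume : Measure (Y × ℝ)).IsAddHaarMeasure :=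
  inferInstanceAs ((volume : Measure Y).prod (volume : Measure ℝ)).IsAddHaarMeasure

/-- Traces are invariant under a shear which fixes the edge. -/
lemma HasEdgeTrace.comp_shear {V : Set Y} (hV : IsOpen V) {g : Y × ℝ → F} {v : Y → F}
    (h : HasEdgeTrace V g v) (hg : LocallyIntegrableOn g (V ×ˢ Ioo (0 : ℝ) 1) volume) (e : Y) :
    HasEdgeTrace V (fun x => g (shear e x)) v := by
  refine ⟨h.1, fun K hK hKV => ?_⟩
  -- the shear leaves `K`, but stays in a slightly larger compact set for small `t`
  obtain ⟨δ, hδ, hδV⟩ := hK.exists_cthickening_subset_open hV hKV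
  set K' := Metric.cthickening δ K with hK'def
  have hK' : IsCompact K' := hK.cthickening
  have hKK' : K ⊆ K' := Metric.self_subset_cthickening K
  obtain ⟨c, hc0, hc⟩ := exists_map_volume_eq_smul (shear e)
  have hvK' : IntegrableOn v K' := (h.integrableOn hg hK' hδV).1
  set w : Y → F := K'.indicator v with hwdef
  have hw : Integrable w := hvK'.integrable_indicator hK'.measurableSet
  have hwt := tendsto_lintegral_translate hw
  -- the modulus of continuity of translations along `e`
  have hwt2 : Tendsto (fun t : ℝ => ∫⁻ q, ‖w (q + -((2 * t) • e)) - w q‖ₑ) (𝓝 0) (𝓝 0) := by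
    refine hwt.comp ?_
    have : Continuous fun t : ℝ => -((2 * t) • e) := by fun_prop
    simpa using this.tendsto 0
  have hg2 := ENNReal.Tendsto.const_mul (a := (c : ℝ≥0∞))
    (tendsto_lintegral_comp_two_mul h hK' hδV) (Or.inr (by simp))
  rw [mul_zero] at hg2
  rw [ENNReal.tendsto_nhds_zero]
  intro η hη
  have hη2 : 0 < η / 2 := ENNReal.half_pos hη.ne'
  rw [ENNReal.tendsto_nhds_zero] at hwt2 hg2
  obtain ⟨τ, hτ, hτw⟩ := Metric.eventually_nhds_iff.1 (hwt2 (η / 2) hη2)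
  have hsmall : ∀ᶠ ε : ℝ in 𝓝[>] 0, 2 * ε * ‖e‖ < δ := by
    refine nhdsWithin_le_nhds ?_
    have : Tendsto (fun ε : ℝ => 2 * ε * ‖e‖) (𝓝 0) (𝓝 (2 * 0 * ‖e‖)) :=
      (tendsto_id.const_mul 2).mul_const _
    rw [mul_zero, zero_mul] at this
    exact this.eventually (gt_mem_nhds hδ)
  filter_upwards [hg2 (η / 2) hη2, self_mem_nhdsWithin, hsmall,
    nhdsWithin_le_nhds (Iio_mem_nhds hτ),
    nhdsWithin_le_nhds (Iio_mem_nhds (show (0 : ℝ) < 1 / 2 by norm_num))] with ε h1 hε h2 h3 h4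
  have hε : 0 < ε := hε
  have h3 : ε < τ := h3
  have h4 : ε < 1 / 2 := h4
  set T := K' ×ˢ Ioo (0 : ℝ) (2 * ε) with hT
  have hTm : MeasurableSet T := hK'.measurableSet.prod measurableSet_Ioo
  have hTsub : T ⊆ V ×ˢ Ioo (0 : ℝ) 1 := prod_mono hδV (Ioo_subset_Ioo_right (by linarith))
  set G : Y × ℝ → ℝ≥0∞ := T.indicator fun x => ‖g x - v x.1‖ₑ with hG
  have hGT : AEMeasurable (fun x : Y × ℝ => ‖g x - v x.1‖ₑ) (volume.restrict T) :=
    ((aestronglyMeasurable_sub_edge hg.aestronglyMeasurable h.1).mono_measure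
    (Measure.restrict_mono hTsub le_rfl)).enorm
  have hGm : AEMeasurable G volume := (aemeasurable_indicator_iff hTm).2 hGT
  have hGLm : AEMeasurable (fun x => G (shear e x)) volume :=
    hGm.comp_quasiMeasurePreserving (quasiMeasurePreserving_linear hc)
  have hA : ∫⁻ q in K, ∫⁻ t in Ioo 0 ε, G (shear e (q, t))
      ≤ c * ∫⁻ q in K', ∫⁻ t in Ioo 0 (2 * ε), ‖g (q, t) - v q‖ₑ := by
    rw [← setLIntegral_prod_volume (G := fun x => G (shear e x)) hGLm.restrict]
    refine (setLIntegral_le_lintegral _ _).trans ?_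
    rw [lintegral_comp_linear hc G, hG, lintegral_indicator hTm, hT,
      setLIntegral_prod_volume hGT]
  have hBm : AEStronglyMeasurable (fun x : Y × ℝ => w (x.1 + -((2 * x.2) • e)) - w x.1) volume := by
    have hw1 : AEStronglyMeasurable (fun x : Y × ℝ => w x.1) volume :=
      AEStronglyMeasurable.comp_fst hw.aestronglyMeasurable
    have hw2 := hw1.comp_quasiMeasurePreserving (quasiMeasurePreserving_linear hc)
    refine AEStronglyMeasurable.sub ?_ hw1
    refine hw2.congr (Eventually.of_forall fun x => ?_)
    simp [shear_apply, sub_eq_add_neg]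
  have hB : ∫⁻ q in K, ∫⁻ t in Ioo 0 ε, ‖w (q + -((2 * t) • e)) - w q‖ₑ
      ≤ ENNReal.ofReal ε * (η / 2) := by
    rw [lintegral_lintegral_swap (f := fun q t => ‖w (q + -((2 * t) • e)) - w q‖ₑ)]
    · calc _ ≤ ∫⁻ t in Ioo 0 ε, η / 2 := by
            refine setLIntegral_mono' measurableSet_Ioo fun t ht => ?_
            refine (setLIntegral_le_lintegral _ _).trans (hτw ?_)
            rw [Real.dist_eq, sub_zero, abs_of_pos ht.1]
            exact ht.2.trans h3
        _ = _ := by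
            rw [setLIntegral_const, Real.volume_Ioo, sub_zero, mul_comm]
    · rw [← restrict_prod_volume]
      exact hBm.enorm.restrict
  have hpt : ∀ q ∈ K, ∀ t ∈ Ioo 0 ε, ‖g (shear e (q, t)) - v q‖ₑ
      ≤ G (shear e (q, t)) + ‖w (q + -((2 * t) • e)) - w q‖ₑ := by
    intro q hq t ht
    have hmem : q + -((2 * t) • e) ∈ K' := by
      refine Metric.mem_cthickening_of_dist_le _ q _ _ hq ?_
      rw [dist_eq_norm, add_sub_cancel_left, norm_neg, norm_smul, Real.norm_of_nonneg (by
        linarith [ht.1])]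
      refine le_trans ?_ h2.le
      gcongr
      exact ht.2.le
    have hmem2 : shear e (q, t) ∈ T := by
      rw [shear_apply]
      refine ⟨by simpa [sub_eq_add_neg] using hmem, ?_, ?_⟩
      · linarith [ht.1]
      · linarith [ht.2]
    rw [hG, indicator_of_mem hmem2, hwdef, indicator_of_mem hmem, indicator_of_mem (hKK' hq)]
    have : g (shear e (q, t)) - v q = (g (shear e (q, t)) - v (shear e (q, t)).1)
        + (v (q + -((2 * t) • e)) - v q) := by
      rw [shear_apply]; simp only [sub_eq_add_neg]; abel
    rw [this]
    exact enorm_add_le _ _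
  calc (ENNReal.ofReal ε)⁻¹ * ∫⁻ q in K, ∫⁻ t in Ioo 0 ε, ‖g (shear e (q, t)) - v q‖ₑ
      ≤ (ENNReal.ofReal ε)⁻¹ * (∫⁻ q in K, ∫⁻ t in Ioo 0 ε,
          (G (shear e (q, t)) + ‖w (q + -((2 * t) • e)) - w q‖ₑ)) := by
        refine mul_le_mul' le_rfl ?_
        exact setLIntegral_mono' hK.measurableSet fun q hq =>
          setLIntegral_mono' measurableSet_Ioo fun t ht => hpt q hq t ht
    _ = (ENNReal.ofReal ε)⁻¹ * ((∫⁻ q in K, ∫⁻ t in Ioo 0 ε, G (shear e (q, t)))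
          + ∫⁻ q in K, ∫⁻ t in Ioo 0 ε, ‖w (q + -((2 * t) • e)) - w q‖ₑ) := by
        congr 1
        rw [← setLIntegral_prod_volume (G := fun x : Y × ℝ => G (shear e x)
            + ‖w (x.1 + -((2 * x.2) • e)) - w x.1‖ₑ) (hGLm.restrict.add hBm.enorm.restrict),
          ← setLIntegral_prod_volume (G := fun x => G (shear e x)) hGLm.restrict,
          ← setLIntegral_prod_volume (G := fun x : Y × ℝ => ‖w (x.1 + -((2 * x.2) • e)) - w x.1‖ₑ)
            hBm.enorm.restrict]
        exact lintegral_add_left' hGLm.restrict _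
    _ ≤ (ENNReal.ofReal ε)⁻¹ * (c * (∫⁻ q in K', ∫⁻ t in Ioo 0 (2 * ε), ‖g (q, t) - v q‖ₑ)
          + ENNReal.ofReal ε * (η / 2)) := by gcongr
    _ = c * ((ENNReal.ofReal ε)⁻¹ * ∫⁻ q in K', ∫⁻ t in Ioo 0 (2 * ε), ‖g (q, t) - v q‖ₑ)
          + (ENNReal.ofReal ε)⁻¹ * ENNReal.ofReal ε * (η / 2) := by ring
    _ ≤ η / 2 + η / 2 := by
        rw [ENNReal.inv_mul_cancel (by simpa using hε) ENNReal.ofReal_ne_top, one_mul]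
        gcongr
    _ = η := ENNReal.add_halves η

end EdgeTrace

/-! ### Existence of traces -/

section TraceExistence

variable {Y F : Type*} [NormedAddCommGroup Y] [NormedSpace ℝ Y] [FiniteDimensional ℝ Y]
  [MeasureSpace Y] [BorelSpace Y] [(volume : Measure Y).IsAddHaarMeasure]
  [NormedAddCommGroup F] [NormedSpace ℝ F] [CompleteSpace F]

/-- If `|g(y, t) - v(y)|` is at most the integral of `|h|` over the layer of height `ε` at the edge
`{ℓ = 0}` whenever `t < ε`, then `v` satisfies the limit condition in `HasEdgeTrace`. Here `ℓ σ` is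
`σ` for the left end and `1 - σ` for the right end. -/
lemma tendsto_edge_of_bound {K : Set Y} (hK : IsCompact K) {g h : Y × ℝ → F} {v : Y → F}
    (hh : IntegrableOn h (K ×ˢ Ioo (0 : ℝ) 1)) {ℓ : ℝ → ℝ} (hℓ : Continuous ℓ)
    (hb : ∀ᵐ y : Y, y ∈ K → ∀ᵐ t : ℝ, t ∈ Ioo (0 : ℝ) 1 → ∀ ε, t < ε → ‖g (y, t) - v y‖ₑ
      ≤ ∫⁻ σ in Ioo (0 : ℝ) 1 ∩ {σ | 0 < ℓ σ ∧ ℓ σ < ε}, ‖h (y, σ)‖ₑ) :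
    Tendsto (fun ε : ℝ => (ENNReal.ofReal ε)⁻¹ *
      ∫⁻ q in K, ∫⁻ t in Ioo 0 ε, ‖g (q, t) - v q‖ₑ) (𝓝[>] 0) (𝓝 0) := by
  have hm : MeasurableSet (K ×ˢ Ioo (0 : ℝ) 1) := hK.measurableSet.prod measurableSet_Ioo
  have hi : Integrable ((K ×ˢ Ioo (0 : ℝ) 1).indicator h) := hh.integrable_indicator hm
  have hs := tendsto_lintegral_slab (ℓ := fun x : Y × ℝ => ℓ x.2) hi (hℓ.comp continuous_snd)
  refine tendsto_of_tendsto_of_tendsto_of_le_of_le' tendsto_const_nhds hs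
    (Eventually.of_forall fun _ => zero_le) ?_
  have hlt1 : ∀ᶠ ε : ℝ in 𝓝[>] 0, 0 < ε ∧ ε < 1 := Ioo_mem_nhdsGT one_pos
  filter_upwards [hlt1] with ε hε
  set S : Set ℝ := Ioo (0 : ℝ) 1 ∩ {σ | 0 < ℓ σ ∧ ℓ σ < ε} with hS
  have hSm : MeasurableSet S := measurableSet_Ioo.inter (measurableSet_slab hℓ ε)
  have hKS : K ×ˢ S ⊆ K ×ˢ Ioo (0 : ℝ) 1 := prod_mono_right inter_subset_left
  have e : ∫⁻ x in {x : Y × ℝ | 0 < ℓ x.2 ∧ ℓ x.2 < ε}, ‖(K ×ˢ Ioo (0 : ℝ) 1).indicator h x‖ₑ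
      = ∫⁻ y in K, ∫⁻ σ in S, ‖h (y, σ)‖ₑ := by
    rw [← setLIntegral_prod_volume (G := fun x => ‖h x‖ₑ) (hh.1.mono_set hKS).enorm]
    simp_rw [enorm_indicator_eq_indicator_enorm]
    rw [lintegral_indicator hm, Measure.restrict_restrict hm]
    congr 2
    ext x
    simp [hS, and_assoc]
  rw [e]
  calc (ENNReal.ofReal ε)⁻¹ * ∫⁻ q in K, ∫⁻ t in Ioo 0 ε, ‖g (q, t) - v q‖ₑ
      ≤ (ENNReal.ofReal ε)⁻¹ * ∫⁻ q in K, ENNReal.ofReal ε * ∫⁻ σ in S, ‖h (q, σ)‖ₑ := by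
        refine mul_le_mul' le_rfl (lintegral_mono_ae ?_)
        filter_upwards [ae_restrict_of_ae hb, ae_restrict_mem hK.measurableSet] with y hy hyK
        calc _ ≤ ∫⁻ t in Ioo 0 ε, ∫⁻ σ in S, ‖h (y, σ)‖ₑ := by
              refine lintegral_mono_ae ?_
              filter_upwards [ae_restrict_of_ae (hy hyK), ae_restrict_mem measurableSet_Ioo]
                with t ht htε
              exact ht ⟨htε.1, htε.2.trans hε.2⟩ ε htε.2
          _ = _ := by rw [setLIntegral_const, Real.volume_Ioo, sub_zero, mul_comm]
    _ = ∫⁻ y in K, ∫⁻ σ in S, ‖h (y, σ)‖ₑ := by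
        rw [lintegral_const_mul' _ _ ENNReal.ofReal_ne_top, ← mul_assoc,
          ENNReal.inv_mul_cancel (by simpa using hε.1) ENNReal.ofReal_ne_top, one_mul]

lemma aestronglyMeasurable_edgeValue {V : Set Y} {f h : Y × ℝ → F}
    (hf : AEStronglyMeasurable f (volume.restrict (V ×ˢ Ioo (0 : ℝ) 1)))
    (hh : AEStronglyMeasurable h (volume.restrict (V ×ˢ Ioo (0 : ℝ) 1))) :
    AEStronglyMeasurable (fun y => edgeValue (fun s => f (y, s)) (fun s => h (y, s)))
      (volume.restrict V) := by
  rw [restrict_prod_volume] at hf hh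
  refine AEStronglyMeasurable.sub ?_ ?_
  · exact ((contDiff_weight.continuous.comp continuous_snd).aestronglyMeasurable.smul
      hf).integral_prod_right'
  · exact ((continuous_weightTail.comp continuous_snd).aestronglyMeasurable.smul
      hh).integral_prod_right'

lemma aestronglyMeasurable_integral_fiber {V : Set Y} {h : Y × ℝ → F}
    (hh : AEStronglyMeasurable h (volume.restrict (V ×ˢ Ioo (0 : ℝ) 1))) :
    AEStronglyMeasurable (fun y => ∫ σ in Ioo (0 : ℝ) 1, h (y, σ)) (volume.restrict V) := by
  rw [restrict_prod_volume] at hh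
  exact hh.integral_prod_right'

/-- A function whose weak derivative in the last variable is integrable up to both ends has traces
at both ends, given by `edgeValue` and by its sum with the integral of the derivative. -/
theorem hasEdgeTrace_edgeValue {V : Set Y} (hV : IsOpen V) {f h : Y × ℝ → F}
    (hf : LocallyIntegrableOn f (V ×ˢ Ioo (0 : ℝ) 1) volume)
    (hhl : LocallyIntegrableOn h (V ×ˢ Ioo (0 : ℝ) 1) volume)
    (hh : ∀ K ⊆ V, IsCompact K → IntegrableOn h (K ×ˢ Ioo (0 : ℝ) 1))
    (hibp : ∀ η : Y × ℝ → ℝ, ContDiff ℝ ∞ η → HasCompactSupport η →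
      tsupport η ⊆ V ×ˢ Ioo (0 : ℝ) 1 →
      ∫ x, (fderiv ℝ η x (0, 1)) • f x = - ∫ x, η x • h x) :
    HasEdgeTrace V f (fun y => edgeValue (fun s => f (y, s)) (fun s => h (y, s))) ∧
    HasEdgeTrace V (fun x => f (x.1, 1 - x.2))
      (fun y => edgeValue (fun s => f (y, s)) (fun s => h (y, s))
        + ∫ σ in Ioo (0 : ℝ) 1, h (y, σ)) := by
  have hae : ∀ᵐ y : Y, ∀ᵐ s : ℝ, (y, s) ∈ V ×ˢ Ioo (0 : ℝ) 1 → f (y, s) = primitive f h (y, s) :=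
    Measure.ae_ae_of_ae_prod (ae_eq_primitive hV hf hh hibp)
  have hmw := aestronglyMeasurable_edgeValue hf.aestronglyMeasurable hhl.aestronglyMeasurable
  refine ⟨⟨hmw, fun K hK hKV => ?_⟩, ⟨hmw.add
    (aestronglyMeasurable_integral_fiber hhl.aestronglyMeasurable), fun K hK hKV => ?_⟩⟩
  · refine tendsto_edge_of_bound hK (hh K hKV hK) (ℓ := fun σ => σ) continuous_id ?_
    filter_upwards [hae] with y hy hyK
    filter_upwards [hy] with t ht ht1 ε htε
    rw [ht ⟨hKV hyK, ht1⟩]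
    simp only [primitive, add_sub_cancel_left]
    refine (enorm_integral_le_lintegral_enorm _).trans (lintegral_mono_set fun σ hσ => ?_)
    exact ⟨⟨hσ.1, hσ.2.trans ht1.2⟩, hσ.1, hσ.2.trans htε⟩
  · refine tendsto_edge_of_bound hK (g := fun x => f (x.1, 1 - x.2)) (h := h)
      (v := fun y => edgeValue (fun s => f (y, s)) (fun s => h (y, s))
        + ∫ σ in Ioo (0 : ℝ) 1, h (y, σ)) (hh K hKV hK) (ℓ := fun σ => 1 - σ) (by fun_prop) ?_
    have hi : ∀ᵐ y : Y, y ∈ K → IntegrableOn (fun σ => h (y, σ)) (Ioo 0 1) := by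
      have h1 := hh K hKV hK
      rw [IntegrableOn, restrict_prod_volume] at h1
      exact (ae_restrict_iff' hK.measurableSet).1 h1.prod_right_ae
    filter_upwards [hae, hi] with y hy hyi hyK
    have hy' : ∀ᵐ t : ℝ, (y, 1 - t) ∈ V ×ˢ Ioo (0 : ℝ) 1 → f (y, 1 - t) = primitive f h (y, 1 - t) :=
      (Measure.measurePreserving_sub_left (volume : Measure ℝ) 1).quasiMeasurePreserving.ae hy
    filter_upwards [hy'] with t ht ht1 ε htε
    have ht2 : 1 - t ∈ Ioo (0 : ℝ) 1 := ⟨by linarith [ht1.2], by linarith [ht1.1]⟩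
    rw [ht ⟨hKV hyK, ht2⟩]
    simp only [primitive, add_sub_add_left_eq_sub]
    have hsplit : Ioo (0 : ℝ) 1 = Ioo 0 (1 - t) ∪ Ico (1 - t) 1 :=
      (Ioo_union_Ico_eq_Ioo ht2.1 ht2.2.le).symm
    have hdisj : Disjoint (Ioo 0 (1 - t)) (Ico (1 - t) 1) :=
      Set.disjoint_left.2 fun x hx hx' => absurd hx.2 (not_lt.2 hx'.1)
    have e : ∫ σ in Ioo (0 : ℝ) 1, h (y, σ)
        = (∫ σ in Ioo 0 (1 - t), h (y, σ)) + ∫ σ in Ico (1 - t) 1, h (y, σ) := by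
      rw [hsplit, setIntegral_union hdisj measurableSet_Ico]
      · exact (hyi hyK).mono_set (by rw [hsplit]; exact subset_union_left)
      · exact (hyi hyK).mono_set (by rw [hsplit]; exact subset_union_right)
    rw [e, sub_add_cancel_left, enorm_neg]
    refine (enorm_integral_le_lintegral_enorm _).trans (lintegral_mono_set fun σ hσ => ?_)
    exact ⟨⟨ht2.1.trans_le hσ.1, hσ.2⟩, by simp only [sub_pos]; exact hσ.2, by linarith [hσ.1]⟩

end TraceExistence

/-! ### The folded function in a chart -/

/-- The linear map `(s, t) ↦ (2 s, t - 2 s)`, used in the piece `{s ≤ t / 2}` of the fold. -/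
def foldLeft : (ℝ × ℝ) ≃L[ℝ] (ℝ × ℝ) :=
  ContinuousLinearEquiv.equivOfInverse
    (((2 : ℝ) • ContinuousLinearMap.fst ℝ ℝ ℝ).prod
      (ContinuousLinearMap.snd ℝ ℝ ℝ - (2 : ℝ) • ContinuousLinearMap.fst ℝ ℝ ℝ))
    (((1 / 2 : ℝ) • ContinuousLinearMap.fst ℝ ℝ ℝ).prod
      (ContinuousLinearMap.fst ℝ ℝ ℝ + ContinuousLinearMap.snd ℝ ℝ ℝ))
    (fun x => by ext <;> simp)
    (fun x => by ext <;> simp)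

/-- The linear map `(s, t) ↦ (t, 2 s - t)`, used in the piece `{t / 2 < s ≤ t}` of the fold. -/
def foldMiddle : (ℝ × ℝ) ≃L[ℝ] (ℝ × ℝ) :=
  ContinuousLinearEquiv.equivOfInverse
    ((ContinuousLinearMap.snd ℝ ℝ ℝ).prod
      ((2 : ℝ) • ContinuousLinearMap.fst ℝ ℝ ℝ - ContinuousLinearMap.snd ℝ ℝ ℝ))
    (((1 / 2 : ℝ) • (ContinuousLinearMap.fst ℝ ℝ ℝ + ContinuousLinearMap.snd ℝ ℝ ℝ)).prod
      (ContinuousLinearMap.fst ℝ ℝ ℝ))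
    (fun x => by ext <;> simp; ring)
    (fun x => by ext <;> simp; ring)

lemma foldLeft_apply (x : ℝ × ℝ) : foldLeft x = (2 * x.1, x.2 - 2 * x.1) := rfl

lemma foldMiddle_apply (x : ℝ × ℝ) : foldMiddle x = (x.2, 2 * x.1 - x.2) := rfl

section ChartFold

variable {E F : Type*} [NormedAddCommGroup E] [NormedSpace ℝ E] [FiniteDimensional ℝ E]
  [MeasureSpace E] [BorelSpace E] [(volume : Measure E).IsAddHaarMeasure]
  [NormedAddCommGroup F] [NormedSpace ℝ F]

variable (E) in
/-- The linear map `id × M` on `E × ℝ × ℝ`. -/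
def liftMap (M : (ℝ × ℝ) ≃L[ℝ] (ℝ × ℝ)) : (E × ℝ × ℝ) ≃L[ℝ] (E × ℝ × ℝ) :=
  (ContinuousLinearEquiv.refl ℝ E).prodCongr M

lemma liftMap_apply (M : (ℝ × ℝ) ≃L[ℝ] (ℝ × ℝ)) (x : E × ℝ × ℝ) :
    liftMap E M x = (x.1, M x.2) := rfl

instance isAddHaarMeasure_prod_real_real : (volume : Measure (E × ℝ × ℝ)).IsAddHaarMeasure :=
  inferInstanceAs ((volume : Measure E).prod (volume : Measure (ℝ × ℝ))).IsAddHaarMeasure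

/-- The weak derivative of the folded function, given those of the two functions. The value on the
null set `{s = t / 2}`, where the formula would leave the domain, is set to `0`. -/
def chartFoldDeriv (f₀' f₁' : E × ℝ × ℝ → E × ℝ × ℝ →ₗ[ℝ] F) (x : E × ℝ × ℝ) :
    E × ℝ × ℝ →ₗ[ℝ] F :=
  if x.2.1 < x.2.2 / 2 then f₀' (liftMap E foldLeft x) ∘ₗ (liftMap E foldLeft).toLinearMap
  else if x.2.1 = x.2.2 / 2 then 0
  else if x.2.1 ≤ x.2.2 then f₁' (liftMap E foldMiddle x) ∘ₗ (liftMap E foldMiddle).toLinearMap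
  else f₁' x

lemma chartFoldDeriv_of_left {f₀' f₁' : E × ℝ × ℝ → E × ℝ × ℝ →ₗ[ℝ] F} {x : E × ℝ × ℝ}
    (h : x.2.1 < x.2.2 / 2) : chartFoldDeriv f₀' f₁' x
      = f₀' (liftMap E foldLeft x) ∘ₗ (liftMap E foldLeft).toLinearMap := by
  simp only [chartFoldDeriv, if_pos h]

lemma chartFoldDeriv_of_middle {f₀' f₁' : E × ℝ × ℝ → E × ℝ × ℝ →ₗ[ℝ] F} {x : E × ℝ × ℝ}
    (h : x.2.2 / 2 < x.2.1) (h' : x.2.1 ≤ x.2.2) : chartFoldDeriv f₀' f₁' x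
      = f₁' (liftMap E foldMiddle x) ∘ₗ (liftMap E foldMiddle).toLinearMap := by
  simp only [chartFoldDeriv, if_neg (not_lt.2 h.le), if_neg h.ne', if_pos h']

lemma chartFoldDeriv_of_right {f₀' f₁' : E × ℝ × ℝ → E × ℝ × ℝ →ₗ[ℝ] F} {x : E × ℝ × ℝ}
    (h : x.2.2 / 2 < x.2.1) (h' : x.2.2 < x.2.1) : chartFoldDeriv f₀' f₁' x = f₁' x := by
  simp only [chartFoldDeriv, if_neg (not_lt.2 h.le), if_neg h.ne', if_neg (not_le.2 h')]

lemma fold_of_left {α N : Type*} {U₀ U₁ : α × ℝ × ℝ → N} {z : α × ℝ × ℝ}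
    (h : z.2.1 ≤ z.2.2 / 2) : fold U₀ U₁ z = U₀ (z.1, foldLeft z.2) := by
  simp only [fold, if_pos h]; rfl

lemma fold_of_middle {α N : Type*} {U₀ U₁ : α × ℝ × ℝ → N} {z : α × ℝ × ℝ}
    (h : z.2.2 / 2 < z.2.1) (h' : z.2.1 ≤ z.2.2) :
    fold U₀ U₁ z = U₁ (z.1, foldMiddle z.2) := by
  simp only [fold, if_neg (not_le.2 h), if_pos h']; rfl

lemma fold_of_right {α N : Type*} {U₀ U₁ : α × ℝ × ℝ → N} {z : α × ℝ × ℝ}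
    (h : z.2.2 / 2 < z.2.1) (h' : z.2.2 < z.2.1) : fold U₀ U₁ z = U₁ z := by
  simp only [fold, if_neg (not_le.2 h), if_neg (not_le.2 h')]

/-- `s - t` as a linear form on `E × ℝ × ℝ`. -/
def formRight (E : Type*) [NormedAddCommGroup E] [NormedSpace ℝ E] : E × ℝ × ℝ →L[ℝ] ℝ :=
  (ContinuousLinearMap.fst ℝ ℝ ℝ - ContinuousLinearMap.snd ℝ ℝ ℝ) ∘L
    ContinuousLinearMap.snd ℝ E (ℝ × ℝ)

/-- `t - 2 s` as a linear form on `E × ℝ × ℝ`. -/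
def formLeft (E : Type*) [NormedAddCommGroup E] [NormedSpace ℝ E] : E × ℝ × ℝ →L[ℝ] ℝ :=
  (ContinuousLinearMap.snd ℝ ℝ ℝ - (2 : ℝ) • ContinuousLinearMap.fst ℝ ℝ ℝ) ∘L
    ContinuousLinearMap.snd ℝ E (ℝ × ℝ)

lemma formRight_apply (x : E × ℝ × ℝ) : formRight E x = x.2.1 - x.2.2 := rfl
lemma formLeft_apply (x : E × ℝ × ℝ) : formLeft E x = x.2.2 - 2 * x.2.1 := rfl

/-- Local integrability of a function given by different formulas on the three pieces. The left and
middle formulas have to be integrable up to the bottom, onto which they map `{s = t / 2}`. -/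
lemma locallyIntegrableOn_pieces {V : Set E} (hV : IsOpen V) {u uA uB uC : E × ℝ × ℝ → F}
    (hA : LocallyIntegrableOn uA (V ×ˢ (Ioo (0 : ℝ) 1 ×ˢ Ico (0 : ℝ) 1)) volume)
    (hB : LocallyIntegrableOn uB (V ×ˢ (Ioo (0 : ℝ) 1 ×ˢ Ico (0 : ℝ) 1)) volume)
    (hC : LocallyIntegrableOn uC (V ×ˢ (Ioo (0 : ℝ) 1 ×ˢ Ioo (0 : ℝ) 1)) volume)
    (eA : ∀ x : E × ℝ × ℝ, x.2.1 < x.2.2 / 2 → u x = uA (liftMap E foldLeft x))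
    (eB : ∀ x : E × ℝ × ℝ, x.2.2 / 2 < x.2.1 → x.2.1 ≤ x.2.2 → u x = uB (liftMap E foldMiddle x))
    (eC : ∀ x : E × ℝ × ℝ, x.2.2 / 2 < x.2.1 → x.2.2 < x.2.1 → u x = uC x) :
    LocallyIntegrableOn u (V ×ˢ (Ioo (0 : ℝ) 1 ×ˢ Ioo (0 : ℝ) 1)) volume := by
  have hΩ : IsOpen (V ×ˢ (Ioo (0 : ℝ) 1 ×ˢ Ioo (0 : ℝ) 1)) :=
    hV.prod (isOpen_Ioo.prod isOpen_Ioo)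
  obtain ⟨cA, -, hcA⟩ := exists_map_volume_eq_smul (liftMap E foldLeft)
  obtain ⟨cB, -, hcB⟩ := exists_map_volume_eq_smul (liftMap E foldMiddle)
  rw [locallyIntegrableOn_iff hΩ.isLocallyClosed]
  have hnull : ∀ᵐ x : E × ℝ × ℝ, formLeft E x ≠ 0 :=
    volume_hyperplane (formLeft E) (0, 0, 1) (by rw [formLeft_apply]; norm_num)
  intro K hK hKc
  have cl1 : IsClosed {x : E × ℝ × ℝ | x.2.1 ≤ x.2.2 / 2} :=
    isClosed_le (by fun_prop) (by fun_prop)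
  have cl2 : IsClosed {x : E × ℝ × ℝ | x.2.2 / 2 ≤ x.2.1} :=
    isClosed_le (by fun_prop) (by fun_prop)
  have cl3 : IsClosed {x : E × ℝ × ℝ | x.2.1 ≤ x.2.2} := isClosed_le (by fun_prop) (by fun_prop)
  have cl4 : IsClosed {x : E × ℝ × ℝ | x.2.2 ≤ x.2.1} := isClosed_le (by fun_prop) (by fun_prop)
  have op2 : IsOpen {x : E × ℝ × ℝ | x.2.2 / 2 < x.2.1} := isOpen_lt (by fun_prop) (by fun_prop)
  have op4 : IsOpen {x : E × ℝ × ℝ | x.2.2 < x.2.1} := isOpen_lt (by fun_prop) (by fun_prop)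
  have iA : IntegrableOn u (K ∩ {x | x.2.1 ≤ x.2.2 / 2}) := by
    have h := (locallyIntegrableOn_comp_linear hcA hA).integrableOn_compact_subset
      (t := K ∩ {x | x.2.1 ≤ x.2.2 / 2}) (fun x hx => by
        have h1 := hK hx.1
        have h2 : x.2.1 ≤ x.2.2 / 2 := hx.2
        have h3 := h1.2.1.1
        have h4 := h1.2.2.2
        exact ⟨h1.1, ⟨by simp only [liftMap_apply, foldLeft_apply]; linarith,
          by simp only [liftMap_apply, foldLeft_apply]; linarith⟩,
          ⟨by simp only [liftMap_apply, foldLeft_apply]; linarith,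
          by simp only [liftMap_apply, foldLeft_apply]; linarith⟩⟩) (hKc.inter_right cl1)
    refine Integrable.congr h ?_
    filter_upwards [ae_restrict_mem (hKc.inter_right cl1).measurableSet, ae_restrict_of_ae hnull]
      with x hx hx'
    exact (eA x (lt_of_le_of_ne hx.2 fun h => hx' (by rw [formLeft_apply, h]; ring))).symm
  have iB : IntegrableOn u (K ∩ ({x | x.2.2 / 2 < x.2.1} ∩ {x | x.2.1 ≤ x.2.2})) := by
    have h := (locallyIntegrableOn_comp_linear hcB hB).integrableOn_compact_subset
      (t := K ∩ ({x | x.2.2 / 2 ≤ x.2.1} ∩ {x | x.2.1 ≤ x.2.2})) (fun x hx => by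
        have h1 := hK hx.1
        have h2 : x.2.2 / 2 ≤ x.2.1 := hx.2.1
        have h2' : x.2.1 ≤ x.2.2 := hx.2.2
        have h3 := h1.2.2.1
        have h4 := h1.2.2.2
        exact ⟨h1.1, ⟨by simp only [liftMap_apply, foldMiddle_apply]; linarith,
          by simp only [liftMap_apply, foldMiddle_apply]; linarith⟩,
          ⟨by simp only [liftMap_apply, foldMiddle_apply]; linarith,
          by simp only [liftMap_apply, foldMiddle_apply]; linarith⟩⟩)
      (hKc.inter_right (cl2.inter cl3))
    refine (h.mono_set ?_).congr_fun (fun x hx => (eB x hx.2.1 hx.2.2).symm)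
      (hKc.measurableSet.inter (op2.measurableSet.inter cl3.measurableSet))
    exact inter_subset_inter_right _ (inter_subset_inter_left _
      fun x (hx : x.2.2 / 2 < x.2.1) => hx.le)
  have iC : IntegrableOn u (K ∩ {x | x.2.2 < x.2.1}) := by
    have h := hC.integrableOn_compact_subset hK hKc
    refine (h.mono_set inter_subset_left).congr_fun (fun x hx => (eC x ?_ hx.2).symm)
      (hKc.measurableSet.inter op4.measurableSet)
    have h1 := (hK hx.1).2.2.1
    have h2 : x.2.2 < x.2.1 := hx.2
    linarith
  refine ((iA.union iB).union iC).mono_set fun x hx => ?_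
  by_cases h1 : x.2.1 ≤ x.2.2 / 2
  · exact Or.inl (Or.inl ⟨hx, h1⟩)
  · by_cases h2 : x.2.1 ≤ x.2.2
    · exact Or.inl (Or.inr ⟨hx, not_le.1 h1, h2⟩)
    · exact Or.inr ⟨hx, not_le.1 h2⟩

/-- The folded function is weakly differentiable away from the two interfaces. -/
lemma hasWeakDerivOn_fold_away {V : Set E} (hV : IsOpen V) {f₀ f₁ : E × ℝ × ℝ → F}
    {f₀' f₁' : E × ℝ × ℝ → E × ℝ × ℝ →ₗ[ℝ] F}
    (h₀ : HasWeakDerivOn (V ×ˢ (Ioo (0 : ℝ) 1 ×ˢ Ioo (0 : ℝ) 1)) f₀ f₀')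
    (h₁ : HasWeakDerivOn (V ×ˢ (Ioo (0 : ℝ) 1 ×ˢ Ioo (0 : ℝ) 1)) f₁ f₁') :
    HasWeakDerivOn (V ×ˢ (Ioo (0 : ℝ) 1 ×ˢ Ioo (0 : ℝ) 1) ∩
      {x | x.2.1 ≠ x.2.2 / 2} ∩ {x | x.2.1 ≠ x.2.2}) (fold f₀ f₁) (chartFoldDeriv f₀' f₁') := by
  set Ω := V ×ˢ (Ioo (0 : ℝ) 1 ×ˢ Ioo (0 : ℝ) 1) with hΩdef
  have hΩ : IsOpen Ω := hV.prod (isOpen_Ioo.prod isOpen_Ioo)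
  obtain ⟨cA, -, hcA⟩ := exists_map_volume_eq_smul (liftMap E foldLeft)
  obtain ⟨cB, -, hcB⟩ := exists_map_volume_eq_smul (liftMap E foldMiddle)
  set A : Set (E × ℝ × ℝ) := Ω ∩ {x | x.2.1 < x.2.2 / 2} with hA
  set B : Set (E × ℝ × ℝ) := Ω ∩ ({x | x.2.2 / 2 < x.2.1} ∩ {x | x.2.1 < x.2.2}) with hB
  set C : Set (E × ℝ × ℝ) := Ω ∩ {x | x.2.2 < x.2.1} with hC
  have oA : IsOpen A := hΩ.inter (isOpen_lt (by fun_prop) (by fun_prop))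
  have oB : IsOpen B := hΩ.inter ((isOpen_lt (by fun_prop) (by fun_prop)).inter
    (isOpen_lt (by fun_prop) (by fun_prop)))
  have oC : IsOpen C := hΩ.inter (isOpen_lt (by fun_prop) (by fun_prop))
  have wA : HasWeakDerivOn A (fold f₀ f₁) (chartFoldDeriv f₀' f₁') := by
    refine ((h₀.comp_linear hcA).mono fun x hx => ?_).congr oA.measurableSet (fun x hx => ?_)
      fun x hx => ?_
    · have h2 : x.2.1 < x.2.2 / 2 := hx.2
      have h3 := hx.1.2.1.1
      have h4 := hx.1.2.2.2
      exact ⟨hx.1.1, ⟨by simp only [liftMap_apply, foldLeft_apply]; linarith,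
        by simp only [liftMap_apply, foldLeft_apply]; linarith⟩,
        ⟨by simp only [liftMap_apply, foldLeft_apply]; linarith,
        by simp only [liftMap_apply, foldLeft_apply]; linarith⟩⟩
    · exact (fold_of_left (le_of_lt hx.2)).symm
    · exact (chartFoldDeriv_of_left hx.2).symm
  have wB : HasWeakDerivOn B (fold f₀ f₁) (chartFoldDeriv f₀' f₁') := by
    refine ((h₁.comp_linear hcB).mono fun x hx => ?_).congr oB.measurableSet (fun x hx => ?_)
      fun x hx => ?_
    · have h2 : x.2.2 / 2 < x.2.1 := hx.2.1
      have h2' : x.2.1 < x.2.2 := hx.2.2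
      have h3 := hx.1.2.2.1
      have h4 := hx.1.2.2.2
      exact ⟨hx.1.1, ⟨by simp only [liftMap_apply, foldMiddle_apply]; linarith,
        by simp only [liftMap_apply, foldMiddle_apply]; linarith⟩,
        ⟨by simp only [liftMap_apply, foldMiddle_apply]; linarith,
        by simp only [liftMap_apply, foldMiddle_apply]; linarith⟩⟩
    · exact (fold_of_middle hx.2.1 (le_of_lt hx.2.2)).symm
    · exact (chartFoldDeriv_of_middle hx.2.1 (le_of_lt hx.2.2)).symm
  have wC : HasWeakDerivOn C (fold f₀ f₁) (chartFoldDeriv f₀' f₁') := by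
    have key : ∀ x ∈ C, x.2.2 / 2 < x.2.1 ∧ x.2.2 < x.2.1 := fun x hx => by
      have h2 : x.2.2 < x.2.1 := hx.2
      have h3 := hx.1.2.2.1
      exact ⟨by linarith, h2⟩
    refine (h₁.mono inter_subset_left).congr oC.measurableSet (fun x hx => ?_) fun x hx => ?_
    · exact (fold_of_right (key x hx).1 (key x hx).2).symm
    · exact (chartFoldDeriv_of_right (key x hx).1 (key x hx).2).symm
  have dAB : Disjoint A B := Set.disjoint_left.2 fun x hx hx' => by
    have h1 : x.2.1 < x.2.2 / 2 := hx.2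
    have h2 : x.2.2 / 2 < x.2.1 := hx'.2.1
    linarith
  have dC : Disjoint (A ∪ B) C := Set.disjoint_left.2 fun x hx hx' => by
    have h2 : x.2.2 < x.2.1 := hx'.2
    have h4 := hx'.1.2.2.1
    rcases hx with hx | hx
    · have h1 : x.2.1 < x.2.2 / 2 := hx.2
      linarith
    · have h1 : x.2.1 < x.2.2 := hx.2.2
      linarith
  refine ((wA.union oA oB dAB wB).union (oA.union oB) oC dC wC).mono ?_
  rintro x ⟨⟨hx, h1⟩, h2⟩
  rcases lt_or_gt_of_ne h1 with h | h
  · exact Or.inl (Or.inl ⟨hx, h⟩)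
  · rcases lt_or_gt_of_ne h2 with h' | h'
    · exact Or.inl (Or.inr ⟨hx, h, h'⟩)
    · exact Or.inr ⟨hx, h'⟩

/-- The folded function is weakly differentiable across the two interfaces as soon as `f₀` and `f₁`
have vanishing difference at the bottom, in average. The interfaces meet only at `s = t = 0`, outside
the domain, but each of them has to be crossed in the presence of the other: `{s = t}` is crossed
first, on the complement of `{s = t / 2}`. -/
lemma hasWeakDerivOn_fold_of_jump {V : Set E} (hV : IsOpen V) {f₀ f₁ : E × ℝ × ℝ → F}
    {f₀' f₁' : E × ℝ × ℝ → E × ℝ × ℝ →ₗ[ℝ] F}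
    (h₀ : HasWeakDerivOn (V ×ˢ (Ioo (0 : ℝ) 1 ×ˢ Ioo (0 : ℝ) 1)) f₀ f₀')
    (h₁ : HasWeakDerivOn (V ×ˢ (Ioo (0 : ℝ) 1 ×ˢ Ioo (0 : ℝ) 1)) f₁ f₁')
    (hl₀ : LocallyIntegrableOn f₀ (V ×ˢ (Ioo (0 : ℝ) 1 ×ˢ Ico (0 : ℝ) 1)) volume)
    (hl₁ : LocallyIntegrableOn f₁ (V ×ˢ (Ioo (0 : ℝ) 1 ×ˢ Ico (0 : ℝ) 1)) volume)
    (hl₀' : ∀ v, LocallyIntegrableOn (fun x => f₀' x v)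
      (V ×ˢ (Ioo (0 : ℝ) 1 ×ˢ Ico (0 : ℝ) 1)) volume)
    (hl₁' : ∀ v, LocallyIntegrableOn (fun x => f₁' x v)
      (V ×ˢ (Ioo (0 : ℝ) 1 ×ˢ Ico (0 : ℝ) 1)) volume)
    (htr : ∀ K : Set (E × ℝ), IsCompact K → K ⊆ V ×ˢ Ioo (0 : ℝ) 1 →
      Tendsto (fun ε : ℝ => (ENNReal.ofReal ε)⁻¹ *
        ∫⁻ x in {x : E × ℝ × ℝ | (x.1, x.2.1) ∈ K ∧ x.2.2 ∈ Ioo 0 ε}, ‖f₀ x - f₁ x‖ₑ)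
        (𝓝[>] 0) (𝓝 0)) :
    HasWeakDerivOn (V ×ˢ (Ioo (0 : ℝ) 1 ×ˢ Ioo (0 : ℝ) 1)) (fold f₀ f₁)
      (chartFoldDeriv f₀' f₁') := by
  set Ω := V ×ˢ (Ioo (0 : ℝ) 1 ×ˢ Ioo (0 : ℝ) 1) with hΩdef
  have hΩ : IsOpen Ω := hV.prod (isOpen_Ioo.prod isOpen_Ioo)
  have hloc : LocallyIntegrableOn (fold f₀ f₁) Ω volume :=
    locallyIntegrableOn_pieces hV hl₀ hl₁ h₁.1 (fun x hx => fold_of_left hx.le)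
      (fun x hx hx' => fold_of_middle hx hx') fun x hx hx' => fold_of_right hx hx'
  have hloc' : ∀ v, LocallyIntegrableOn (fun x => chartFoldDeriv f₀' f₁' x v) Ω volume := fun v =>
    locallyIntegrableOn_pieces hV (hl₀' (liftMap E foldLeft v)) (hl₁' (liftMap E foldMiddle v))
      (h₁.2 v).1 (fun x hx => by rw [chartFoldDeriv_of_left hx]; rfl)
      (fun x hx hx' => by rw [chartFoldDeriv_of_middle hx hx']; rfl)
      (fun x hx hx' => by rw [chartFoldDeriv_of_right hx hx'])
  have hΩ' : IsOpen (Ω ∩ {x | formLeft E x ≠ 0}) :=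
    hΩ.inter (isOpen_ne_fun (formLeft E).continuous continuous_const)
  have hsub : Ω ∩ {x | formLeft E x ≠ 0} ⊆ Ω := inter_subset_left
  have w₁ : HasWeakDerivOn (Ω ∩ {x | formLeft E x ≠ 0}) (fold f₀ f₁) (chartFoldDeriv f₀' f₁') := by
    -- the map `(s, t) ↦ ((s + t) / 2, s)` takes `{s > t}` to the middle piece and does not change
    -- the value of the fold, so that there is no jump at all
    refine HasWeakDerivOn.glue hΩ' (hloc.mono_set hsub) (fun v => (hloc' v).mono_set hsub)
      (formRight E) (0, 1 / 2, -1) (by rw [formRight_apply]; norm_num) ?_ ?_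
    · refine (hasWeakDerivOn_fold_away hV h₀ h₁).mono ?_
      rintro x ⟨⟨hx, h1⟩, h2⟩
      refine ⟨⟨hx, fun h => h1 ?_⟩, fun h => h2 ?_⟩
      · rw [formLeft_apply]; linarith [show x.2.1 = x.2.2 / 2 from h]
      · rw [formRight_apply]; linarith [show x.2.1 = x.2.2 from h]
    · intro K hK hKc
      refine tendsto_const_nhds.congr fun ε => ?_
      symm
      have hm : MeasurableSet (K ∩ {x | 0 < formRight E x ∧ formRight E x < ε}) :=
        hKc.measurableSet.inter (measurableSet_slab (formRight E).continuous ε)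
      rw [setLIntegral_congr_fun hm (g := fun _ => 0)]
      · simp
      · rintro ⟨y, s, t⟩ ⟨hx, hx1, -⟩
        have ht : 0 < t := (hK hx).1.2.2.1
        have hst : 0 < s - t := hx1
        have e : ((y, s, t) : E × ℝ × ℝ) - formRight E (y, s, t) • (0, 1 / 2, -1)
            = (y, (s + t) / 2, s) := by
          rw [formRight_apply]
          ext <;> simp
          ring
        simp only [e]
        rw [fold_of_right (by simp only; linarith) (by simp only; linarith),
          fold_of_middle (by simp only; linarith) (by simp only; linarith)]
        simp only [foldMiddle_apply]
        rw [show 2 * ((s + t) / 2) - s = t by ring, sub_self, enorm_zero]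
  -- the map `(s, t) ↦ (t / 2, 2 s)` takes `{s < t / 2}` to the middle piece, and the jump there is
  -- `f₀ - f₁` at the point `(2 s, t - 2 s)` of the layer of height `ε` at the bottom
  refine HasWeakDerivOn.glue hΩ hloc hloc' (formLeft E) (0, -1 / 2, 1)
    (by rw [formLeft_apply]; norm_num) w₁ ?_
  intro K hK hKc
  obtain ⟨c, -, hc⟩ := exists_map_volume_eq_smul (liftMap E foldLeft)
  have cl : IsClosed {x : E × ℝ × ℝ | 2 * x.2.1 ≤ x.2.2} := isClosed_le (by fun_prop) (by fun_prop)
  have hK₂c : IsCompact ((fun x : E × ℝ × ℝ => (x.1, 2 * x.2.1)) '' (K ∩ {x | 2 * x.2.1 ≤ x.2.2})) :=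
    (hKc.inter_right cl).image (by fun_prop)
  set K₂ := (fun x : E × ℝ × ℝ => (x.1, 2 * x.2.1)) '' (K ∩ {x | 2 * x.2.1 ≤ x.2.2}) with hK₂
  have hK₂V : K₂ ⊆ V ×ˢ Ioo (0 : ℝ) 1 := by
    rintro _ ⟨x, ⟨hx, hx'⟩, rfl⟩
    have h1 := hK hx
    have h2 : 2 * x.2.1 ≤ x.2.2 := hx'
    exact ⟨h1.1, by linarith [h1.2.1.1], by linarith [h1.2.2.2]⟩
  obtain ⟨a, b, ha, -, -, -, hab⟩ := exists_Icc_of_isCompact_subset_Ioo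
    (hKc.image (f := fun x : E × ℝ × ℝ => x.2.1) (by fun_prop))
    (by rintro _ ⟨x, hx, rfl⟩; exact (hK hx).2.1)
  have hlim := ENNReal.Tendsto.const_mul (a := (c : ℝ≥0∞)) (htr K₂ hK₂c hK₂V) (Or.inr (by simp))
  rw [mul_zero] at hlim
  refine tendsto_of_tendsto_of_tendsto_of_le_of_le' tendsto_const_nhds hlim
    (Eventually.of_forall fun _ => zero_le) ?_
  filter_upwards [nhdsWithin_le_nhds (Iio_mem_nhds ha)] with ε hε
  have hε : ε < a := hε
  set T : Set (E × ℝ × ℝ) := {x | (x.1, x.2.1) ∈ K₂ ∧ x.2.2 ∈ Ioo 0 ε} with hT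
  have hTm : MeasurableSet T :=
    (hK₂c.measurableSet.preimage (by fun_prop)).inter (measurableSet_Ioo.preimage (by fun_prop))
  have hm : MeasurableSet (K ∩ {x | 0 < formLeft E x ∧ formLeft E x < ε}) :=
    hKc.measurableSet.inter (measurableSet_slab (formLeft E).continuous ε)
  rw [← mul_assoc, mul_comm (c : ℝ≥0∞), mul_assoc]
  refine mul_le_mul' le_rfl ?_
  rw [← lintegral_indicator hTm, ← lintegral_comp_linear hc]
  refine (setLIntegral_mono' hm ?_).trans (setLIntegral_le_lintegral _ _)
  rintro ⟨y, s, t⟩ ⟨hx, hx1, hx2⟩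
  have h1 : 0 < t - 2 * s := hx1
  have h2 : t - 2 * s < ε := hx2
  have has : a ≤ s := (hab ⟨_, hx, rfl⟩).1
  have e : ((y, s, t) : E × ℝ × ℝ) - formLeft E (y, s, t) • (0, -1 / 2, 1) = (y, t / 2, 2 * s) := by
    rw [formLeft_apply]
    ext <;> simp
    ring
  have hmem : liftMap E foldLeft (y, s, t) ∈ T :=
    ⟨⟨(y, s, t), ⟨hx, show 2 * s ≤ t by linarith⟩, rfl⟩, h1, h2⟩
  rw [indicator_of_mem hmem]
  simp only [e]
  rw [fold_of_left (by simp only; linarith), fold_of_middle (by simp only; linarith)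
    (by simp only; linarith)]
  simp only [liftMap_apply, foldMiddle_apply, foldLeft_apply]
  rw [show 2 * (t / 2) - 2 * s = t - 2 * s by ring]

end ChartFold

/-! ### Traces and weak derivative of the folded function in a chart -/

section ChartTraces

variable {E F : Type*} [NormedAddCommGroup E] [NormedSpace ℝ E] [FiniteDimensional ℝ E]
  [MeasureSpace E] [BorelSpace E] [(volume : Measure E).IsAddHaarMeasure]
  [NormedAddCommGroup F] [NormedSpace ℝ F]

variable (E) in
/-- The coordinates `((x', t), s) ↦ (x', s, t)` in which the left and right faces are the ends of
the last interval. -/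
def leftCoord : ((E × ℝ) × ℝ) ≃L[ℝ] (E × ℝ × ℝ) :=
  (ContinuousLinearEquiv.prodAssoc ℝ E ℝ ℝ).trans
    ((ContinuousLinearEquiv.refl ℝ E).prodCongr (ContinuousLinearEquiv.prodComm ℝ ℝ ℝ))

lemma leftCoord_apply (z : (E × ℝ) × ℝ) : leftCoord E z = (z.1.1, z.2, z.1.2) := rfl

variable (E) in
/-- The coordinates `((x', s), t) ↦ (x', s, t)` in which the bottom face is an end of the last
interval. -/
def bottomCoord : ((E × ℝ) × ℝ) ≃L[ℝ] (E × ℝ × ℝ) := ContinuousLinearEquiv.prodAssoc ℝ E ℝ ℝ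

lemma bottomCoord_apply (z : (E × ℝ) × ℝ) : bottomCoord E z = (z.1.1, z.1.2, z.2) := rfl

lemma map_bottomCoord : Measure.map (bottomCoord E) (volume : Measure ((E × ℝ) × ℝ))
    = (1 : ℝ≥0) • (volume : Measure (E × ℝ × ℝ)) := by
  rw [one_smul]
  exact (volume_preserving_prodAssoc (α₁ := E) (β₁ := ℝ) (γ₁ := ℝ)).map_eq

/-- Integrability over compact sets times the square, in coordinates adapted to a face. -/
lemma integrableOn_fiber {L : ((E × ℝ) × ℝ) ≃L[ℝ] (E × ℝ × ℝ)}
    (hL : ∀ z : (E × ℝ) × ℝ, z.1.2 ∈ Ioo (0 : ℝ) 1 → z.2 ∈ Ioo (0 : ℝ) 1 →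
      (L z).1 = z.1.1 ∧ (L z).2 ∈ Ioo (0 : ℝ) 1 ×ˢ Ioo (0 : ℝ) 1)
    {V : Set E} {u : E × ℝ × ℝ → F}
    (hu : ∀ K ⊆ V, IsCompact K → IntegrableOn u (K ×ˢ (Ioo (0 : ℝ) 1 ×ˢ Ioo (0 : ℝ) 1)))
    {K : Set (E × ℝ)} (hKV : K ⊆ V ×ˢ Ioo (0 : ℝ) 1) (hK : IsCompact K) :
    IntegrableOn (fun z => u (L z)) (K ×ˢ Ioo (0 : ℝ) 1) := by
  obtain ⟨c, -, hc⟩ := exists_map_volume_eq_smul L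
  refine (integrableOn_comp_linear hc (hu (Prod.fst '' K)
    (by rintro _ ⟨x, hx, rfl⟩; exact (hKV hx).1) (hK.image continuous_fst))).mono_set ?_
  rintro z ⟨hz, hz'⟩
  obtain ⟨h1, h2⟩ := hL z (hKV hz).2 hz'
  exact ⟨⟨z.1, hz, h1.symm⟩, h2⟩

lemma exists_Icc_of_isCompact_edge {V : Set E} {K : Set (E × ℝ)} (hK : IsCompact K)
    (hKV : K ⊆ V ×ˢ Ioo (0 : ℝ) 1) :
    ∃ a b : ℝ, 0 < a ∧ b < 1 ∧ ∀ q ∈ K, a ≤ q.2 ∧ q.2 ≤ b := by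
  obtain ⟨a, b, ha, -, -, hb, hab⟩ := exists_Icc_of_isCompact_subset_Ioo
    (hK.image continuous_snd) (by rintro _ ⟨x, hx, rfl⟩; exact (hKV hx).2)
  exact ⟨a, b, ha, hb, fun q hq => hab ⟨q, hq, rfl⟩⟩

/-- Weakly differentiable functions have traces on the left and right faces. -/
lemma HasWeakDerivOn.hasEdgeTrace [CompleteSpace F] {V : Set E} (hV : IsOpen V)
    {f : E × ℝ × ℝ → F} {f' : E × ℝ × ℝ → E × ℝ × ℝ →ₗ[ℝ] F}
    (h : HasWeakDerivOn (V ×ˢ (Ioo (0 : ℝ) 1 ×ˢ Ioo (0 : ℝ) 1)) f f')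
    (hd : ∀ K ⊆ V, IsCompact K → ∀ v,
      IntegrableOn (fun x => f' x v) (K ×ˢ (Ioo (0 : ℝ) 1 ×ˢ Ioo (0 : ℝ) 1))) :
    HasEdgeTrace (V ×ˢ Ioo (0 : ℝ) 1) (fun z => f (z.1.1, z.2, z.1.2))
      (fun q => edgeValue (fun s => f (q.1, s, q.2)) (fun s => f' (q.1, s, q.2) (0, 1, 0))) ∧
    HasEdgeTrace (V ×ˢ Ioo (0 : ℝ) 1) (fun z => f (z.1.1, 1 - z.2, z.1.2))
      (fun q => edgeValue (fun s => f (q.1, s, q.2)) (fun s => f' (q.1, s, q.2) (0, 1, 0))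
        + ∫ s in Ioo (0 : ℝ) 1, f' (q.1, s, q.2) (0, 1, 0)) := by
  obtain ⟨c, -, hc⟩ := exists_map_volume_eq_smul (leftCoord E)
  have hΩ : leftCoord E ⁻¹' (V ×ˢ (Ioo (0 : ℝ) 1 ×ˢ Ioo (0 : ℝ) 1))
      = (V ×ˢ Ioo (0 : ℝ) 1) ×ˢ Ioo (0 : ℝ) 1 := by
    ext z
    simp only [mem_preimage, leftCoord_apply, mem_prod]
    tauto
  have h' := h.comp_linear hc
  rw [hΩ] at h'
  have e : leftCoord E (0, 1) = (0, 1, 0) := rfl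
  refine hasEdgeTrace_edgeValue (Y := E × ℝ) (f := fun z => f (z.1.1, z.2, z.1.2))
    (h := fun z => f' (z.1.1, z.2, z.1.2) (0, 1, 0)) (hV.prod isOpen_Ioo) h'.1 (h'.2 (0, 1)).1 ?_
    (h'.2 (0, 1)).2
  intro K hKV hK
  exact integrableOn_fiber (L := leftCoord E) (u := fun x => f' x (0, 1, 0))
    (fun z hz hz' => ⟨rfl, hz', hz⟩) (fun K hK hKc => hd K hK hKc _) hKV hK

lemma hasEdgeTrace_fold_bottom {V : Set E} {f₀ f₁ : E × ℝ × ℝ → F} {w : E × ℝ → F}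
    (h : HasEdgeTrace (V ×ˢ Ioo (0 : ℝ) 1) (fun z : (E × ℝ) × ℝ => f₁ (z.1.1, z.1.2, z.2)) w) :
    HasEdgeTrace (V ×ˢ Ioo (0 : ℝ) 1)
      (fun z : (E × ℝ) × ℝ => fold f₀ f₁ (z.1.1, z.1.2, z.2)) w := by
  refine h.congr fun K hKV hK => ?_
  obtain ⟨a, b, ha, -, hab⟩ := exists_Icc_of_isCompact_edge hK hKV
  refine ⟨a, ha, fun q hq t ht => (fold_of_right ?_ ?_).symm⟩
  · have := (hab q hq).1
    simp only; linarith [ht.1, ht.2]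
  · have := (hab q hq).1
    simp only; linarith [ht.2]

lemma hasEdgeTrace_fold_right {V : Set E} {f₀ f₁ : E × ℝ × ℝ → F} {w : E × ℝ → F}
    (h : HasEdgeTrace (V ×ˢ Ioo (0 : ℝ) 1) (fun z : (E × ℝ) × ℝ => f₁ (z.1.1, 1 - z.2, z.1.2)) w) :
    HasEdgeTrace (V ×ˢ Ioo (0 : ℝ) 1)
      (fun z : (E × ℝ) × ℝ => fold f₀ f₁ (z.1.1, 1 - z.2, z.1.2)) w := by
  refine h.congr fun K hKV hK => ?_
  obtain ⟨a, b, ha, hb, hab⟩ := exists_Icc_of_isCompact_edge hK hKV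
  refine ⟨1 - b, by linarith, fun q hq t ht => (fold_of_right ?_ ?_).symm⟩
  · have := hab q hq
    simp only; linarith [ht.1, ht.2]
  · have := (hab q hq).2
    simp only; linarith [ht.2]

/-- Near the left face the fold is `f₀(2 s, t - 2 s)`, a shear of `f₀` which fixes the face. -/
lemma hasEdgeTrace_fold_left {V : Set E} (hV : IsOpen V) {f₀ f₁ : E × ℝ × ℝ → F} {w : E × ℝ → F}
    (hf₀ : LocallyIntegrableOn f₀ (V ×ˢ (Ioo (0 : ℝ) 1 ×ˢ Ioo (0 : ℝ) 1)) volume)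
    (h : HasEdgeTrace (V ×ˢ Ioo (0 : ℝ) 1) (fun z : (E × ℝ) × ℝ => f₀ (z.1.1, z.2, z.1.2)) w) :
    HasEdgeTrace (V ×ˢ Ioo (0 : ℝ) 1)
      (fun z : (E × ℝ) × ℝ => fold f₀ f₁ (z.1.1, z.2, z.1.2)) w := by
  obtain ⟨c, -, hc⟩ := exists_map_volume_eq_smul (leftCoord E)
  have hl : LocallyIntegrableOn (fun z : (E × ℝ) × ℝ => f₀ (z.1.1, z.2, z.1.2))
      ((V ×ˢ Ioo (0 : ℝ) 1) ×ˢ Ioo (0 : ℝ) 1) volume :=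
    (locallyIntegrableOn_comp_linear hc hf₀).mono_set fun z hz => ⟨hz.1.1, hz.2, hz.1.2⟩
  refine (h.comp_shear (hV.prod isOpen_Ioo) hl (0, 1)).congr fun K hKV hK => ?_
  obtain ⟨a, b, ha, -, hab⟩ := exists_Icc_of_isCompact_edge hK hKV
  refine ⟨a / 2, by linarith, fun q hq t ht => ?_⟩
  rw [fold_of_left]
  · simp [shear_apply, foldLeft_apply]
  · have := (hab q hq).1
    simp only; linarith [ht.2]

/-- `locallyIntegrableOn_prod_Ico` for the bottom face. -/
lemma locallyIntegrableOn_bottom {V : Set E} (hV : IsOpen V) {u : E × ℝ × ℝ → F}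
    (hu : LocallyIntegrableOn u (V ×ˢ (Ioo (0 : ℝ) 1 ×ˢ Ioo (0 : ℝ) 1)) volume)
    (h0 : ∀ K ⊆ V ×ˢ Ioo (0 : ℝ) 1, IsCompact K → ∃ δ > 0,
      IntegrableOn (fun z => u (bottomCoord E z)) (K ×ˢ Ioo (0 : ℝ) δ)) :
    LocallyIntegrableOn u (V ×ˢ (Ioo (0 : ℝ) 1 ×ˢ Ico (0 : ℝ) 1)) volume := by
  obtain ⟨c, -, hc⟩ := exists_map_volume_eq_smul (bottomCoord E).symm
  have h1 : LocallyIntegrableOn (fun z => u (bottomCoord E z))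
      ((V ×ˢ Ioo (0 : ℝ) 1) ×ˢ Ioo (0 : ℝ) 1) volume :=
    (locallyIntegrableOn_comp_linear map_bottomCoord hu).mono_set
      fun z hz => ⟨hz.1.1, hz.1.2, hz.2⟩
  have h2 := locallyIntegrableOn_prod_Ico (hV.prod isOpen_Ioo) h1 h0
  have h3 := locallyIntegrableOn_comp_linear hc h2
  simp only [ContinuousLinearEquiv.apply_symm_apply] at h3
  exact h3.mono_set fun x hx => ⟨⟨hx.1, hx.2.1⟩, hx.2.2⟩

/-- If `f₀` and `f₁` have the same trace at the bottom, then the folded function is weakly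
differentiable. -/
theorem hasWeakDerivOn_fold {V : Set E} (hV : IsOpen V) {f₀ f₁ : E × ℝ × ℝ → F}
    {f₀' f₁' : E × ℝ × ℝ → E × ℝ × ℝ →ₗ[ℝ] F}
    (h₀ : HasWeakDerivOn (V ×ˢ (Ioo (0 : ℝ) 1 ×ˢ Ioo (0 : ℝ) 1)) f₀ f₀')
    (h₁ : HasWeakDerivOn (V ×ˢ (Ioo (0 : ℝ) 1 ×ˢ Ioo (0 : ℝ) 1)) f₁ f₁')
    (hd₀ : ∀ K ⊆ V, IsCompact K → ∀ v,
      IntegrableOn (fun x => f₀' x v) (K ×ˢ (Ioo (0 : ℝ) 1 ×ˢ Ioo (0 : ℝ) 1)))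
    (hd₁ : ∀ K ⊆ V, IsCompact K → ∀ v,
      IntegrableOn (fun x => f₁' x v) (K ×ˢ (Ioo (0 : ℝ) 1 ×ˢ Ioo (0 : ℝ) 1)))
    {w : E × ℝ → F}
    (t₀ : HasEdgeTrace (V ×ˢ Ioo (0 : ℝ) 1) (fun z : (E × ℝ) × ℝ => f₀ (z.1.1, z.1.2, z.2)) w)
    (t₁ : HasEdgeTrace (V ×ˢ Ioo (0 : ℝ) 1) (fun z : (E × ℝ) × ℝ => f₁ (z.1.1, z.1.2, z.2)) w) :
    HasWeakDerivOn (V ×ˢ (Ioo (0 : ℝ) 1 ×ˢ Ioo (0 : ℝ) 1)) (fold f₀ f₁)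
      (chartFoldDeriv f₀' f₁') := by
  have hb : ∀ {u : E × ℝ × ℝ → F},
      LocallyIntegrableOn u (V ×ˢ (Ioo (0 : ℝ) 1 ×ˢ Ioo (0 : ℝ) 1)) volume →
      LocallyIntegrableOn (fun z : (E × ℝ) × ℝ => u (z.1.1, z.1.2, z.2))
        ((V ×ˢ Ioo (0 : ℝ) 1) ×ˢ Ioo (0 : ℝ) 1) volume := fun hu =>
    (locallyIntegrableOn_comp_linear map_bottomCoord hu).mono_set
      fun z hz => ⟨hz.1.1, hz.1.2, hz.2⟩
  have hder : ∀ {u : E × ℝ × ℝ → F},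
      LocallyIntegrableOn u (V ×ˢ (Ioo (0 : ℝ) 1 ×ˢ Ioo (0 : ℝ) 1)) volume →
      (∀ K ⊆ V, IsCompact K → IntegrableOn u (K ×ˢ (Ioo (0 : ℝ) 1 ×ˢ Ioo (0 : ℝ) 1))) →
      LocallyIntegrableOn u (V ×ˢ (Ioo (0 : ℝ) 1 ×ˢ Ico (0 : ℝ) 1)) volume := fun hu hud =>
    locallyIntegrableOn_bottom hV hu fun K hKV hK => ⟨1, one_pos,
      integrableOn_fiber (L := bottomCoord E) (fun z hz hz' => ⟨rfl, hz, hz'⟩) hud hKV hK⟩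
  refine hasWeakDerivOn_fold_of_jump hV h₀ h₁
    (locallyIntegrableOn_bottom hV h₀.1 fun K hKV hK => (t₀.integrableOn (hb h₀.1) hK hKV).2)
    (locallyIntegrableOn_bottom hV h₁.1 fun K hKV hK => (t₁.integrableOn (hb h₁.1) hK hKV).2)
    (fun v => hder (h₀.2 v).1 fun K hKV hK => hd₀ K hKV hK v)
    (fun v => hder (h₁.2 v).1 fun K hKV hK => hd₁ K hKV hK v) ?_
  intro K hK hKV
  have hlim := (t₀.2 K hK hKV).add (t₁.2 K hK hKV)
  rw [add_zero] at hlim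
  refine tendsto_of_tendsto_of_tendsto_of_le_of_le' tendsto_const_nhds hlim
    (Eventually.of_forall fun _ => zero_le) ?_
  filter_upwards [nhdsWithin_le_nhds (Iio_mem_nhds one_pos)] with ε hε
  have hε : ε < 1 := hε
  rw [← mul_add]
  refine mul_le_mul' le_rfl ?_
  set T : Set (E × ℝ × ℝ) := {x | (x.1, x.2.1) ∈ K ∧ x.2.2 ∈ Ioo 0 ε} with hT
  have hTm : MeasurableSet T :=
    (hK.measurableSet.preimage (by fun_prop)).inter (measurableSet_Ioo.preimage (by fun_prop))
  have hKm : MeasurableSet (K ×ˢ Ioo (0 : ℝ) ε) := hK.measurableSet.prod measurableSet_Ioo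
  have hsub : K ×ˢ Ioo (0 : ℝ) ε ⊆ (V ×ˢ Ioo (0 : ℝ) 1) ×ˢ Ioo (0 : ℝ) 1 :=
    prod_mono hKV (Ioo_subset_Ioo_right hε.le)
  have m₀ := ((aestronglyMeasurable_sub_edge (hb h₀.1).aestronglyMeasurable t₀.1).mono_set
    hsub).enorm
  have m₁ := ((aestronglyMeasurable_sub_edge (hb h₁.1).aestronglyMeasurable t₁.1).mono_set
    hsub).enorm
  rw [← setLIntegral_prod_volume m₀, ← setLIntegral_prod_volume m₁, ← lintegral_add_left' m₀]
  have e := lintegral_comp_linear (map_bottomCoord (E := E)) (T.indicator fun x => ‖f₀ x - f₁ x‖ₑ)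
  rw [lintegral_indicator hTm, ENNReal.coe_one, one_mul] at e
  rw [← e, ← lintegral_indicator hKm]
  refine lintegral_mono fun z => ?_
  by_cases hz : z ∈ K ×ˢ Ioo (0 : ℝ) ε
  · have hz' : bottomCoord E z ∈ T := ⟨hz.1, hz.2⟩
    rw [indicator_of_mem hz, indicator_of_mem hz', bottomCoord_apply]
    rw [← sub_sub_sub_cancel_right _ _ (w z.1)]
    exact enorm_sub_le
  · have hz' : bottomCoord E z ∉ T := fun h => hz ⟨h.1, h.2⟩
    rw [indicator_of_notMem hz']
    exact zero_le

end ChartTraces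

/-! ### The Riemannian metric in charts -/

section Metric

variable {d : ℕ} {W : Type*} [TopologicalSpace W] [ChartedSpace (EuclideanSpace ℝ (Fin d)) W]
  [IsManifold (𝓡 d) ∞ W]

lemma continuousOn_chartInvDeriv {φ : OpenPartialHomeomorph W (EuclideanSpace ℝ (Fin d))}
    (hφ : φ ∈ IsManifold.maximalAtlas (𝓡 d) ∞ W) (e : EuclideanSpace ℝ (Fin d)) :
    ContinuousOn (fun u => (⟨φ.symm u, chartInvDeriv φ u e⟩ : TangentBundle (𝓡 d) W))
      φ.target := by
  have h := (contMDiffOn_symm_of_mem_maximalAtlas hφ).continuousOn_tangentMapWithin (by simp)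
    φ.open_target.uniqueMDiffOn
  have hc : Continuous (fun u : EuclideanSpace ℝ (Fin d) =>
      (⟨u, e⟩ : TangentBundle (𝓡 d) (EuclideanSpace ℝ (Fin d)))) := by
    have := (tangentBundleModelSpaceHomeomorph (𝓡 d)).symm.continuous.comp
      (Continuous.prodMk_left e)
    exact this
  refine (h.comp hc.continuousOn fun u hu => hu).congr fun u hu => ?_
  simp only [Function.comp, tangentMapWithin, mfderivWithin_of_isOpen φ.open_target hu]
  rfl

lemma chartInvDeriv_injective {φ : OpenPartialHomeomorph W (EuclideanSpace ℝ (Fin d))}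
    (hφ : φ ∈ IsManifold.maximalAtlas (𝓡 d) ∞ W) {u : EuclideanSpace ℝ (Fin d)}
    (hu : u ∈ φ.target) : Function.Injective (chartInvDeriv φ u) := by
  have hd : φ.MDifferentiable (𝓡 d) (𝓡 d) :=
    ⟨(contMDiffOn_of_mem_maximalAtlas hφ).mdifferentiableOn (by simp),
      (contMDiffOn_symm_of_mem_maximalAtlas hφ).mdifferentiableOn (by simp)⟩
  exact (hd.symm.mfderiv_bijective hu).1

variable [Bundle.RiemannianBundle (fun x : W => TangentSpace (𝓡 d) x)]
  [IsContMDiffRiemannianBundle (𝓡 d) ∞ (EuclideanSpace ℝ (Fin d))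
    (fun x : W => TangentSpace (𝓡 d) x)]

lemma continuousOn_inner_chartInvDeriv
    {φ : OpenPartialHomeomorph W (EuclideanSpace ℝ (Fin d))}
    (hφ : φ ∈ IsManifold.maximalAtlas (𝓡 d) ∞ W) (e e' : EuclideanSpace ℝ (Fin d)) :
    ContinuousOn (fun u => inner ℝ (chartInvDeriv φ u e) (chartInvDeriv φ u e'))
      φ.target := by
  have : IsContinuousRiemannianBundle (EuclideanSpace ℝ (Fin d))
      (fun x : W => TangentSpace (𝓡 d) x) := by
    obtain ⟨g, hg, h⟩ := IsContMDiffRiemannianBundle.exists_contMDiff (IB := 𝓡 d) (n := ∞)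
      (F := EuclideanSpace ℝ (Fin d)) (E := fun x : W => TangentSpace (𝓡 d) x)
    exact ⟨g, hg.continuous, h⟩
  exact (continuousOn_chartInvDeriv hφ e).inner_bundle (continuousOn_chartInvDeriv hφ e')

lemma continuousOn_chartDensity
    {φ : OpenPartialHomeomorph W (EuclideanSpace ℝ (Fin d))}
    (hφ : φ ∈ IsManifold.maximalAtlas (𝓡 d) ∞ W) : ContinuousOn (chartDensity φ) φ.target := by
  refine Real.continuous_sqrt.comp_continuousOn ?_
  have : ContinuousOn (fun u => (Matrix.of fun i j : Fin d =>
    inner ℝ (chartInvDeriv φ u (EuclideanSpace.single i 1))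
      (chartInvDeriv φ u (EuclideanSpace.single j 1)) : Matrix (Fin d) (Fin d) ℝ)) φ.target :=
    continuousOn_pi.2 fun i => continuousOn_pi.2 fun j => continuousOn_inner_chartInvDeriv hφ _ _
  exact (continuous_id.matrix_det).comp_continuousOn this

lemma chartDensity_pos
    {φ : OpenPartialHomeomorph W (EuclideanSpace ℝ (Fin d))}
    (hφ : φ ∈ IsManifold.maximalAtlas (𝓡 d) ∞ W) {u : EuclideanSpace ℝ (Fin d)}
    (hu : u ∈ φ.target) : 0 < chartDensity φ u := by
  refine Real.sqrt_pos.2 ?_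
  have hli : LinearIndependent ℝ (fun i : Fin d =>
      chartInvDeriv φ u (EuclideanSpace.single i (1 : ℝ))) := by
    have := (EuclideanSpace.basisFun (Fin d) ℝ).toBasis.linearIndependent.map'
      (chartInvDeriv φ u) (LinearMap.ker_eq_bot.2 (chartInvDeriv_injective hφ hu))
    simpa [Function.comp_def] using this
  exact (Matrix.posDef_gram_of_linearIndependent (𝕜 := ℝ) hli).det_pos

lemma exists_chartDensity_ge
    {φ : OpenPartialHomeomorph W (EuclideanSpace ℝ (Fin d))}
    (hφ : φ ∈ IsManifold.maximalAtlas (𝓡 d) ∞ W) {K : Set (EuclideanSpace ℝ (Fin d))}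
    (hK : IsCompact K) (hKφ : K ⊆ φ.target) : ∃ m > 0, ∀ u ∈ K, m ≤ chartDensity φ u := by
  rcases K.eq_empty_or_nonempty with rfl | hne
  · exact ⟨1, one_pos, fun u hu => hu.elim⟩
  · obtain ⟨u₀, hu₀, hmin⟩ := hK.exists_isMinOn hne ((continuousOn_chartDensity hφ).mono hKφ)
    exact ⟨_, chartDensity_pos hφ (hKφ hu₀), fun u hu => hmin hu⟩

lemma norm_apply_le_derivNorm {F : Type*} [NormedAddCommGroup F] [NormedSpace ℝ F] {x : W}
    (L : (TangentSpace (𝓡 d) x × ℝ × ℝ) →ₗ[ℝ] F) (w : TangentSpace (𝓡 d) x) (r : ℝ × ℝ) :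
    ‖L (w, r)‖ ≤ ((d : ℝ) * ‖w‖ + |r.1| + |r.2|) * derivNorm L := by
  set b := stdOrthonormalBasis ℝ (TangentSpace (𝓡 d) x)
  have hb : ∀ i, ‖L (b i, 0, 0)‖ ≤ derivNorm L := fun i => by
    refine Real.le_sqrt_of_sq_le ?_
    have := Finset.single_le_sum (f := fun i => ‖L (b i, 0, 0)‖ ^ 2) (fun i _ => sq_nonneg _)
      (Finset.mem_univ i)
    have h1 := sq_nonneg ‖L (0, 1, 0)‖
    have h2 := sq_nonneg ‖L (0, 0, 1)‖
    linarith
  have hs : (0 : ℝ) ≤ ∑ i, ‖L (b i, 0, 0)‖ ^ 2 := Finset.sum_nonneg fun i _ => sq_nonneg _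
  have h1 : ‖L (0, 1, 0)‖ ≤ derivNorm L := by
    refine Real.le_sqrt_of_sq_le ?_
    have h2 := sq_nonneg ‖L (0, 0, 1)‖
    linarith
  have h2 : ‖L (0, 0, 1)‖ ≤ derivNorm L := by
    refine Real.le_sqrt_of_sq_le ?_
    have h2 := sq_nonneg ‖L (0, 1, 0)‖
    linarith
  have hw : (w, r) = (∑ i, inner ℝ (b i) w • ((b i, 0, 0) : TangentSpace (𝓡 d) x × ℝ × ℝ))
      + r.1 • ((0, 1, 0) : TangentSpace (𝓡 d) x × ℝ × ℝ)
      + r.2 • ((0, 0, 1) : TangentSpace (𝓡 d) x × ℝ × ℝ) := by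
    have h := b.sum_repr' w
    ext
    · simp [Prod.fst_sum, h]
    · simp [Prod.snd_sum]
    · simp [Prod.snd_sum]
  rw [hw, map_add, map_add, map_sum, map_smul, map_smul, add_mul, add_mul]
  refine (norm_add₃_le).trans (add_le_add (add_le_add ?_ ?_) ?_)
  · refine (norm_sum_le _ _).trans ((Finset.sum_le_sum fun i _ => ?_ :
      _ ≤ ∑ i : Fin (Module.finrank ℝ (TangentSpace (𝓡 d) x)), ‖w‖ * derivNorm L).trans ?_)
    · rw [map_smul, norm_smul]
      refine mul_le_mul ?_ (hb i) (norm_nonneg _) (norm_nonneg _)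
      simpa using norm_inner_le_norm (𝕜 := ℝ) (b i) w
    · have : Module.finrank ℝ (TangentSpace (𝓡 d) x) = d := finrank_euclideanSpace_fin
      simp [this, mul_assoc]
  · rw [norm_smul]; exact mul_le_mul_of_nonneg_left h1 (norm_nonneg _)
  · rw [norm_smul]; exact mul_le_mul_of_nonneg_left h2 (norm_nonneg _)

/-- Over compact subsets of a chart, coordinate components are bounded by the Riemannian norm. -/
lemma exists_norm_chart_le_derivNorm {F : Type*} [NormedAddCommGroup F] [NormedSpace ℝ F]
    {φ : OpenPartialHomeomorph W (EuclideanSpace ℝ (Fin d))}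
    (hφ : φ ∈ IsManifold.maximalAtlas (𝓡 d) ∞ W) {K : Set (EuclideanSpace ℝ (Fin d))}
    (hK : IsCompact K) (hKφ : K ⊆ φ.target) (v : EuclideanSpace ℝ (Fin d) × ℝ × ℝ) :
    ∃ C : ℝ≥0, ∀ u ∈ K, ∀ L : (TangentSpace (𝓡 d) (φ.symm u) × ℝ × ℝ) →ₗ[ℝ] F,
      ‖L (chartInvDeriv φ u v.1, v.2)‖ ≤ C * derivNorm L := by
  have hc : ContinuousOn (fun u => (d : ℝ) * ‖chartInvDeriv φ u v.1‖ + |v.2.1| + |v.2.2|) K := by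
    have : ContinuousOn (fun u => ‖chartInvDeriv φ u v.1‖) K := by
      refine (Real.continuous_sqrt.comp_continuousOn
        ((continuousOn_inner_chartInvDeriv hφ v.1 v.1).mono hKφ)).congr fun u _ => ?_
      simp only [Function.comp, real_inner_self_eq_norm_sq]
      exact (Real.sqrt_sq (norm_nonneg _)).symm
    fun_prop
  obtain ⟨C, hC⟩ := (hK.image_of_continuousOn hc).bddAbove
  refine ⟨C.toNNReal, fun u hu L => (norm_apply_le_derivNorm L _ _).trans
    (mul_le_mul_of_nonneg_right ?_ (Real.sqrt_nonneg _))⟩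
  exact (hC (mem_image_of_mem _ hu)).trans (Real.le_coe_toNNReal C)

end Metric

/-- The squared columns of either map of the plane give at most `9 (|P|² + |Q|²)`, for the two
vertical derivatives `P` and `Q`. -/
lemma derivNorm_comp_le {d : ℕ} {W : Type*} [TopologicalSpace W]
    [ChartedSpace (EuclideanSpace ℝ (Fin d)) W]
    [Bundle.RiemannianBundle (fun x : W => TangentSpace (𝓡 d) x)]
    {F : Type*} [NormedAddCommGroup F] [NormedSpace ℝ F] {x : W}
    (L : (TangentSpace (𝓡 d) x × ℝ × ℝ) →ₗ[ℝ] F) {M : (ℝ × ℝ) →ₗ[ℝ] (ℝ × ℝ)}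
    (hM : M = foldLeft.toLinearMap ∨ M = foldMiddle.toLinearMap) :
    derivNorm (L ∘ₗ LinearMap.prodMap LinearMap.id M) ≤ 3 * derivNorm L := by
  have h3 : (3 : ℝ) = √9 := by rw [show (9 : ℝ) = 3 ^ 2 by norm_num]; simp
  rw [derivNorm, derivNorm, h3, ← Real.sqrt_mul (by norm_num)]
  refine Real.sqrt_le_sqrt ?_
  set P := L (0, 1, 0) with hP
  set Q := L (0, 0, 1) with hQ
  have key : ∀ a b : ℝ, L (0, a, b) = a • P + b • Q := fun a b => by
    rw [hP, hQ, ← map_smul, ← map_smul, ← map_add]; simp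
  have hS : (0 : ℝ) ≤ ∑ i, ‖L (stdOrthonormalBasis ℝ (TangentSpace (𝓡 d) x) i, 0, 0)‖ ^ 2 :=
    Finset.sum_nonneg fun i _ => sq_nonneg _
  have h0 : M (0, 0) = (0, 0) := map_zero M
  simp only [LinearMap.comp_apply, LinearMap.prodMap_apply, LinearMap.id_apply, h0]
  have tri : ∀ X Y : F, ‖X + Y‖ ^ 2 ≤ 2 * ‖X‖ ^ 2 + 2 * ‖Y‖ ^ 2 := fun X Y => by
    have := norm_add_le X Y
    nlinarith [sq_nonneg (‖X‖ - ‖Y‖), norm_nonneg (X + Y)]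
  have n2 : ∀ X : F, ‖(2 : ℝ) • X‖ ^ 2 = 4 * ‖X‖ ^ 2 := fun X => by
    rw [norm_smul, mul_pow]; norm_num
  have n2' : ∀ X : F, ‖(-2 : ℝ) • X‖ ^ 2 = 4 * ‖X‖ ^ 2 := fun X => by
    rw [norm_smul, mul_pow]; norm_num
  rcases hM with rfl | rfl
  · have e1 : L (0, foldLeft.toLinearMap ((1, 0) : ℝ × ℝ)) = (2 : ℝ) • P + (-2 : ℝ) • Q := by
      rw [← key]; congr 2; simp [foldLeft_apply]
    have e2 : L (0, foldLeft.toLinearMap ((0, 1) : ℝ × ℝ)) = Q := by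
      rw [hQ]; congr 2; simp [foldLeft_apply]
    rw [e1, e2]
    have h1 := tri ((2 : ℝ) • P) ((-2 : ℝ) • Q)
    rw [n2, n2'] at h1
    nlinarith [sq_nonneg ‖P‖, sq_nonneg ‖Q‖]
  · have e1 : L (0, foldMiddle.toLinearMap ((1, 0) : ℝ × ℝ)) = (2 : ℝ) • Q := by
      rw [← zero_add ((2 : ℝ) • Q), ← zero_smul ℝ P, ← key]; congr 2; simp [foldMiddle_apply]
    have e2 : L (0, foldMiddle.toLinearMap ((0, 1) : ℝ × ℝ)) = P + (-1 : ℝ) • Q := by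
      rw [← one_smul ℝ P, ← key]; congr 2; simp [foldMiddle_apply]
    rw [e1, e2]
    have h1 := tri P ((-1 : ℝ) • Q)
    have h2 : ‖(-1 : ℝ) • Q‖ ^ 2 = ‖Q‖ ^ 2 := by simp
    rw [n2]
    nlinarith [sq_nonneg ‖P‖, sq_nonneg ‖Q‖]

/-! ### The Riemannian measure -/

section RiemannianMeasure

variable {d : ℕ} {W : Type*} [TopologicalSpace W] [ChartedSpace (EuclideanSpace ℝ (Fin d)) W]

/-- The change of variables formula for a map which is a measurable embedding on a set carrying the
measure, without any measurability assumption on the integrand: derivatives are not assumed to be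
measurable on the manifold. -/
lemma lintegral_map_of_injOn {X Y : Type*} [MeasurableSpace X] [MeasurableSpace Y]
    {ν : Measure X} {S : Set X} (hS : MeasurableSet S) (hν : ν.restrict S = ν) {f : X → Y}
    (hf : MeasurableEmbedding (S.domRestrict f)) (G : Y → ℝ≥0∞) :
    ∫⁻ y, G y ∂(ν.map f) = ∫⁻ x, G (f x) ∂ν := by
  have e : (ν.comap ((↑) : S → X)).map ((↑) : S → X) = ν := by
    rw [map_comap_subtype_coe hS, hν]
  have hfν : AEMeasurable f ν := by
    rw [← e, (MeasurableEmbedding.subtype_coe hS).aemeasurable_map_iff]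
    exact hf.measurable.aemeasurable
  have h1 : ν.map f = (ν.comap ((↑) : S → X)).map (S.domRestrict f) := by
    conv_lhs => rw [← e]
    rw [AEMeasurable.map_map_of_aemeasurable (by rwa [e]) measurable_subtype_coe.aemeasurable]
    rfl
  conv_rhs => rw [← e]
  rw [h1, hf.lintegral_map, (MeasurableEmbedding.subtype_coe hS).lintegral_map]
  rfl

variable [T2Space W] [SecondCountableTopology W] [IsManifold (𝓡 d) ∞ W]
  [Bundle.RiemannianBundle (fun x : W => TangentSpace (𝓡 d) x)]
  [IsContMDiffRiemannianBundle (𝓡 d) ∞ (EuclideanSpace ℝ (Fin d))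
    (fun x : W => TangentSpace (𝓡 d) x)]
  [MeasurableSpace W] [BorelSpace W]

lemma measurableEmbedding_prodInv (φ : OpenPartialHomeomorph W (EuclideanSpace ℝ (Fin d))) :
    MeasurableEmbedding ((φ.target ×ˢ (univ : Set (ℝ × ℝ))).domRestrict (prodInv φ)) :=
  (φ.symm.prod (OpenPartialHomeomorph.refl (ℝ × ℝ))).isOpenEmbedding_restrict.measurableEmbedding

lemma aemeasurable_prodInv (φ : OpenPartialHomeomorph W (EuclideanSpace ℝ (Fin d))) :
    AEMeasurable (prodInv φ) (volume.restrict (φ.target ×ˢ (univ : Set (ℝ × ℝ)))) :=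
  ContinuousOn.aemeasurable
    (φ.symm.prod (OpenPartialHomeomorph.refl (ℝ × ℝ))).continuousOn
    (φ.open_target.prod isOpen_univ).measurableSet

lemma aemeasurable_chartDensity {φ : OpenPartialHomeomorph W (EuclideanSpace ℝ (Fin d))}
    (hφ : φ ∈ IsManifold.maximalAtlas (𝓡 d) ∞ W) :
    AEMeasurable (fun u : EuclideanSpace ℝ (Fin d) × ℝ × ℝ => ENNReal.ofReal (chartDensity φ u.1))
      (volume.restrict (φ.target ×ˢ (univ : Set (ℝ × ℝ)))) := by
  refine ENNReal.measurable_ofReal.comp_aemeasurable (ContinuousOn.aemeasurable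
    ((continuousOn_chartDensity hφ).comp continuousOn_fst fun u hu => hu.1)
    (φ.open_target.prod isOpen_univ).measurableSet)

/-- An integral in a chart against the Riemannian density is at most the integral against the
Riemannian measure. -/
lemma lintegral_prodInv_le {φ : OpenPartialHomeomorph W (EuclideanSpace ℝ (Fin d))}
    (hφ : φ ∈ IsManifold.maximalAtlas (𝓡 d) ∞ W) {A : Set (ℝ × ℝ)} (hA : MeasurableSet A)
    (G : W × ℝ × ℝ → ℝ≥0∞) :
    ∫⁻ u in φ.target ×ˢ A, ENNReal.ofReal (chartDensity φ u.1) * G (prodInv φ u)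
      ≤ ∫⁻ z in univ ×ˢ A, G z ∂(riemannianMeasure d W) := by
  have hS : MeasurableSet (φ.target ×ˢ (univ : Set (ℝ × ℝ))) :=
    (φ.open_target.prod isOpen_univ).measurableSet
  set G' : W × ℝ × ℝ → ℝ≥0∞ := (univ ×ˢ A : Set (W × ℝ × ℝ)).indicator G with hG'
  calc ∫⁻ u in φ.target ×ˢ A, ENNReal.ofReal (chartDensity φ u.1) * G (prodInv φ u)
      = ∫⁻ u in φ.target ×ˢ A, ENNReal.ofReal (chartDensity φ u.1) * G' (prodInv φ u) := by
        refine setLIntegral_congr_fun (φ.open_target.measurableSet.prod hA) fun u hu => ?_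
        have : prodInv φ u ∈ (univ ×ˢ A : Set (W × ℝ × ℝ)) := ⟨trivial, hu.2⟩
        simp only [hG', indicator_of_mem this]
    _ ≤ ∫⁻ u in φ.target ×ˢ univ, ENNReal.ofReal (chartDensity φ u.1) * G' (prodInv φ u) :=
        lintegral_mono_set (prod_mono_right (subset_univ A))
    _ = ∫⁻ z, G' z ∂(chartMeasure φ) := by
        rw [chartMeasure, lintegral_map_of_injOn hS _ (measurableEmbedding_prodInv φ),
          lintegral_withDensity_eq_lintegral_mul_non_measurable₀ _ (aemeasurable_chartDensity hφ)
            (ae_of_all _ fun u => ENNReal.ofReal_lt_top)]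
        · rfl
        · rw [restrict_withDensity hS, Measure.restrict_restrict hS, inter_self]
    _ ≤ ∫⁻ z, G' z ∂(riemannianMeasure d W) :=
        lintegral_mono' (le_iSup₂ (f := fun φ (_ : φ ∈ IsManifold.maximalAtlas (𝓡 d) ∞ W) =>
          chartMeasure φ) φ hφ) le_rfl
    _ = ∫⁻ z in univ ×ˢ A, G z ∂(riemannianMeasure d W) :=
        lintegral_indicator (MeasurableSet.univ.prod hA) _

/-- A weak derivative of finite energy is integrable, in charts, up to the faces. -/
lemma integrableOn_chart_of_derivEnergy_lt_top {F : Type*} [NormedAddCommGroup F]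
    [NormedSpace ℝ F] {p : ℝ} (hp : 1 ≤ p) {U : W × ℝ × ℝ → F}
    {D : (z : W × ℝ × ℝ) → (TangentSpace (𝓡 d) z.1 × ℝ × ℝ) →ₗ[ℝ] F} (hD : IsWeakDeriv U D)
    (hE : derivEnergy p D < ⊤) {φ : OpenPartialHomeomorph W (EuclideanSpace ℝ (Fin d))}
    (hφ : φ ∈ IsManifold.maximalAtlas (𝓡 d) ∞ W) {K : Set (EuclideanSpace ℝ (Fin d))}
    (hKφ : K ⊆ φ.target) (hK : IsCompact K) (v : EuclideanSpace ℝ (Fin d) × ℝ × ℝ) :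
    IntegrableOn (fun u => (D (prodInv φ u) ∘ₗ
      LinearMap.prodMap (chartInvDeriv φ u.1) LinearMap.id) v)
      (K ×ˢ (Ioo (0 : ℝ) 1 ×ˢ Ioo (0 : ℝ) 1)) := by
  obtain ⟨m, hm, hmK⟩ := exists_chartDensity_ge hφ hK hKφ
  obtain ⟨C, hC⟩ := exists_norm_chart_le_derivNorm (F := F) hφ hK hKφ v
  have hI : MeasurableSet (Ioo (0 : ℝ) 1 ×ˢ Ioo (0 : ℝ) 1) :=
    measurableSet_Ioo.prod measurableSet_Ioo
  have hKI : MeasurableSet (K ×ˢ (Ioo (0 : ℝ) 1 ×ˢ Ioo (0 : ℝ) 1)) := hK.measurableSet.prod hI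
  refine ⟨((hD φ hφ).2 v).1.aestronglyMeasurable.mono_set (prod_mono_left hKφ), ?_⟩
  set n : EuclideanSpace ℝ (Fin d) × ℝ × ℝ → ℝ := fun u => derivNorm (D (prodInv φ u)) with hn
  -- from `n ≤ 1 + n ^ p`, which uses `1 ≤ p`, and the lower bound `m` for the density
  have hbound : ∀ u ∈ K ×ˢ (Ioo (0 : ℝ) 1 ×ˢ Ioo (0 : ℝ) 1),
      ‖(D (prodInv φ u) ∘ₗ LinearMap.prodMap (chartInvDeriv φ u.1) LinearMap.id) v‖ₑ
      ≤ C * (1 + ENNReal.ofReal m⁻¹ *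
        (ENNReal.ofReal (chartDensity φ u.1) * ENNReal.ofReal (n u ^ p))) := fun u hu => by
    have hnu : 0 ≤ n u := Real.sqrt_nonneg _
    have h1 : n u ≤ 1 + n u ^ p := by
      rcases le_total (n u) 1 with h | h
      · linarith [Real.rpow_nonneg hnu p]
      · linarith [Real.self_le_rpow_of_one_le h hp]
    have h2 : n u ^ p ≤ m⁻¹ * (chartDensity φ u.1 * n u ^ p) := by
      rw [← mul_assoc]
      refine le_mul_of_one_le_left (Real.rpow_nonneg hnu p) ?_
      rw [← div_eq_inv_mul, one_le_div hm]
      exact hmK u.1 hu.1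
    have h3 : (0 : ℝ) ≤ chartDensity φ u.1 := Real.sqrt_nonneg _
    rw [← ENNReal.ofReal_mul h3, ← ENNReal.ofReal_mul (inv_nonneg.2 hm.le), ← ENNReal.ofReal_one,
      ← ENNReal.ofReal_add zero_le_one (mul_nonneg (inv_nonneg.2 hm.le) (mul_nonneg h3
        (Real.rpow_nonneg hnu p))), ← ENNReal.ofReal_coe_nnreal, ← ENNReal.ofReal_mul C.coe_nonneg,
      ← ofReal_norm]
    exact ENNReal.ofReal_le_ofReal ((hC u.1 hu.1 _).trans
      (mul_le_mul_of_nonneg_left (h1.trans (by gcongr)) C.coe_nonneg))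
  have hfin : ∫⁻ u in K ×ˢ (Ioo (0 : ℝ) 1 ×ˢ Ioo (0 : ℝ) 1),
      ENNReal.ofReal (chartDensity φ u.1) * ENNReal.ofReal (n u ^ p) < ⊤ :=
    ((lintegral_mono_set (prod_mono_left hKφ)).trans
      (lintegral_prodInv_le hφ hI fun z => ENNReal.ofReal (derivNorm (D z) ^ p))).trans_lt hE
  have hvol : volume (K ×ˢ (Ioo (0 : ℝ) 1 ×ˢ Ioo (0 : ℝ) 1)) < ⊤ :=
    (hK.prod (isCompact_Icc.prod isCompact_Icc)).measure_lt_top.trans_le' (measure_mono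
      (prod_mono_right (prod_mono Ioo_subset_Icc_self Ioo_subset_Icc_self)))
  refine (setLIntegral_mono' hKI hbound).trans_lt ?_
  rw [lintegral_const_mul' _ _ ENNReal.coe_ne_top, lintegral_add_left measurable_const,
    lintegral_const_mul' _ _ ENNReal.ofReal_ne_top]
  refine ENNReal.mul_lt_top ENNReal.coe_lt_top (ENNReal.add_lt_top.2 ⟨?_, ENNReal.mul_lt_top
    ENNReal.ofReal_lt_top hfin⟩)
  simpa using hvol

end RiemannianMeasure

section LinearChange

variable {d : ℕ} {W : Type*} [TopologicalSpace W] [ChartedSpace (EuclideanSpace ℝ (Fin d)) W]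
  [T2Space W] [SecondCountableTopology W] [IsManifold (𝓡 d) ∞ W]
  [Bundle.RiemannianBundle (fun x : W => TangentSpace (𝓡 d) x)]
  [IsContMDiffRiemannianBundle (𝓡 d) ∞ (EuclideanSpace ℝ (Fin d))
    (fun x : W => TangentSpace (𝓡 d) x)]
  [MeasurableSpace W] [BorelSpace W]

/-- The map `id × M` on `α × ℝ × ℝ`. -/
def shiftEquiv (α : Type*) [MeasurableSpace α] (M : (ℝ × ℝ) ≃L[ℝ] (ℝ × ℝ)) :
    (α × ℝ × ℝ) ≃ᵐ (α × ℝ × ℝ) :=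
  (MeasurableEquiv.refl α).prodCongr M.toHomeomorph.toMeasurableEquiv

lemma shiftEquiv_apply {α : Type*} [MeasurableSpace α] (M : (ℝ × ℝ) ≃L[ℝ] (ℝ × ℝ))
    (z : α × ℝ × ℝ) : shiftEquiv α M z = (z.1, M z.2) := rfl

lemma map_shiftEquiv_chartMeasure (φ : OpenPartialHomeomorph W (EuclideanSpace ℝ (Fin d)))
    {M : (ℝ × ℝ) ≃L[ℝ] (ℝ × ℝ)} {c : ℝ≥0} (hM : Measure.map M volume = c • volume) :
    (chartMeasure φ).map (shiftEquiv W M) = c • chartMeasure φ := by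
  set e := shiftEquiv (EuclideanSpace ℝ (Fin d)) M
  set S : Set (EuclideanSpace ℝ (Fin d) × ℝ × ℝ) := φ.target ×ˢ univ with hSdef
  have hS : MeasurableSet S := (φ.open_target.prod isOpen_univ).measurableSet
  have hvol : (volume : Measure (EuclideanSpace ℝ (Fin d) × ℝ × ℝ)).map e = c • volume := by
    have h := Measure.map_prod_map (volume : Measure (EuclideanSpace ℝ (Fin d)))
      (volume : Measure (ℝ × ℝ)) measurable_id M.continuous.measurable
    rw [Measure.map_id, hM, Measure.prod_smul_right] at h
    exact h.symm
  have hSe : e ⁻¹' S = S := by ext u; simp [hSdef, e, shiftEquiv_apply]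
  have hres : (volume.restrict S).map e = c • volume.restrict S := by
    conv_lhs => rw [← hSe]
    rw [← e.measurableEmbedding.restrict_map, hvol, Measure.restrict_smul]
  set ν := (volume.restrict S).withDensity fun u => ENNReal.ofReal (chartDensity φ u.1) with hν
  have hmap : ν.map e = c • ν := by
    ext B hB
    rw [e.map_apply, hν, withDensity_apply _ (e.measurable hB), Measure.smul_apply,
      withDensity_apply _ hB, ← lintegral_smul_measure, ← Measure.restrict_smul, ← hres,
      e.measurableEmbedding.restrict_map, e.measurableEmbedding.lintegral_map]
    rfl
  have hm : AEMeasurable (prodInv φ) ν :=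
    (aemeasurable_prodInv φ).mono_ac (withDensity_absolutelyContinuous _ _)
  have hm' : AEMeasurable (prodInv φ) (ν.map e) := by
    rw [hmap]; exact hm.smul_measure c
  calc (ν.map (prodInv φ)).map (shiftEquiv W M)
      = ν.map (prodInv φ ∘ e) := by
        rw [AEMeasurable.map_map_of_aemeasurable (shiftEquiv W M).measurable.aemeasurable hm]
        rfl
    _ = (ν.map e).map (prodInv φ) :=
        (AEMeasurable.map_map_of_aemeasurable hm' e.measurable.aemeasurable).symm
    _ = c • ν.map (prodInv φ) := by rw [hmap, Measure.map_smul]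

/-- By definition of a supremum of measures, it is enough to bound the image of each chart measure
under the inverse map. -/
lemma map_shiftEquiv_riemannianMeasure_le
    {M : (ℝ × ℝ) ≃L[ℝ] (ℝ × ℝ)} {c : ℝ≥0} (hM : Measure.map M volume = c • volume) :
    (riemannianMeasure d W).map (shiftEquiv W M) ≤ c • riemannianMeasure d W := by
  have key : riemannianMeasure d W
      ≤ (c • riemannianMeasure d W).map (shiftEquiv W M).symm := by
    refine iSup₂_le fun φ hφ => ?_
    have h : chartMeasure φ = (c • chartMeasure φ).map (shiftEquiv W M).symm := by
      rw [← map_shiftEquiv_chartMeasure φ hM, MeasurableEquiv.map_symm_map]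
    rw [h]
    refine Measure.map_mono ?_ (shiftEquiv W M).symm.measurable
    gcongr
    exact le_iSup₂ (f := fun φ (_ : φ ∈ IsManifold.maximalAtlas (𝓡 d) ∞ W) =>
      chartMeasure φ) φ hφ
  calc _ ≤ ((c • riemannianMeasure d W).map (shiftEquiv W M).symm).map (shiftEquiv W M) :=
        Measure.map_mono key (shiftEquiv W M).measurable
    _ = _ := MeasurableEquiv.map_map_symm _

lemma setLIntegral_comp_shiftEquiv_le
    {M : (ℝ × ℝ) ≃L[ℝ] (ℝ × ℝ)} {c : ℝ≥0} (hM : Measure.map M volume = c • volume)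
    {A B : Set (W × ℝ × ℝ)} (hA : MeasurableSet A) (hB : MeasurableSet B)
    (hAB : ∀ z ∈ A, (z.1, M z.2) ∈ B) (G : W × ℝ × ℝ → ℝ≥0∞) :
    ∫⁻ z in A, G (z.1, M z.2) ∂(riemannianMeasure d W)
      ≤ c * ∫⁻ z in B, G z ∂(riemannianMeasure d W) := by
  calc ∫⁻ z in A, G (z.1, M z.2) ∂(riemannianMeasure d W)
      = ∫⁻ z in A, B.indicator G (shiftEquiv W M z) ∂(riemannianMeasure d W) :=
        setLIntegral_congr_fun hA fun z hz => (indicator_of_mem (hAB z hz) G).symm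
    _ ≤ ∫⁻ z, B.indicator G (shiftEquiv W M z) ∂(riemannianMeasure d W) :=
        setLIntegral_le_lintegral _ _
    _ = ∫⁻ z, B.indicator G z ∂((riemannianMeasure d W).map (shiftEquiv W M)) :=
        (lintegral_map_equiv _ _).symm
    _ ≤ ∫⁻ z, B.indicator G z ∂(c • riemannianMeasure d W) :=
        lintegral_mono' (map_shiftEquiv_riemannianMeasure_le hM) le_rfl
    _ = c * ∫⁻ z in B, G z ∂(riemannianMeasure d W) := by
        rw [lintegral_smul_measure, lintegral_indicator hB]; rfl

end LinearChange

/-! ### Folding on the manifold -/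

section FoldDeriv

variable {d : ℕ} {W : Type*} [TopologicalSpace W] [ChartedSpace (EuclideanSpace ℝ (Fin d)) W]
  {F : Type*} [NormedAddCommGroup F] [NormedSpace ℝ F]

/-- The weak derivative of the folded map, given those of the two maps. The value on the null set
`{s = t / 2}`, where the formula would leave the domain, is set to `0`. -/
def foldDeriv (D₀ D₁ : (z : W × ℝ × ℝ) → (TangentSpace (𝓡 d) z.1 × ℝ × ℝ) →ₗ[ℝ] F)
    (z : W × ℝ × ℝ) : (TangentSpace (𝓡 d) z.1 × ℝ × ℝ) →ₗ[ℝ] F :=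
  if z.2.1 < z.2.2 / 2 then
    D₀ (z.1, foldLeft z.2) ∘ₗ LinearMap.prodMap LinearMap.id foldLeft.toLinearMap
  else if z.2.1 = z.2.2 / 2 then 0
  else if z.2.1 ≤ z.2.2 then
    D₁ (z.1, foldMiddle z.2) ∘ₗ LinearMap.prodMap LinearMap.id foldMiddle.toLinearMap
  else D₁ z

/-- The local representative of a derivative `D` in the chart `φ × id`. -/
def chartDeriv (φ : OpenPartialHomeomorph W (EuclideanSpace ℝ (Fin d)))
    (D : (z : W × ℝ × ℝ) → (TangentSpace (𝓡 d) z.1 × ℝ × ℝ) →ₗ[ℝ] F)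
    (u : EuclideanSpace ℝ (Fin d) × ℝ × ℝ) : EuclideanSpace ℝ (Fin d) × ℝ × ℝ →ₗ[ℝ] F :=
  D (prodInv φ u) ∘ₗ LinearMap.prodMap (chartInvDeriv φ u.1) LinearMap.id

lemma chartDeriv_foldDeriv (φ : OpenPartialHomeomorph W (EuclideanSpace ℝ (Fin d)))
    (D₀ D₁ : (z : W × ℝ × ℝ) → (TangentSpace (𝓡 d) z.1 × ℝ × ℝ) →ₗ[ℝ] F) :
    chartDeriv φ (foldDeriv D₀ D₁) = chartFoldDeriv (chartDeriv φ D₀) (chartDeriv φ D₁) := by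
  funext u
  unfold chartDeriv foldDeriv chartFoldDeriv
  refine LinearMap.ext fun v => ?_
  by_cases h1 : u.2.1 < u.2.2 / 2
  · have h1' : (prodInv φ u).2.1 < (prodInv φ u).2.2 / 2 := h1
    rw [if_pos h1, if_pos h1']
    rfl
  · have h1' : ¬ (prodInv φ u).2.1 < (prodInv φ u).2.2 / 2 := h1
    rw [if_neg h1, if_neg h1']
    by_cases h2 : u.2.1 = u.2.2 / 2
    · have h2' : (prodInv φ u).2.1 = (prodInv φ u).2.2 / 2 := h2
      rw [if_pos h2, if_pos h2']
      rfl
    · have h2' : ¬ (prodInv φ u).2.1 = (prodInv φ u).2.2 / 2 := h2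
      rw [if_neg h2, if_neg h2']
      by_cases h3 : u.2.1 ≤ u.2.2
      · have h3' : (prodInv φ u).2.1 ≤ (prodInv φ u).2.2 := h3
        rw [if_pos h3, if_pos h3']
        rfl
      · have h3' : ¬ (prodInv φ u).2.1 ≤ (prodInv φ u).2.2 := h3
        rw [if_neg h3, if_neg h3']

variable [T2Space W] [SecondCountableTopology W] [IsManifold (𝓡 d) ∞ W]
  [Bundle.RiemannianBundle (fun x : W => TangentSpace (𝓡 d) x)]
  [IsContMDiffRiemannianBundle (𝓡 d) ∞ (EuclideanSpace ℝ (Fin d))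
    (fun x : W => TangentSpace (𝓡 d) x)]
  [MeasurableSpace W] [BorelSpace W]

/-- The constant of the energy estimate depends neither on the manifold nor on its dimension,
since folding is a linear change of variables in the last two coordinates only. -/
lemma exists_derivEnergy_foldDeriv_le (p : ℝ) (hp : 1 ≤ p) : ∃ C : ℝ≥0, 0 < C ∧
    ∀ (d : ℕ) (W : Type*) [TopologicalSpace W] [T2Space W] [SecondCountableTopology W]
      [ChartedSpace (EuclideanSpace ℝ (Fin d)) W] [IsManifold (𝓡 d) ∞ W]
      [Bundle.RiemannianBundle (fun x : W => TangentSpace (𝓡 d) x)]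
      [IsContMDiffRiemannianBundle (𝓡 d) ∞ (EuclideanSpace ℝ (Fin d))
        (fun x : W => TangentSpace (𝓡 d) x)]
      [MeasurableSpace W] [BorelSpace W] (F : Type*) [NormedAddCommGroup F] [NormedSpace ℝ F]
      (D₀ D₁ : (z : W × ℝ × ℝ) → (TangentSpace (𝓡 d) z.1 × ℝ × ℝ) →ₗ[ℝ] F),
      derivEnergy p (foldDeriv D₀ D₁) ≤ C * (derivEnergy p D₀ + derivEnergy p D₁) := by
  obtain ⟨a, -, ha⟩ := exists_map_volume_eq_smul foldLeft
  obtain ⟨b, -, hb⟩ := exists_map_volume_eq_smul foldMiddle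
  have hp0 : 0 ≤ p := zero_le_one.trans hp
  set c : ℝ≥0 := Real.toNNReal (3 ^ p) with hc
  refine ⟨c * a + c * b + 1, by positivity, ?_⟩
  intro d W _ _ _ _ _ _ _ _ _ F _ _ D₀ D₁
  have hcomp : ∀ {x : W} (L : (TangentSpace (𝓡 d) x × ℝ × ℝ) →ₗ[ℝ] F)
      {M : (ℝ × ℝ) →ₗ[ℝ] (ℝ × ℝ)},
      M = foldLeft.toLinearMap ∨ M = foldMiddle.toLinearMap →
      ENNReal.ofReal (derivNorm (L ∘ₗ LinearMap.prodMap LinearMap.id M) ^ p)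
        ≤ c * ENNReal.ofReal (derivNorm L ^ p) := fun {x} L {M} hM => by
    rw [hc, ← ENNReal.ofReal, ← ENNReal.ofReal_mul (by positivity),
      ← Real.mul_rpow (by norm_num) (show 0 ≤ derivNorm L from Real.sqrt_nonneg _)]
    exact ENNReal.ofReal_le_ofReal
      (Real.rpow_le_rpow (Real.sqrt_nonneg _) (derivNorm_comp_le L hM) hp0)
  have hstrip : MeasurableSet (strip W) :=
    MeasurableSet.univ.prod (measurableSet_Ioo.prod measurableSet_Ioo)
  have ms : Measurable fun z : W × ℝ × ℝ => z.2.1 := measurable_fst.comp measurable_snd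
  have mt : Measurable fun z : W × ℝ × ℝ => z.2.2 := measurable_snd.comp measurable_snd
  set A : Set (W × ℝ × ℝ) := strip W ∩ {z | z.2.1 < z.2.2 / 2}
  set A' : Set (W × ℝ × ℝ) := strip W ∩ {z | z.2.1 = z.2.2 / 2}
  set B : Set (W × ℝ × ℝ) := strip W ∩ ({z | z.2.2 / 2 < z.2.1} ∩ {z | z.2.1 ≤ z.2.2})
  set C : Set (W × ℝ × ℝ) := strip W ∩ {z | z.2.2 < z.2.1}
  have mA : MeasurableSet A := hstrip.inter (measurableSet_lt ms (mt.div_const 2))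
  have mA' : MeasurableSet A' := hstrip.inter (measurableSet_eq_fun ms (mt.div_const 2))
  have mB : MeasurableSet B :=
    hstrip.inter ((measurableSet_lt (mt.div_const 2) ms).inter (measurableSet_le ms mt))
  have mC : MeasurableSet C := hstrip.inter (measurableSet_lt mt ms)
  have cover : strip W ⊆ ((A ∪ A') ∪ B) ∪ C := fun z hz => by
    rcases lt_trichotomy z.2.1 (z.2.2 / 2) with h | h | h
    · exact Or.inl (Or.inl (Or.inl ⟨hz, h⟩))
    · exact Or.inl (Or.inl (Or.inr ⟨hz, h⟩))
    · rcases le_or_gt z.2.1 z.2.2 with h' | h'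
      · exact Or.inl (Or.inr ⟨hz, h, h'⟩)
      · exact Or.inr ⟨hz, h'⟩
  set G : W × ℝ × ℝ → ℝ≥0∞ := fun z => ENNReal.ofReal (derivNorm (foldDeriv D₀ D₁ z) ^ p)
  set μ := riemannianMeasure d W
  have bA : ∫⁻ z in A, G z ∂μ ≤ c * a * derivEnergy p D₀ := by
    refine (setLIntegral_mono' (g := fun z : W × ℝ × ℝ => (c : ℝ≥0∞) *
      ENNReal.ofReal (derivNorm (D₀ (z.1, foldLeft z.2)) ^ p)) mA fun z hz => ?_).trans ?_
    · have : foldDeriv D₀ D₁ z = _ := if_pos hz.2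
      simp only [G, this]
      exact hcomp _ (Or.inl rfl)
    · rw [lintegral_const_mul' _ _ ENNReal.coe_ne_top, mul_assoc]
      gcongr
      refine setLIntegral_comp_shiftEquiv_le ha mA hstrip (fun z hz => ?_)
        (fun z => ENNReal.ofReal (derivNorm (D₀ z) ^ p))
      have h1 := hz.1.2.1.1
      have h2 := hz.1.2.2.2
      have h3 : z.2.1 < z.2.2 / 2 := hz.2
      exact ⟨trivial, ⟨by simp only [foldLeft_apply]; linarith,
        by simp only [foldLeft_apply]; linarith⟩,
        ⟨by simp only [foldLeft_apply]; linarith, by simp only [foldLeft_apply]; linarith⟩⟩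
  have bA' : ∫⁻ z in A', G z ∂μ = 0 := by
    refine setLIntegral_eq_zero mA' fun z hz => ?_
    have h : z.2.1 = z.2.2 / 2 := hz.2
    have : foldDeriv D₀ D₁ z = 0 := by
      unfold foldDeriv
      rw [if_neg (by rw [h]; exact lt_irrefl _), if_pos h]
    simp [G, this, derivNorm, Real.zero_rpow (zero_lt_one.trans_le hp).ne']
  have bB : ∫⁻ z in B, G z ∂μ ≤ c * b * derivEnergy p D₁ := by
    refine (setLIntegral_mono' (g := fun z : W × ℝ × ℝ => (c : ℝ≥0∞) *
      ENNReal.ofReal (derivNorm (D₁ (z.1, foldMiddle z.2)) ^ p)) mB fun z hz => ?_).trans ?_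
    · have h : z.2.2 / 2 < z.2.1 := hz.2.1
      have h' : z.2.1 ≤ z.2.2 := hz.2.2
      have : foldDeriv D₀ D₁ z = D₁ (z.1, foldMiddle z.2) ∘ₗ
          LinearMap.prodMap LinearMap.id foldMiddle.toLinearMap := by
        unfold foldDeriv
        rw [if_neg h.not_gt, if_neg h.ne', if_pos h']
      simp only [G, this]
      exact hcomp _ (Or.inr rfl)
    · rw [lintegral_const_mul' _ _ ENNReal.coe_ne_top, mul_assoc]
      gcongr
      refine setLIntegral_comp_shiftEquiv_le hb mB hstrip (fun z hz => ?_)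
        (fun z => ENNReal.ofReal (derivNorm (D₁ z) ^ p))
      have h1 := hz.1.2.2.1
      have h2 := hz.1.2.2.2
      have h3 : z.2.2 / 2 < z.2.1 := hz.2.1
      have h4 : z.2.1 ≤ z.2.2 := hz.2.2
      exact ⟨trivial, ⟨by simp only [foldMiddle_apply]; linarith,
        by simp only [foldMiddle_apply]; linarith⟩,
        ⟨by simp only [foldMiddle_apply]; linarith, by simp only [foldMiddle_apply]; linarith⟩⟩
  have bC : ∫⁻ z in C, G z ∂μ ≤ derivEnergy p D₁ := by
    refine (setLIntegral_mono' (g := fun z => ENNReal.ofReal (derivNorm (D₁ z) ^ p)) mC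
      fun z hz => ?_).trans (lintegral_mono_set inter_subset_left)
    have h : z.2.2 < z.2.1 := hz.2
    have h' : z.2.2 / 2 < z.2.1 := by linarith [hz.1.2.2.1]
    have : foldDeriv D₀ D₁ z = D₁ z := by
      unfold foldDeriv
      rw [if_neg h'.not_gt, if_neg h'.ne', if_neg h.not_ge]
    simp only [G, this, le_refl]
  calc derivEnergy p (foldDeriv D₀ D₁) ≤ ∫⁻ z in ((A ∪ A') ∪ B) ∪ C, G z ∂μ :=
        lintegral_mono_set cover
    _ ≤ ((∫⁻ z in A, G z ∂μ + ∫⁻ z in A', G z ∂μ) + ∫⁻ z in B, G z ∂μ) + ∫⁻ z in C, G z ∂μ :=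
        (lintegral_union_le _ _ _).trans (add_le_add_left ((lintegral_union_le _ _ _).trans
          (add_le_add_left (lintegral_union_le _ _ _) _)) _)
    _ ≤ c * a * derivEnergy p D₀ + 0 + c * b * derivEnergy p D₁ + derivEnergy p D₁ := by
        rw [bA']; gcongr
    _ ≤ _ := by
        have e1 : (((c * a + c * b + 1 : ℝ≥0) : ℝ≥0) : ℝ≥0∞) = c * a + c * b + 1 := by push_cast; rfl
        rw [e1, mul_add, add_zero]
        have h1 : (c * a : ℝ≥0∞) * derivEnergy p D₀ ≤ (c * a + c * b + 1) * derivEnergy p D₀ := by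
          gcongr; rw [add_assoc]; exact le_self_add
        have h2 : (c * b : ℝ≥0∞) * derivEnergy p D₁ + derivEnergy p D₁
            ≤ (c * a + c * b + 1) * derivEnergy p D₁ := by
          rw [← add_one_mul]; gcongr; exact le_add_self
        rw [add_assoc]
        exact add_le_add h1 h2

variable {U₀ U₁ : W × ℝ × ℝ → F}
  {D₀ D₁ : (z : W × ℝ × ℝ) → (TangentSpace (𝓡 d) z.1 × ℝ × ℝ) →ₗ[ℝ] F}

/-- The folded map is weakly differentiable on the manifold as soon as the two maps are weakly
differentiable with finite energy and have the same trace on the bottom face. -/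
lemma isWeakDeriv_fold {p : ℝ} (hp : 1 ≤ p) (h₀ : IsWeakDeriv U₀ D₀) (h₁ : IsWeakDeriv U₁ D₁)
    (e₀ : derivEnergy p D₀ < ⊤) (e₁ : derivEnergy p D₁ < ⊤)
    (h : SameTrace d bottomFace U₀ U₁) : IsWeakDeriv (fold U₀ U₁) (foldDeriv D₀ D₁) := by
  intro φ hφ
  obtain ⟨v, t₀, t₁⟩ := h
  have := hasWeakDerivOn_fold φ.open_target (h₀ φ hφ) (h₁ φ hφ)
    (fun K hK hKc w => integrableOn_chart_of_derivEnergy_lt_top hp h₀ e₀ hφ hK hKc w)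
    (fun K hK hKc w => integrableOn_chart_of_derivEnergy_lt_top hp h₁ e₁ hφ hK hKc w)
    (t₀ φ hφ) (t₁ φ hφ)
  have e : chartFoldDeriv (chartDeriv φ D₀) (chartDeriv φ D₁) = chartDeriv φ (foldDeriv D₀ D₁) :=
    (chartDeriv_foldDeriv φ D₀ D₁).symm
  change HasWeakDerivOn _ (fold (fun u => U₀ (prodInv φ u)) (fun u => U₁ (prodInv φ u)))
    (chartFoldDeriv (chartDeriv φ D₀) (chartDeriv φ D₁)) at this
  rw [e] at this
  exact this

lemma sameTrace_fold_bottom (h : SameTrace d bottomFace U₀ U₁) :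
    SameTrace d bottomFace (fold U₀ U₁) U₀ ∧ SameTrace d bottomFace (fold U₀ U₁) U₁ := by
  obtain ⟨v, t₀, t₁⟩ := h
  have : IsTrace d bottomFace (fold U₀ U₁) v := fun φ hφ =>
    hasEdgeTrace_fold_bottom (f₀ := fun u => U₀ (prodInv φ u)) (f₁ := fun u => U₁ (prodInv φ u))
      (t₁ φ hφ)
  exact ⟨⟨v, this, t₀⟩, ⟨v, this, t₁⟩⟩

/-- Vertical derivatives do not depend on the chart. -/
lemma chartDeriv_apply_vertical (φ : OpenPartialHomeomorph W (EuclideanSpace ℝ (Fin d)))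
    (D : (z : W × ℝ × ℝ) → (TangentSpace (𝓡 d) z.1 × ℝ × ℝ) →ₗ[ℝ] F)
    (u : EuclideanSpace ℝ (Fin d) × ℝ × ℝ) (r : ℝ × ℝ) :
    chartDeriv φ D u (0, r) = D (prodInv φ u) (0, r) := by
  change D (prodInv φ u) (chartInvDeriv φ u.1 0, r) = _
  rw [map_zero]
  rfl

lemma sameTrace_fold_left [CompleteSpace F] {p : ℝ} (hp : 1 ≤ p) (h₀ : IsWeakDeriv U₀ D₀)
    (e₀ : derivEnergy p D₀ < ⊤) : SameTrace d leftFace (fold U₀ U₁) U₀ := by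
  set w : W × ℝ → F := fun q => edgeValue (fun s => U₀ (q.1, s, q.2))
    (fun s => D₀ (q.1, s, q.2) (0, 1, 0))
  have t : IsTrace d leftFace U₀ w := fun φ hφ => by
    have h := ((h₀ φ hφ).hasEdgeTrace φ.open_target fun K hK hKc v =>
      integrableOn_chart_of_derivEnergy_lt_top hp h₀ e₀ hφ hK hKc v).1
    change HasEdgeTrace _ _ (fun q : EuclideanSpace ℝ (Fin d) × ℝ => edgeValue (fun s => U₀ (φ.symm q.1, s, q.2))
      (fun s => chartDeriv φ D₀ (q.1, s, q.2) (0, 1, 0))) at h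
    simp only [chartDeriv_apply_vertical] at h
    exact h
  exact ⟨w, fun φ hφ => hasEdgeTrace_fold_left (f₀ := fun u => U₀ (prodInv φ u))
    (f₁ := fun u => U₁ (prodInv φ u)) φ.open_target (h₀ φ hφ).1 (t φ hφ), t⟩

lemma sameTrace_fold_right [CompleteSpace F] {p : ℝ} (hp : 1 ≤ p) (h₁ : IsWeakDeriv U₁ D₁)
    (e₁ : derivEnergy p D₁ < ⊤) : SameTrace d rightFace (fold U₀ U₁) U₁ := by
  set w : W × ℝ → F := fun q => edgeValue (fun s => U₁ (q.1, s, q.2))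
    (fun s => D₁ (q.1, s, q.2) (0, 1, 0)) + ∫ s in Ioo (0 : ℝ) 1, D₁ (q.1, s, q.2) (0, 1, 0)
  have t : IsTrace d rightFace U₁ w := fun φ hφ => by
    have h := ((h₁ φ hφ).hasEdgeTrace φ.open_target fun K hK hKc v =>
      integrableOn_chart_of_derivEnergy_lt_top hp h₁ e₁ hφ hK hKc v).2
    change HasEdgeTrace _ _ (fun q : EuclideanSpace ℝ (Fin d) × ℝ => edgeValue (fun s => U₁ (φ.symm q.1, s, q.2))
      (fun s => chartDeriv φ D₁ (q.1, s, q.2) (0, 1, 0)) +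
        ∫ s in Ioo (0 : ℝ) 1, chartDeriv φ D₁ (q.1, s, q.2) (0, 1, 0)) at h
    simp only [chartDeriv_apply_vertical] at h
    exact h
  exact ⟨w, fun φ hφ => hasEdgeTrace_fold_right (f₀ := fun u => U₀ (prodInv φ u))
    (f₁ := fun u => U₁ (prodInv φ u)) (t φ hφ), t⟩

/-- The energy bound passes to the infima over weak derivatives. If one of the energies is infinite
the bound is trivial, as `0 < C`. -/
lemma energy_fold_le {p : ℝ} (hp : 1 ≤ p) {C : ℝ≥0} (hC : 0 < C)
    (hE : ∀ D₀ D₁ : (z : W × ℝ × ℝ) → (TangentSpace (𝓡 d) z.1 × ℝ × ℝ) →ₗ[ℝ] F,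
      derivEnergy p (foldDeriv D₀ D₁) ≤ C * (derivEnergy p D₀ + derivEnergy p D₁))
    (h : SameTrace d bottomFace U₀ U₁) :
    energy d p (fold U₀ U₁) ≤ C * (energy d p U₀ + energy d p U₁) := by
  have key : ∀ D₀ D₁ : (z : W × ℝ × ℝ) → (TangentSpace (𝓡 d) z.1 × ℝ × ℝ) →ₗ[ℝ] F,
      IsWeakDeriv U₀ D₀ → IsWeakDeriv U₁ D₁ →
      energy d p (fold U₀ U₁) ≤ C * (derivEnergy p D₀ + derivEnergy p D₁) := by
    intro D₀ D₁ h₀ h₁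
    by_cases e : derivEnergy p D₀ < ⊤ ∧ derivEnergy p D₁ < ⊤
    · exact (iInf₂_le _ (isWeakDeriv_fold hp h₀ h₁ e.1 e.2 h)).trans (hE D₀ D₁)
    · have : derivEnergy p D₀ + derivEnergy p D₁ = ⊤ := by
        rw [ENNReal.add_eq_top]
        by_contra! hne
        exact e ⟨hne.1.lt_top, hne.2.lt_top⟩
      rw [this, ENNReal.mul_top (by exact_mod_cast hC.ne')]
      exact le_top
  have hC0 : (C : ℝ≥0∞) ≠ 0 := by exact_mod_cast hC.ne'
  rw [← ENNReal.div_le_iff' hC0 ENNReal.coe_ne_top, ← tsub_le_iff_right]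
  refine le_iInf₂ fun D₀ h₀ => ?_
  rw [tsub_le_iff_left, ← tsub_le_iff_right]
  refine le_iInf₂ fun D₁ h₁ => ?_
  rw [tsub_le_iff_left, ENNReal.div_le_iff' hC0 ENNReal.coe_ne_top]
  exact key D₀ D₁ h₀ h₁

end FoldDeriv

lemma comp_fold {α N N' : Type*} (ι : N → N') (U₀ U₁ : α × ℝ × ℝ → N) :
    ι ∘ fold U₀ U₁ = fold (ι ∘ U₀) (ι ∘ U₁) := by
  funext z
  simp only [Function.comp, fold]
  split_ifs <;> rfl

end SobolevFolding

end

open SobolevFolding in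
theorem proposition2p1 (p : ℝ) (hp : 1 ≤ p) :
    ∃ C : ℝ≥0,
      ∀ (d : ℕ) (W : Type*) [TopologicalSpace W] [T2Space W] [SecondCountableTopology W]
        [ChartedSpace (EuclideanSpace ℝ (Fin d)) W] [IsManifold (𝓡 d) ∞ W]
        [Bundle.RiemannianBundle (fun x : W => TangentSpace (𝓡 d) x)]
        [IsContMDiffRiemannianBundle (𝓡 d) ∞ (EuclideanSpace ℝ (Fin d))
          (fun x : W => TangentSpace (𝓡 d) x)]
        [MeasurableSpace W] [BorelSpace W]
        (n : ℕ) (N : Type*) [TopologicalSpace N]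
        [ChartedSpace (EuclideanSpace ℝ (Fin n)) N] [IsManifold (𝓡 n) ∞ N]
        [Bundle.RiemannianBundle (fun y : N => TangentSpace (𝓡 n) y)]
        [IsContMDiffRiemannianBundle (𝓡 n) ∞ (EuclideanSpace ℝ (Fin n))
          (fun y : N => TangentSpace (𝓡 n) y)]
        (ν : ℕ) (ι : N → EuclideanSpace ℝ (Fin ν)) (_ : IsIsometricEmbedding n ι)
        (U₀ U₁ : W × ℝ × ℝ → N),
        MemSobolev d p (ι ∘ U₀) → MemSobolev d p (ι ∘ U₁) →
        SameTrace d bottomFace (ι ∘ U₀) (ι ∘ U₁) →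
          MemSobolev d p (ι ∘ fold U₀ U₁) ∧
          SameTrace d bottomFace (ι ∘ fold U₀ U₁) (ι ∘ U₀) ∧
          SameTrace d bottomFace (ι ∘ fold U₀ U₁) (ι ∘ U₁) ∧
          SameTrace d leftFace (ι ∘ fold U₀ U₁) (ι ∘ U₀) ∧
          SameTrace d rightFace (ι ∘ fold U₀ U₁) (ι ∘ U₁) ∧
          energy d p (ι ∘ fold U₀ U₁) ≤
            C * (energy d p (ι ∘ U₀) + energy d p (ι ∘ U₁)) := by
  obtain ⟨C, hC, hE⟩ := exists_derivEnergy_foldDeriv_le p hp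
  refine ⟨C, ?_⟩
  intro d W _ _ _ _ _ _ _ _ _ n N _ _ _ _ _ ν ι _ U₀ U₁ m₀ m₁ htr
  rw [comp_fold]
  obtain ⟨D₀, h₀, e₀⟩ := m₀
  obtain ⟨D₁, h₁, e₁⟩ := m₁
  exact ⟨⟨foldDeriv D₀ D₁, isWeakDeriv_fold hp h₀ h₁ e₀ e₁ htr,
      (hE d W _ D₀ D₁).trans_lt (ENNReal.mul_lt_top ENNReal.coe_lt_top
        (ENNReal.add_lt_top.2 ⟨e₀, e₁⟩))⟩,
    (sameTrace_fold_bottom htr).1, (sameTrace_fold_bottom htr).2,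
    sameTrace_fold_left hp h₀ e₀, sameTrace_fold_right hp h₁ e₁,
    energy_fold_le hp hC (hE d W _) htr⟩
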